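/- Let $L$ be a positive self-adjoint operator in a complex Hilbert space $\mathfrak H$ (that is, $(Lu,u)\ge 0$ for all $u\in\mathcal D(L)$). Let $\mathfrak H_L$ be the Hilbert space obtained by completing $\mathcal D(L)$ with respect to $\|u\|_L^2=(Lu,u)$, let $H=\mathfrak H_L\oplus\mathfrak H$ be the energy space, and let $W(t)$, $t\in\mathbb R$, be the group of solutions of the Cauchy problem for $u_{tt}=-Lu$, i.e. the strongly continuous group of unitary operators in $H$ whose generator is given on $\mathcal D(L)\oplus\mathcal D(L)$ by $(u,v)\mapsto(v,-Lu)$. Let $\mathfrak H_0$ be a closed subspace of $\mathfrak H$ and let $B$ be a densely defined closed symmetric operator in $\mathfrak H_0$ which is simple (its restriction to any nonzero reducing subspace is not self-adjoint) and maximal, with zero defect number in $\mathbb C_+$, i.e. $\ker(B^*-iI)=\{0\}$. Assume that $L$ is an extension of $B^2$, where $\mathcal D(B^2)=\{u\in\mathcal D(B): Bu\in\mathcal D(B)\}$. Let $D_\pm$ be the closures in $H$ of the sets $\{(u,\pm iBu): u\in\mathcal D(B^2)\}$. Let $V$ be an isometric operator in $\mathfrak H_0$ that commutes with $B$: $V\mathcal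 D(B)\subset\mathcal D(B)$ and $VBu=BVu$ for all $u\in\mathcal D(B)$. Put $\mathfrak H_0^V=V\mathfrak H_0$, let $B_V=VBV^*$ be the operator in $\mathfrak H_0^V$ with domain $V\mathcal D(B)$, and let $D_\pm^V$ be the closures in $H$ of $\{(u,\pm iB_Vu): u\in\mathcal D(B_V^2)\}$. Let $T=(B-iI)(B+iI)^{-1}$ be the Cayley transform of $B$, a bounded operator on $\mathfrak H_0$. Suppose that at least one of the following conditions holds: (a) the nonzero defect number of $B$ is $1$, i.e. $\dim\ker(B^*+iI)=1$; (b) the subspace $\mathfrak H_0^V$ is hyperinvariant for $T$, i.e. it is invariant for every bounded operator in $\mathfrak H_0$ that commutes with $T$. Then $D_+$ and $D_+^V$ are asymptotically equivalent with respect to $W(t)$, and so are $D_-$ and $D_-^V$; that is, for each choice of sign, $$D_\pm\subset\bigvee_{t\in\mathbb R}W(t)D_\pm^V\qquad\text{and}\qquad D_\pm^V\subset\bigvee_{t\in\mathbb R}W(t)D_\pm ,$$ where $\bigvee$ denotes the closed linear span. Moreover, there is an inner function $\psi\in H^\infty(\mathbb C_+)$ such that $\mathfrak H_0^V=\psi(B)\mathfrak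 H_0$. Here $\psi(B)$ is the bounded operator $\varphi(T)=\operatorname{s-lim}_{r\to1-}\sum_{n\ge0}a_nr^nT^n$, where $\varphi(w)=\sum_{n\ge0}a_nw^n$ is the function on the unit disc with $\psi(z)=\varphi\left(\frac{z-i}{z+i}\right)$. -/

import Mathlib

open scoped InnerProductSpace Topology LinearPMap Nat

noncomputable section

/-! ### Unbounded operators in a Hilbert space -/

section Operators

variable {E F : Type*} [NormedAddCommGroup E] [InnerProductSpace ℂ E]
  [NormedAddCommGroup F] [InnerProductSpace ℂ F]

/-- The bounded operator `S` commutes with the (unbounded) operator `A`: for every `u ∈ 𝒟(A)`,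
`S u ∈ 𝒟(A)` and `A S u = S A u`. -/
def CommutesWith (S : E →L[ℂ] E) (A : E →ₗ.[ℂ] E) : Prop :=
  ∀ u : A.domain, ∃ h : S u ∈ A.domain, A ⟨S u, h⟩ = S (A u)

/-- The closed subspace `M` reduces `A`: the orthogonal projection onto `M` commutes with `A`. -/
def IsReducing (A : E →ₗ.[ℂ] E) (M : Submodule ℂ E) [CompleteSpace M] : Prop :=
  CommutesWith M.starProjection A

theorem IsReducing.map_mem {A : E →ₗ.[ℂ] E} {M : Submodule ℂ E} [CompleteSpace M]
    (h : IsReducing A M) (u : A.domain) (hu : (u : E) ∈ M) : A u ∈ M := by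
  obtain ⟨h1, h2⟩ := h u
  have h3 : M.starProjection (u : E) = u := Submodule.starProjection_eq_self_iff.2 hu
  have h4 : (⟨M.starProjection (u : E), h1⟩ : A.domain) = u := Subtype.ext h3
  rw [h4] at h2
  rw [h2]
  exact Submodule.starProjection_apply_mem _ _

/-- The restriction of `A` to a reducing subspace `M`, an operator in the Hilbert space `M` with
domain `𝒟(A) ∩ M`. -/
def restrictReducing (A : E →ₗ.[ℂ] E) (M : Submodule ℂ E) [CompleteSpace M]
    (h : IsReducing A M) : M →ₗ.[ℂ] M where
  domain := A.domain.comap M.subtype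
  toFun :=
    { toFun := fun u => ⟨A ⟨(u : M), u.2⟩, h.map_mem ⟨(u : M), u.2⟩ (u : M).2⟩
      map_add' := fun u v => Subtype.ext (A.map_add ⟨(u : M), u.2⟩ ⟨(v : M), v.2⟩)
      map_smul' := fun c u => Subtype.ext (A.map_smul c ⟨(u : M), u.2⟩) }

/-- The defect subspace `ker (A* - z I)`. -/
def defectSpace [CompleteSpace E] (A : E →ₗ.[ℂ] E) (z : ℂ) : Submodule ℂ E :=
  (LinearMap.ker (A†.toFun - z • A†.domain.subtype)).map A†.domain.subtype

/-- `B` is a densely defined, closed, simple maximal symmetric operator, the defect number in the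
upper half-plane, `dim ker (B* - i I)`, being zero. -/
structure IsSimpleMaximalSymmetric [CompleteSpace E] (B : E →ₗ.[ℂ] E) : Prop where
  dense : Dense (B.domain : Set E)
  symmetric : ∀ u v : B.domain, ⟪B u, (v : E)⟫_ℂ = ⟪(u : E), B v⟫_ℂ
  closed : B.IsClosed
  simple : ∀ (M : Submodule ℂ E) [CompleteSpace M], M ≠ ⊥ →
    ∀ h : IsReducing B M, ¬ IsSelfAdjoint (restrictReducing B M h)
  defect : defectSpace B Complex.I = ⊥

/-- The operator `U A U⁻¹` in `F`, with domain `U 𝒟(A)`, for a unitary map `U` from `E`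
onto `F`. -/
def conjOperator (U : E ≃ₗᵢ[ℂ] F) (A : E →ₗ.[ℂ] E) : F →ₗ.[ℂ] F where
  domain := A.domain.comap (U.symm.toLinearEquiv : F →ₗ[ℂ] E)
  toFun :=
    { toFun := fun w => U (A ⟨U.symm (w : F), w.2⟩)
      map_add' := fun w w' => by
        rw [← map_add, ← A.map_add]
        congr 3
        exact U.symm.map_add _ _
      map_smul' := fun c w => by
        rw [RingHom.id_apply, ← map_smul, ← A.map_smul]
        congr 3
        exact U.symm.map_smul _ _ }

/-! ### The Cayley transform -/

/-- The linear map `u ↦ B u + z u` on `𝒟(B)`. -/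
def shiftedMap (B : E →ₗ.[ℂ] E) (z : ℂ) : B.domain →ₗ[ℂ] E :=
  B.toFun + z • B.domain.subtype

theorem shiftedMap_apply (B : E →ₗ.[ℂ] E) (z : ℂ) (u : B.domain) :
    shiftedMap B z u = B u + z • (u : E) := rfl

variable [CompleteSpace E] {B : E →ₗ.[ℂ] E}

theorem IsSimpleMaximalSymmetric.inner_im (hB : IsSimpleMaximalSymmetric B) (u : B.domain) :
    (⟪B u, (u : E)⟫_ℂ).im = 0 := by
  have h1 : (starRingEnd ℂ) ⟪B u, (u : E)⟫_ℂ = ⟪B u, (u : E)⟫_ℂ := by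
    rw [inner_conj_symm]; exact (hB.symmetric u u).symm
  exact Complex.conj_eq_iff_im.1 h1

theorem IsSimpleMaximalSymmetric.norm_sq_shifted (hB : IsSimpleMaximalSymmetric B)
    (u : B.domain) (s : ℝ) (hs : s ^ 2 = 1) :
    ‖shiftedMap B (s * Complex.I) u‖ ^ 2 = ‖B u‖ ^ 2 + ‖(u : E)‖ ^ 2 := by
  have h := hB.inner_im u
  have hn : ‖((s : ℂ) * Complex.I)‖ = |s| := by simp
  rw [shiftedMap_apply, @norm_add_sq ℂ, inner_smul_right, norm_smul, hn, mul_pow, sq_abs, hs]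
  simp [h]

theorem IsSimpleMaximalSymmetric.norm_shifted_eq (hB : IsSimpleMaximalSymmetric B)
    (u : B.domain) : ‖shiftedMap B (-Complex.I) u‖ = ‖shiftedMap B Complex.I u‖ := by
  have h1 := hB.norm_sq_shifted u 1 (by norm_num)
  have h2 := hB.norm_sq_shifted u (-1) (by norm_num)
  simp only [Complex.ofReal_one, Complex.ofReal_neg, one_mul, neg_mul] at h1 h2
  exact (sq_eq_sq₀ (norm_nonneg _) (norm_nonneg _)).1 (h2.trans h1.symm)

theorem IsSimpleMaximalSymmetric.norm_sq_shifted_I (hB : IsSimpleMaximalSymmetric B)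
    (u : B.domain) : ‖shiftedMap B Complex.I u‖ ^ 2 = ‖B u‖ ^ 2 + ‖(u : E)‖ ^ 2 := by
  have h1 := hB.norm_sq_shifted u 1 (by norm_num)
  simpa only [Complex.ofReal_one, one_mul] using h1

theorem IsSimpleMaximalSymmetric.injective (hB : IsSimpleMaximalSymmetric B) :
    Function.Injective (shiftedMap B Complex.I) := by
  rw [injective_iff_map_eq_zero]
  intro u hu
  have h := hB.norm_sq_shifted_I u
  rw [hu, norm_zero] at h
  have h0 : ‖(u : E)‖ = 0 := by nlinarith [sq_nonneg ‖B u‖, sq_nonneg ‖(u : E)‖]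
  exact Subtype.ext (norm_eq_zero.1 h0)

theorem IsSimpleMaximalSymmetric.surjective (hB : IsSimpleMaximalSymmetric B) :
    Function.Surjective (shiftedMap B Complex.I) := by
  have hcl : IsClosed (LinearMap.range (shiftedMap B Complex.I) : Set E) := by
    have hg : CompleteSpace B.graph := IsClosed.completeSpace_coe (hs := hB.closed)
    let f : B.graph →L[ℂ] E :=
      ((ContinuousLinearMap.snd ℂ E E) + Complex.I • (ContinuousLinearMap.fst ℂ E E)).comp
        B.graph.subtypeL
    have hf : AntilipschitzWith 1 f := by
      refine AddMonoidHomClass.antilipschitz_of_bound f (fun x => ?_)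
      obtain ⟨u, hu1, hu2⟩ := (LinearPMap.mem_graph_iff B).1 x.2
      have hfx : f x = shiftedMap B Complex.I u := by
        rw [shiftedMap_apply, hu1, hu2]; rfl
      have h := hB.norm_sq_shifted_I u
      have hx : ‖x‖ = max ‖(u : E)‖ ‖B u‖ := by
        rw [hu1, hu2]; rfl
      rw [hfx, hx, NNReal.coe_one, one_mul]
      refine max_le ?_ ?_
      · exact abs_le_of_sq_le_sq' (by nlinarith [sq_nonneg ‖B u‖]) (norm_nonneg _) |>.2
      · exact abs_le_of_sq_le_sq' (by nlinarith [sq_nonneg ‖(u : E)‖]) (norm_nonneg _) |>.2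
    have hr : (LinearMap.range (shiftedMap B Complex.I) : Set E) = Set.range f := by
      ext y
      constructor
      · rintro ⟨u, rfl⟩
        exact ⟨⟨((u : E), B u), B.mem_graph u⟩, rfl⟩
      · rintro ⟨x, rfl⟩
        obtain ⟨u, hu1, hu2⟩ := (LinearPMap.mem_graph_iff B).1 x.2
        refine ⟨u, ?_⟩
        rw [shiftedMap_apply, hu1, hu2]; rfl
    rw [hr]
    exact hf.isClosed_range f.uniformContinuous
  have : CompleteSpace (LinearMap.range (shiftedMap B Complex.I)) :=
    IsClosed.completeSpace_coe (hs := hcl)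
  rw [← LinearMap.range_eq_top, ← Submodule.orthogonal_eq_bot_iff, Submodule.eq_bot_iff]
  intro v hv
  have hv' : ∀ u : B.domain, ⟪Complex.I • v, (u : E)⟫_ℂ = ⟪v, B u⟫_ℂ := by
    intro u
    have h := Submodule.inner_left_of_mem_orthogonal (LinearMap.mem_range_self _ u) hv
    rw [shiftedMap_apply, inner_add_right, inner_smul_right] at h
    rw [inner_smul_left, Complex.conj_I]
    linear_combination -h
  have hd : v ∈ B†.domain := LinearPMap.mem_adjoint_domain_of_exists v ⟨_, hv'⟩
  have he : B† ⟨v, hd⟩ = Complex.I • v := LinearPMap.adjoint_apply_eq hB.dense ⟨v, hd⟩ hv'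
  have hm : v ∈ defectSpace B Complex.I := by
    refine ⟨⟨v, hd⟩, ?_, rfl⟩
    simp only [SetLike.mem_coe, LinearMap.mem_ker, LinearMap.sub_apply, LinearMap.smul_apply,
      Submodule.subtype_apply, sub_eq_zero]
    exact he
  rw [hB.defect] at hm
  exact hm

/-- The bijection `B + i I` of `𝒟(B)` onto the whole space. -/
def addIEquiv (hB : IsSimpleMaximalSymmetric B) : B.domain ≃ₗ[ℂ] E :=
  LinearEquiv.ofBijective (shiftedMap B Complex.I) ⟨hB.injective, hB.surjective⟩

/-- The Cayley transform `T = (B - i I)(B + i I)⁻¹`. -/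
def cayleyTransform (hB : IsSimpleMaximalSymmetric B) : E →L[ℂ] E :=
  LinearMap.mkContinuous
    ((shiftedMap B (-Complex.I)).comp (addIEquiv hB).symm.toLinearMap) 1 (fun x => by
      have h := hB.norm_shifted_eq ((addIEquiv hB).symm x)
      have h' : shiftedMap B Complex.I ((addIEquiv hB).symm x) = x :=
        (addIEquiv hB).apply_symm_apply x
      rw [h'] at h
      rw [one_mul]
      exact h.le)

theorem cayleyTransform_apply (hB : IsSimpleMaximalSymmetric B) (u : B.domain) :
    cayleyTransform hB (B u + Complex.I • (u : E)) = B u - Complex.I • (u : E) := by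
  have h : (addIEquiv hB).symm (B u + Complex.I • (u : E)) = u :=
    (addIEquiv hB).symm_apply_apply u
  change shiftedMap B (-Complex.I) ((addIEquiv hB).symm (B u + Complex.I • (u : E))) = _
  rw [h, shiftedMap_apply, neg_smul, sub_eq_add_neg]

/-- The subspace `M` is hyperinvariant for `T`: it is invariant for every bounded operator that
commutes with `T`. -/
def IsHyperinvariant (M : Submodule ℂ E) (T : E →L[ℂ] E) : Prop :=
  ∀ S : E →L[ℂ] E, Commute S T → ∀ x ∈ M, S x ∈ M

/-! ### Inner functions of `B` -/

/-- `ψ` is an inner function of the upper half-plane: it is holomorphic and bounded there, and the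
modulus of its boundary values is `1` almost everywhere on the real line. -/
structure IsInnerUpperHalfPlane (ψ : ℂ → ℂ) : Prop where
  holomorphic : DifferentiableOn ℂ ψ {z : ℂ | 0 < z.im}
  bounded : ∃ C : ℝ, ∀ z : ℂ, 0 < z.im → ‖ψ z‖ ≤ C
  boundary : ∀ᵐ x : ℝ, Filter.Tendsto (fun y : ℝ => ‖ψ (x + y * Complex.I)‖) (𝓝[>] 0) (𝓝 1)

/-- The `n`-th Taylor coefficient at `0` of the function `φ` of the unit disc given by
`ψ z = φ ((z - i) / (z + i))`, that is, `φ w = ψ (i (1 + w) / (1 - w))`. -/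
def discCoeff (ψ : ℂ → ℂ) (n : ℕ) : ℂ :=
  iteratedDeriv n (fun w : ℂ => ψ (Complex.I * (1 + w) / (1 - w))) 0 / (n ! : ℂ)

/-- The bounded operator `S` is `ψ(B)`. Here `ψ(B) = φ(T)`, where `T` is the Cayley transform of
`B`, `ψ z = φ ((z - i) / (z + i))`, and `φ(T)` is the strong limit, as `r` tends to `1` from below,
of `φ(rT) = ∑ aₙ rⁿ Tⁿ`, where `φ w = ∑ aₙ wⁿ` in the unit disc. -/
def IsFunctionOf (hB : IsSimpleMaximalSymmetric B) (ψ : ℂ → ℂ) (S : E →L[ℂ] E) : Prop :=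
  ∀ x : E, Filter.Tendsto
    (fun r : ℝ => ∑' n : ℕ, (discCoeff ψ n * (r : ℂ) ^ n) • (cayleyTransform hB ^ n) x)
    (𝓝[<] 1) (𝓝 (S x))

end Operators

/-! ### The energy space and the group of the abstract wave equation -/

section Energy

variable {𝔥 : Type*} [NormedAddCommGroup 𝔥] [InnerProductSpace ℂ 𝔥] [CompleteSpace 𝔥]

/-- `L` is a positive self-adjoint operator. -/
structure IsPositiveSelfAdjoint (L : 𝔥 →ₗ.[ℂ] 𝔥) : Prop where
  selfAdjoint : IsSelfAdjoint L
  nonneg : ∀ u : L.domain, 0 ≤ (⟪L u, (u : 𝔥)⟫_ℂ).re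

variable {L : 𝔥 →ₗ.[ℂ] 𝔥}

theorem IsPositiveSelfAdjoint.symmetric (hL : IsPositiveSelfAdjoint L) (u v : L.domain) :
    ⟪L u, (v : 𝔥)⟫_ℂ = ⟪(u : 𝔥), L v⟫_ℂ := by
  have h := LinearPMap.adjoint_isFormalAdjoint hL.selfAdjoint.dense_domain
  rw [LinearPMap.isSelfAdjoint_def.1 hL.selfAdjoint] at h
  exact h u v

/-- The domain of `L`, to be equipped with the energy inner product. -/
def EnergyDomain (_hL : IsPositiveSelfAdjoint L) : Type _ := L.domain

variable (hL : IsPositiveSelfAdjoint L)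

instance EnergyDomain.instAddCommGroup : AddCommGroup (EnergyDomain hL) :=
  inferInstanceAs (AddCommGroup L.domain)

instance EnergyDomain.instModule : Module ℂ (EnergyDomain hL) :=
  inferInstanceAs (Module ℂ L.domain)

/-- The identity map from `𝒟(L)` with the energy inner product to the plain submodule `𝒟(L)`. -/
def EnergyDomain.toDomain : EnergyDomain hL ≃ₗ[ℂ] L.domain := LinearEquiv.refl ℂ L.domain

/-- The energy inner product `(L u, v)` on `𝒟(L)`. -/
@[reducible]
def energyCore : PreInnerProductSpace.Core ℂ (EnergyDomain hL) where
  inner u v := ⟪L (EnergyDomain.toDomain hL u), (EnergyDomain.toDomain hL v : 𝔥)⟫_ℂ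
  conj_inner_symm u v := by
    rw [inner_conj_symm]
    exact (hL.symmetric _ _).symm
  re_inner_nonneg u := hL.nonneg _
  add_left u v w := by rw [map_add, L.map_add, inner_add_left]
  smul_left u v c := by rw [map_smul, L.map_smul, inner_smul_left]

instance EnergyDomain.instSeminormedAddCommGroup : SeminormedAddCommGroup (EnergyDomain hL) :=
  @InnerProductSpace.Core.toSeminormedAddCommGroup ℂ (EnergyDomain hL) _ _ _ (energyCore hL)

instance EnergyDomain.instInnerProductSpace : InnerProductSpace ℂ (EnergyDomain hL) :=
  InnerProductSpace.ofCore (energyCore hL)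

/-- The energy space `H = 𝔥_L ⊕ 𝔥`, where `𝔥_L` is the completion of `𝒟(L)` with respect to the
norm `‖u‖_L² = (L u, u)`. -/
abbrev EnergySpace : Type _ :=
  WithLp 2 (UniformSpace.Completion (EnergyDomain hL) × 𝔥)

/-- The element of the energy space with components `u ∈ 𝒟(L)` and `v ∈ 𝔥`. -/
def energyVec (u : L.domain) (v : 𝔥) : EnergySpace hL :=
  WithLp.toLp 2
    (((EnergyDomain.toDomain hL).symm u : UniformSpace.Completion (EnergyDomain hL)), v)

/-- `W` is the group of solutions of the Cauchy problem for `u_tt = -L u`: it is a strongly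
continuous one-parameter group of unitary operators in the energy space, and its generator is given
on `𝒟(L) ⊕ 𝒟(L)` by `(u, v) ↦ (v, -L u)`. Since this operator is essentially skew-adjoint, `W` is
uniquely determined. -/
structure IsWaveGroup (W : ℝ → (EnergySpace hL ≃ₗᵢ[ℂ] EnergySpace hL)) : Prop where
  zero : ∀ x, W 0 x = x
  add : ∀ s t x, W (s + t) x = W s (W t x)
  continuous : ∀ x, Continuous fun t => W t x
  generator : ∀ u v : L.domain,
    HasDerivAt (fun t => W t (energyVec hL u v)) (energyVec hL v (-L u)) 0

/-- The closed linear span of the sets `W t D`, `t ∈ ℝ`. -/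
def orbitSpan {H : Type*} [NormedAddCommGroup H] [InnerProductSpace ℂ H]
    (W : ℝ → (H ≃ₗᵢ[ℂ] H)) (D : Set H) : Submodule ℂ H :=
  (Submodule.span ℂ (⋃ t : ℝ, W t '' D)).topologicalClosure

/-- `D` and `D'` are asymptotically equivalent with respect to `W`. -/
def AsymptoticallyEquivalent {H : Type*} [NormedAddCommGroup H] [InnerProductSpace ℂ H]
    (W : ℝ → (H ≃ₗᵢ[ℂ] H)) (D D' : Set H) : Prop :=
  D ⊆ orbitSpan W D' ∧ D' ⊆ orbitSpan W D

/-- `L` is an extension (with exit to `𝔥`) of `B²`, where `B` acts in the subspace `K` of `𝔥` and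
`𝒟(B²)` consists of all `u ∈ 𝒟(B)` with `B u ∈ 𝒟(B)`. -/
def ExtendsSquare (L : 𝔥 →ₗ.[ℂ] 𝔥) {K : Submodule ℂ 𝔥} (B : K →ₗ.[ℂ] K) : Prop :=
  ∀ (u : B.domain) (hu : B u ∈ B.domain),
    ∃ h : ((u : K) : 𝔥) ∈ L.domain, L ⟨((u : K) : 𝔥), h⟩ = (B ⟨B u, hu⟩ : K)

/-- The closure in the energy space of the set of all `(u, c B u)`, `u ∈ 𝒟(B²)`. Vectors
`u ∈ 𝒟(B²)` belong to `𝒟(L)` when `L` is an extension of `B²`. -/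
def waveSubspace {K : Submodule ℂ 𝔥} (B : K →ₗ.[ℂ] K) (c : ℂ) : Set (EnergySpace hL) :=
  closure {x | ∃ u : B.domain, B u ∈ B.domain ∧ ∃ h : ((u : K) : 𝔥) ∈ L.domain,
    x = energyVec hL ⟨((u : K) : 𝔥), h⟩ (c • ((B u : K) : 𝔥))}

/-- The outgoing subspace `D₊`, the closure of the set of all `(u, i B u)`, `u ∈ 𝒟(B²)`. -/
def outgoingSubspace {K : Submodule ℂ 𝔥} (B : K →ₗ.[ℂ] K) : Set (EnergySpace hL) :=
  waveSubspace hL B Complex.I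

/-- The incoming subspace `D₋`, the closure of the set of all `(u, -i B u)`, `u ∈ 𝒟(B²)`. -/
def incomingSubspace {K : Submodule ℂ 𝔥} (B : K →ₗ.[ℂ] K) : Set (EnergySpace hL) :=
  waveSubspace hL B (-Complex.I)

/-- The subspace `V K` of `𝔥`, for an isometric operator `V` in `K ⊆ 𝔥`. -/
def rangeSubspace {K : Submodule ℂ 𝔥} (V : K →ₗᵢ[ℂ] K) : Submodule ℂ 𝔥 :=
  LinearMap.range (K.subtypeₗᵢ.comp V).toLinearMap

/-- The operator `B_V = V B V*` in the Hilbert space `V K`, with domain `V 𝒟(B)`. -/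
def transformedOperator {K : Submodule ℂ 𝔥} (B : K →ₗ.[ℂ] K) (V : K →ₗᵢ[ℂ] K) :
    rangeSubspace V →ₗ.[ℂ] rangeSubspace V :=
  conjOperator (K.subtypeₗᵢ.comp V).equivRange B

end Energy

end

/-! The Cayley transform `T` of `B` is an isometry, and simplicity of `B` makes it pure: in the Wold
decomposition a unitary part of `T` would produce a self-adjoint part of `B`. So `T` is a unilateral
shift with wandering subspace `N = ker (B* + i)`, and `V`, commuting with `B`, commutes with `T`.

The core is that the range of `V` is the range of some `S = φ(T)` with `φ` inner. If `dim N = 1`,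
`V` is itself such a function: the coefficients of `φ` are those of `V e` in the basis `Tⁿ e`, for a
unit vector `e` of `N`. If the range of `V` is hyperinvariant, it is preserved by the operators `x ↦
∑ (Tⁿ e, x) Tⁿ f`, with `e`, `f` unit vectors in `N`, since these commute with `T`; they carry one
scalar function `φ`, found along one direction of `N`, to all other directions. The bound `|φ| ≤ 1`
comes from reproducing kernels (`norm_powerSum_le_one`), and `φ(rT)` converges strongly to an
isometry by von Neumann's inequality (`exists_isometry_of_abelSum`).

For the equivalence, `D±` is the closure of the vectors `J x = (u, ±i B u)` with `u = (I - T)² x`.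
Then `J T = U J`, where `U` is the unitary Cayley transform of the generator of `W(t)` (of `W(-t)`
for the minus sign), and `‖J S x‖ = ‖J x‖`. The inclusion of `D±^V` in `D±` is immediate. Conversely
`J S x` lies in `D±^V`; since `φ(rU) J x` tends to `J S x` and `φ(rU)` is normal, `φ(rU)* J S x`
tends to `J x`, so `J x` lies in every closed `W`-invariant subspace that contains `J S x`
(`mem_of_abelSum_mem`).

That `φ` has boundary values of modulus one is Fatou's theorem: a primitive of `φ` is Lipschitz up
to the boundary, hence differentiable almost everywhere there, and the derivative is a nontangential
limit. Parseval's identity and `∑ ‖aₙ‖² = 1` force its modulus to be `1`. -/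

noncomputable section

/-! ### Isometries and wandering subspaces -/

section Isometry

variable {E : Type*} [NormedAddCommGroup E] [InnerProductSpace ℂ E]

/-- The wandering subspace `(T E)ᗮ` of an isometry `T`. -/
def wandering (T : E →L[ℂ] E) : Submodule ℂ E := (LinearMap.range T.toLinearMap)ᗮ

theorem mem_wandering_iff {T : E →L[ℂ] E} {c : E} :
    c ∈ wandering T ↔ ∀ x, ⟪T x, c⟫_ℂ = 0 := by
  simp [wandering, Submodule.mem_orthogonal]

/-- An isometry is pure if the subspaces `T ^ n N`, `N` being its wandering subspace, span the
whole space. -/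
def IsPure (T : E →L[ℂ] E) : Prop :=
  ∀ x, (∀ n : ℕ, ∀ c ∈ wandering T, ⟪(T ^ n) c, x⟫_ℂ = 0) → x = 0

variable {T : E →L[ℂ] E}

theorem inner_map_of_norm_eq {F : Type*} [NormedAddCommGroup F] [InnerProductSpace ℂ F]
    {J : E →L[ℂ] F} (hJ : ∀ x, ‖J x‖ = ‖x‖) (x y : E) : ⟪J x, J y⟫_ℂ = ⟪x, y⟫_ℂ :=
  LinearIsometry.inner_map_map (⟨J.toLinearMap, hJ⟩ : E →ₗᵢ[ℂ] F) x y

theorem pow_succ_apply_left (T : E →L[ℂ] E) (n : ℕ) (x : E) : (T ^ (n + 1)) x = T ((T ^ n) x) := by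
  rw [pow_succ']; rfl

theorem pow_succ_apply_right (T : E →L[ℂ] E) (n : ℕ) (x : E) :
    (T ^ (n + 1)) x = (T ^ n) (T x) := by
  rw [pow_succ]; rfl

theorem norm_pow_apply (hT : ∀ x, ‖T x‖ = ‖x‖) (n : ℕ) (x : E) : ‖(T ^ n) x‖ = ‖x‖ := by
  induction n with
  | zero => simp
  | succ n ih => rw [pow_succ_apply_left, hT, ih]

theorem inner_pow_apply (hT : ∀ x, ‖T x‖ = ‖x‖) (n : ℕ) (x y : E) :
    ⟪(T ^ n) x, (T ^ n) y⟫_ℂ = ⟪x, y⟫_ℂ :=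
  inner_map_of_norm_eq (norm_pow_apply hT n) x y

/-- Cancelling the smaller power leaves a vector of `N` paired with a vector in the range of `T`. -/
theorem inner_pow_wandering (hT : ∀ x, ‖T x‖ = ‖x‖) {b c : E} (hb : b ∈ wandering T)
    (hc : c ∈ wandering T) {m n : ℕ} (hmn : m ≠ n) : ⟪(T ^ m) b, (T ^ n) c⟫_ℂ = 0 := by
  rcases lt_or_gt_of_ne hmn with h | h
  · obtain ⟨k, rfl⟩ := Nat.exists_eq_add_of_lt h
    rw [add_assoc, pow_add, mul_apply_eq_comp, inner_pow_apply hT, pow_succ_apply_left,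
      ← inner_conj_symm, mem_wandering_iff.1 hb, map_zero]
  · obtain ⟨k, rfl⟩ := Nat.exists_eq_add_of_lt h
    rw [add_assoc, pow_add, mul_apply_eq_comp, inner_pow_apply hT, pow_succ_apply_left,
      mem_wandering_iff.1 hc]

theorem orthonormal_pow (hT : ∀ x, ‖T x‖ = ‖x‖) {e : E} (he : e ∈ wandering T) (h1 : ‖e‖ = 1) :
    Orthonormal ℂ (fun n : ℕ => (T ^ n) e) :=
  ⟨fun n => by rw [norm_pow_apply hT, h1], fun _ _ h => inner_pow_wandering hT he he h⟩

end Isometry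

/-! ### The Cayley transform is a pure isometry -/

section Cayley

variable {E : Type*} [NormedAddCommGroup E] [InnerProductSpace ℂ E] [CompleteSpace E]
  {B : E →ₗ.[ℂ] E}

theorem norm_cayleyTransform (hB : IsSimpleMaximalSymmetric B) (x : E) :
    ‖cayleyTransform hB x‖ = ‖x‖ := by
  obtain ⟨u, rfl⟩ := hB.surjective x
  have := hB.norm_shifted_eq u
  simp only [shiftedMap_apply, neg_smul, ← sub_eq_add_neg] at this ⊢
  rw [cayleyTransform_apply, this]

/-- For `x = (B + i) u` one has `x - T x = 2i u` and `x + T x = 2 B u`. Thus `I - T` parametrises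
the domain of `B`, and `B` becomes `x - T x ↦ i (x + T x)`. -/
theorem sub_cayleyTransform_mem (hB : IsSimpleMaximalSymmetric B) (x : E) :
    x - cayleyTransform hB x ∈ B.domain := by
  obtain ⟨u, rfl⟩ := hB.surjective x
  rw [shiftedMap_apply, cayleyTransform_apply]
  have : B u + Complex.I • (u : E) - (B u - Complex.I • (u : E)) = (2 * Complex.I) • (u : E) := by
    module
  rw [this]
  exact B.domain.smul_mem _ u.2

theorem apply_sub_cayleyTransform (hB : IsSimpleMaximalSymmetric B) (x : E)
    (h : x - cayleyTransform hB x ∈ B.domain) :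
    B ⟨x - cayleyTransform hB x, h⟩ = Complex.I • (x + cayleyTransform hB x) := by
  obtain ⟨u, rfl⟩ := hB.surjective x
  have h2 : (⟨shiftedMap B Complex.I u - cayleyTransform hB (shiftedMap B Complex.I u), h⟩ :
      B.domain) = (2 * Complex.I) • u := by
    ext
    simp only [shiftedMap_apply, cayleyTransform_apply, Submodule.coe_smul]
    module
  rw [h2, B.map_smul, shiftedMap_apply, cayleyTransform_apply]
  module

theorem exists_eq_sub_cayleyTransform (hB : IsSimpleMaximalSymmetric B) (u : B.domain) :
    ∃ x, (u : E) = x - cayleyTransform hB x := by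
  refine ⟨(2 * Complex.I)⁻¹ • (B u + Complex.I • (u : E)), ?_⟩
  rw [map_smul, cayleyTransform_apply, ← smul_sub]
  have : B u + Complex.I • (u : E) - (B u - Complex.I • (u : E)) = (2 * Complex.I) • (u : E) := by
    module
  rw [this, smul_smul, inv_mul_cancel₀ (by simp), one_smul]

theorem cayleyTransform_comm (hB : IsSimpleMaximalSymmetric B) {S : E →L[ℂ] E}
    (h : CommutesWith S B) (x : E) : cayleyTransform hB (S x) = S (cayleyTransform hB x) := by
  obtain ⟨u, rfl⟩ := hB.surjective x
  obtain ⟨h1, h2⟩ := h u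
  have := cayleyTransform_apply hB ⟨S u, h1⟩
  rw [h2] at this
  rw [shiftedMap_apply, cayleyTransform_apply, map_sub, map_add, map_smul]
  exact this

theorem commutesWith_of_cayleyTransform_comm (hB : IsSimpleMaximalSymmetric B) {S : E →L[ℂ] E}
    (h : ∀ x, cayleyTransform hB (S x) = S (cayleyTransform hB x)) : CommutesWith S B := by
  intro u
  obtain ⟨x, hx⟩ := exists_eq_sub_cayleyTransform hB u
  have h1 : S u = S x - cayleyTransform hB (S x) := by rw [hx, map_sub, h]
  have h2 : S u ∈ B.domain := h1 ▸ sub_cayleyTransform_mem hB (S x)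
  refine ⟨h2, ?_⟩
  have h3 : (⟨S u, h2⟩ : B.domain) = ⟨_, sub_cayleyTransform_mem hB (S x)⟩ := Subtype.ext h1
  have h4 : u = ⟨_, sub_cayleyTransform_mem hB x⟩ := Subtype.ext hx
  rw [h3, apply_sub_cayleyTransform]
  conv_rhs => rw [h4]
  rw [apply_sub_cayleyTransform, map_smul, map_add, h]

/-- The kernel of `B* + i` is the orthogonal complement of the range of `B - i`, which is the range
of `T`. -/
theorem defectSpace_eq_wandering (hB : IsSimpleMaximalSymmetric B) :
    defectSpace B (-Complex.I) = wandering (cayleyTransform hB) := by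
  have key : ∀ v : E, v ∈ wandering (cayleyTransform hB) ↔
      ∀ u : B.domain, ⟪-Complex.I • v, (u : E)⟫_ℂ = ⟪v, B u⟫_ℂ := by
    intro v
    have h0 : ∀ u : B.domain, ⟪-Complex.I • v, (u : E)⟫_ℂ = ⟪v, B u⟫_ℂ ↔
        ⟪cayleyTransform hB (B u + Complex.I • (u : E)), v⟫_ℂ = 0 := by
      intro u
      rw [cayleyTransform_apply, ← inner_conj_symm (_ - _), map_eq_zero, inner_sub_right,
        inner_smul_right, inner_smul_left, map_neg, Complex.conj_I, neg_neg, sub_eq_zero]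
      exact eq_comm
    rw [mem_wandering_iff]
    refine ⟨fun h u => (h0 u).2 (h _), fun h x => ?_⟩
    obtain ⟨u, rfl⟩ := hB.surjective x
    exact (h0 u).1 (h u)
  ext v
  rw [key]
  constructor
  · rintro ⟨w, hw, rfl⟩ u
    simp only [SetLike.mem_coe, LinearMap.mem_ker, LinearMap.sub_apply, LinearMap.smul_apply,
      Submodule.subtype_apply, sub_eq_zero] at hw
    have := LinearPMap.adjoint_isFormalAdjoint hB.dense w u
    rw [show B† w = -Complex.I • (w : E) from hw] at this
    exact this
  · intro h
    have hd : v ∈ B†.domain := LinearPMap.mem_adjoint_domain_of_exists v ⟨_, h⟩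
    have he : B† ⟨v, hd⟩ = -Complex.I • v := LinearPMap.adjoint_apply_eq hB.dense ⟨v, hd⟩ h
    refine ⟨⟨v, hd⟩, ?_, rfl⟩
    simp only [SetLike.mem_coe, LinearMap.mem_ker, LinearMap.sub_apply, LinearMap.smul_apply,
      Submodule.subtype_apply, sub_eq_zero]
    exact he

/-- A densely defined symmetric operator for which `A + i` and `A - i` are onto is self-adjoint. -/
theorem isSelfAdjoint_of_surjective {A : E →ₗ.[ℂ] E} (hd : Dense (A.domain : Set E))
    (hs : ∀ u v : A.domain, ⟪A u, (v : E)⟫_ℂ = ⟪(u : E), A v⟫_ℂ)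
    (h1 : ∀ y, ∃ u : A.domain, A u + Complex.I • (u : E) = y)
    (h2 : ∀ y, ∃ u : A.domain, A u - Complex.I • (u : E) = y) : IsSelfAdjoint A := by
  rw [LinearPMap.isSelfAdjoint_def]
  have hle : A ≤ A† := LinearPMap.IsFormalAdjoint.le_adjoint hd (fun u v => hs u v)
  refine (LinearPMap.eq_of_le_of_domain_eq hle (le_antisymm hle.1 ?_)).symm
  intro v hv
  -- With `(A + i) u = (A* + i) v`, the difference `v - u` is killed by `A* + i`, hence orthogonal
  -- to the range of `A - i`, which contains `v - u` itself.
  obtain ⟨u, hu⟩ := h1 (A† ⟨v, hv⟩ + Complex.I • v)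
  obtain ⟨w, hw⟩ := h2 (v - u)
  have hadj := LinearPMap.adjoint_isFormalAdjoint hd ⟨v, hv⟩ w
  have hsym := hs u w
  have h0 : ⟪v - (u : E), A w - Complex.I • (w : E)⟫_ℂ = 0 := by
    rw [show A† ⟨v, hv⟩ = A u + Complex.I • (u : E) - Complex.I • v by rw [hu]; abel] at hadj
    simp only [inner_sub_left, inner_sub_right, inner_add_left, inner_smul_left, inner_smul_right,
      Complex.conj_I] at hadj ⊢
    linear_combination hsym - hadj
  rw [hw] at h0
  have : v = u := sub_eq_zero.1 (inner_self_eq_zero.1 h0)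
  rw [this]; exact u.2

/-- Wold decomposition: the orthogonal complement `M` of all `Tⁿ N` reduces `T`, and `T` is unitary
on it. Hence `M` reduces `B`, both `B + i` and `B - i` are onto there, and the restriction is
self-adjoint; simplicity leaves only `M = 0`. -/
theorem isPure_cayleyTransform (hB : IsSimpleMaximalSymmetric B) :
    IsPure (cayleyTransform hB) := by
  set T := cayleyTransform hB with hTdef
  have hT : ∀ x, ‖T x‖ = ‖x‖ := norm_cayleyTransform hB
  let S : Submodule ℂ E := Submodule.span ℂ {y | ∃ n : ℕ, ∃ c ∈ wandering T, y = (T ^ n) c}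
  let M : Submodule ℂ E := Sᗮ
  have hM : ∀ x, x ∈ M ↔ ∀ n : ℕ, ∀ c ∈ wandering T, ⟪(T ^ n) c, x⟫_ℂ = 0 := by
    intro x
    constructor
    · exact fun h n c hc => h _ (Submodule.subset_span ⟨n, c, hc, rfl⟩)
    · intro h y hy
      induction hy using Submodule.span_induction with
      | mem y hy => obtain ⟨n, c, hc, rfl⟩ := hy; exact h n c hc
      | zero => simp
      | add y z _ _ h1 h2 => rw [inner_add_left, h1, h2, add_zero]
      | smul a y _ h1 => rw [inner_smul_left, h1, mul_zero]
  have hTM : ∀ x ∈ M, T x ∈ M := by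
    intro x hx
    rw [hM] at hx ⊢
    intro n c hc
    cases n with
    | zero =>
      rw [pow_zero, one_apply_eq_self, ← inner_conj_symm, mem_wandering_iff.1 hc,
        map_zero]
    | succ n => rw [pow_succ_apply_left, inner_map_of_norm_eq hT, hx n c hc]
  have hTM' : ∀ x ∈ M, ContinuousLinearMap.adjoint T x ∈ M := by
    intro x hx
    rw [hM] at hx ⊢
    intro n c hc
    rw [ContinuousLinearMap.adjoint_inner_right, ← pow_succ_apply_left]
    exact hx _ c hc
  have hTT : ∀ x, ContinuousLinearMap.adjoint T (T x) = x := by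
    intro x
    refine ext_inner_left ℂ fun y => ?_
    rw [ContinuousLinearMap.adjoint_inner_right, inner_map_of_norm_eq hT]
  -- The vector `x - T T* x` lies both in `N` and in `M`, so it is orthogonal to itself.
  have hTT' : ∀ x ∈ M, T (ContinuousLinearMap.adjoint T x) = x := by
    intro x hx
    have h1 : x - T (ContinuousLinearMap.adjoint T x) ∈ wandering T := by
      rw [mem_wandering_iff]
      intro y
      rw [← ContinuousLinearMap.adjoint_inner_right, map_sub, hTT, sub_self, inner_zero_right]
    have h2 : x - T (ContinuousLinearMap.adjoint T x) ∈ M := M.sub_mem hx (hTM _ (hTM' _ hx))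
    have := (hM _).1 h2 0 _ h1
    rw [pow_zero, one_apply_eq_self, inner_self_eq_zero, sub_eq_zero] at this
    exact this.symm
  have hPT : ∀ x, T (M.starProjection x) = M.starProjection (T x) := by
    intro x
    symm
    apply Submodule.eq_starProjection_of_mem_of_inner_eq_zero (hTM _ (M.starProjection_apply_mem x))
    intro w hw
    rw [← map_sub, ← ContinuousLinearMap.adjoint_inner_right]
    exact Submodule.starProjection_inner_eq_zero x _ (hTM' w hw)
  have hred : IsReducing B M := commutesWith_of_cayleyTransform_comm hB hPT
  have hmem : ∀ y : M, y - (⟨T y, hTM _ y.2⟩ : M) ∈ (restrictReducing B M hred).domain :=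
    fun y => sub_cayleyTransform_mem hB (y : E)
  have happ : ∀ y : M, ((restrictReducing B M hred ⟨_, hmem y⟩ : M) : E) =
      Complex.I • ((y : E) + T y) := fun y => apply_sub_cayleyTransform hB (y : E) _
  by_contra hne
  have hMne : M ≠ ⊥ := by
    intro h
    refine hne fun x hx => ?_
    have : x ∈ M := (hM x).2 hx
    rwa [h, Submodule.mem_bot] at this
  refine hB.simple M hMne hred (isSelfAdjoint_of_surjective ?_ ?_ ?_ ?_)
  · rw [Submodule.dense_iff_topologicalClosure_eq_top, Submodule.topologicalClosure_eq_top_iff,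
      Submodule.eq_bot_iff]
    intro y hy
    have hy' : ∀ u : B.domain, ⟪(u : E), (y : E)⟫_ℂ = 0 := by
      intro u
      obtain ⟨h1, -⟩ := hred u
      have h2 : ⟪((⟨M.starProjection (u : E), M.starProjection_apply_mem _⟩ : M)), y⟫_ℂ = 0 :=
        hy _ h1
      have h3 := Submodule.starProjection_inner_eq_zero (K := M) (u : E) y y.2
      rw [inner_sub_left, sub_eq_zero] at h3
      rw [h3]; exact h2
    have : (y : E) = 0 := hB.dense.eq_zero_of_inner_right ℂ (fun u hu => hy' ⟨u, hu⟩)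
    exact Subtype.ext this
  · intro u v
    exact hB.symmetric ⟨_, u.2⟩ ⟨_, v.2⟩
  · intro y
    refine ⟨(2 * Complex.I)⁻¹ • ⟨_, hmem y⟩, ?_⟩
    rw [LinearPMap.map_smul]
    apply Subtype.ext
    push_cast
    rw [happ, smul_comm Complex.I, ← smul_add, inv_smul_eq_iff₀ (by simp)]
    module
  · intro y
    -- Since `(B - i)(y' - T y') = 2i T y'`, solving for `y` requires `T y' = y`, that is, `y' = T*
    -- y`.
    let y' : M := ⟨_, hTM' _ y.2⟩
    refine ⟨(2 * Complex.I)⁻¹ • ⟨_, hmem y'⟩, ?_⟩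
    rw [LinearPMap.map_smul]
    apply Subtype.ext
    push_cast
    rw [happ, smul_comm Complex.I, ← smul_sub, inv_smul_eq_iff₀ (by simp)]
    change Complex.I • ((ContinuousLinearMap.adjoint T (y : E)) +
      T (ContinuousLinearMap.adjoint T (y : E))) - Complex.I • ((ContinuousLinearMap.adjoint T
      (y : E)) - T (ContinuousLinearMap.adjoint T (y : E))) = _
    rw [hTT' _ y.2]
    module

end Cayley
end

noncomputable section

/-! ### Series along an orthonormal sequence -/

section OrthonormalSeries

variable {E : Type*} [NormedAddCommGroup E] [InnerProductSpace ℂ E] {v : ℕ → E}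

theorem Orthonormal.norm_sq_sum_smul (hv : Orthonormal ℂ v) (c : ℕ → ℂ) (s : Finset ℕ) :
    ‖∑ i ∈ s, c i • v i‖ ^ 2 = ∑ i ∈ s, ‖c i‖ ^ 2 := by
  simpa using hv.orthogonalFamily.norm_sum c s

theorem Orthonormal.summable_smul_iff [CompleteSpace E] (hv : Orthonormal ℂ v) (c : ℕ → ℂ) :
    Summable (fun i => c i • v i) ↔ Summable fun i => ‖c i‖ ^ 2 := by
  simpa using hv.orthogonalFamily.summable_iff_norm_sq_summable c

theorem Orthonormal.hasSum_norm_sq (hv : Orthonormal ℂ v) {c : ℕ → ℂ} {y : E}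
    (h : HasSum (fun i => c i • v i) y) : HasSum (fun i => ‖c i‖ ^ 2) (‖y‖ ^ 2) := by
  have : Filter.Tendsto (fun s : Finset ℕ => ‖∑ i ∈ s, c i • v i‖ ^ 2) Filter.atTop
      (𝓝 (‖y‖ ^ 2)) := (h.norm).pow 2
  simp only [hv.norm_sq_sum_smul] at this
  exact this

theorem Orthonormal.inner_hasSum (hv : Orthonormal ℂ v) {c : ℕ → ℂ} {y : E}
    (h : HasSum (fun i => c i • v i) y) (n : ℕ) : ⟪v n, y⟫_ℂ = c n := by
  have h1 : HasSum (fun i => ⟪v n, c i • v i⟫_ℂ) ⟪v n, y⟫_ℂ := (innerSL ℂ (v n)).hasSum h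
  have h2 : HasSum (fun i => ⟪v n, c i • v i⟫_ℂ) ⟪v n, c n • v n⟫_ℂ := by
    refine hasSum_single n fun i hi => ?_
    rw [inner_smul_right, hv.2 hi.symm, mul_zero]
  rw [h1.unique h2, inner_smul_right, inner_self_eq_norm_sq_to_K, hv.1]
  simp

end OrthonormalSeries

/-! ### Unitary dilation and von Neumann's inequality -/

section VonNeumann

variable {E : Type*} [NormedAddCommGroup E] [InnerProductSpace ℂ E]

open Polynomial in
theorem aeval_apply_of_intertwine {H : Type*} [NormedAddCommGroup H] [InnerProductSpace ℂ H]
    {T : E →L[ℂ] E} {U : H →L[ℂ] H} {J : E → H} (hJa : ∀ x y, J (x + y) = J x + J y)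
    (hJs : ∀ (c : ℂ) x, J (c • x) = c • J x) (hJ : ∀ x, U (J x) = J (T x)) (p : ℂ[X]) (x : E) :
    aeval U p (J x) = J (aeval T p x) := by
  induction p using Polynomial.induction_on' with
  | add p q hp hq => simp [hJa, hp, hq]
  | monomial n c =>
    have : (U ^ n) (J x) = J ((T ^ n) x) := by
      induction n with
      | zero => simp
      | succ n ih => rw [pow_succ_apply_left, ih, hJ, pow_succ_apply_left]
    simp [aeval_monomial, Algebra.algebraMap_eq_smul_one, hJs, this]

variable [CompleteSpace E]

open Polynomial in
-- A unitary operator is normal with spectrum in the circle, and `p(U)` is given by its continuous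
-- functional calculus.
theorem norm_aeval_unitary_le {U : E →L[ℂ] E} (hU : U ∈ unitary (E →L[ℂ] E)) (p : ℂ[X]) {C : ℝ}
    (hp : ∀ w : ℂ, ‖w‖ = 1 → ‖p.eval w‖ ≤ C) : ‖aeval U p‖ ≤ C := by
  have hn : IsStarNormal U := ⟨by
    rw [Unitary.mem_iff] at hU
    rw [commute_iff_eq, hU.1, hU.2]⟩
  have hC : 0 ≤ C := (norm_nonneg _).trans (hp 1 (by simp))
  rw [← cfc_polynomial p U hn]
  refine norm_cfc_le hC fun w hw => hp w ?_
  simpa using spectrum.subset_circle_of_unitary hU hw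

/-- The unitary dilation `(x, y) ↦ (T x + (1 - T T*) y, T* y)` of an isometry `T`. -/
def unitaryDilation (T : E →L[ℂ] E) (hT : ∀ x, ‖T x‖ = ‖x‖) :
    WithLp 2 (E × E) →ₗᵢ[ℂ] WithLp 2 (E × E) where
  toFun z := WithLp.toLp 2 (T z.fst + (z.snd - T (ContinuousLinearMap.adjoint T z.snd)),
    ContinuousLinearMap.adjoint T z.snd)
  map_add' z w := by
    refine WithLp.ofLp_injective 2 (Prod.ext ?_ ?_)
    · change T (z.fst + w.fst) + ((z.snd + w.snd) - T (ContinuousLinearMap.adjoint T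
        (z.snd + w.snd))) = (T z.fst + (z.snd - T (ContinuousLinearMap.adjoint T z.snd))) +
        (T w.fst + (w.snd - T (ContinuousLinearMap.adjoint T w.snd)))
      simp only [map_add]
      abel
    · exact map_add (ContinuousLinearMap.adjoint T) z.snd w.snd
  map_smul' c z := by
    refine WithLp.ofLp_injective 2 (Prod.ext ?_ ?_)
    · change T (c • z.fst) + (c • z.snd - T (ContinuousLinearMap.adjoint T (c • z.snd))) =
        c • (T z.fst + (z.snd - T (ContinuousLinearMap.adjoint T z.snd)))
      simp only [map_smul, smul_add, smul_sub]
    · exact map_smul (ContinuousLinearMap.adjoint T) c z.snd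
  norm_map' z := by
    rw [← sq_eq_sq₀ (norm_nonneg _) (norm_nonneg _), WithLp.prod_norm_sq_eq_of_L2,
      WithLp.prod_norm_sq_eq_of_L2]
    change ‖T z.fst + (z.snd - T (ContinuousLinearMap.adjoint T z.snd))‖ ^ 2 +
      ‖ContinuousLinearMap.adjoint T z.snd‖ ^ 2 = _
    set y := z.snd
    set x := z.fst
    have hTT : ∀ x, ContinuousLinearMap.adjoint T (T x) = x := by
      intro x
      refine ext_inner_left ℂ fun y => ?_
      rw [ContinuousLinearMap.adjoint_inner_right, inner_map_of_norm_eq hT]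
    -- As `y - T T* y` is orthogonal to the range of `T`, Pythagoras applies to the first component
    -- and to the splitting of `y`.
    have h0 : ∀ u, ⟪T u, y - T (ContinuousLinearMap.adjoint T y)⟫_ℂ = 0 := by
      intro u
      rw [← ContinuousLinearMap.adjoint_inner_right, map_sub, hTT, sub_self, inner_zero_right]
    have h1 := norm_add_sq_eq_norm_sq_add_norm_sq_of_inner_eq_zero _ _ (h0 x)
    have h2 := norm_add_sq_eq_norm_sq_add_norm_sq_of_inner_eq_zero _ _
      (h0 (ContinuousLinearMap.adjoint T y))
    rw [add_sub_cancel] at h2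
    simp only [hT, ← sq] at h1 h2
    linarith

theorem unitaryDilation_surjective (T : E →L[ℂ] E) (hT : ∀ x, ‖T x‖ = ‖x‖) :
    Function.Surjective (unitaryDilation T hT) := by
  have hTT : ∀ x, ContinuousLinearMap.adjoint T (T x) = x := by
    intro x
    refine ext_inner_left ℂ fun y => ?_
    rw [ContinuousLinearMap.adjoint_inner_right, inner_map_of_norm_eq hT]
  intro z
  -- The preimage is the value at `z` of the adjoint of the dilation.
  refine ⟨WithLp.toLp 2 (ContinuousLinearMap.adjoint T z.fst,
    z.fst - T (ContinuousLinearMap.adjoint T z.fst) + T z.snd), ?_⟩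
  change WithLp.toLp 2 (_, _) = WithLp.toLp 2 (z.fst, z.snd)
  congr 2
  · simp [hTT]
  · simp [hTT]

open Polynomial in
/-- Von Neumann's inequality for isometries. -/
theorem norm_aeval_isometry_le {T : E →L[ℂ] E} (hT : ∀ x, ‖T x‖ = ‖x‖) (p : ℂ[X]) {C : ℝ}
    (hp : ∀ w : ℂ, ‖w‖ = 1 → ‖p.eval w‖ ≤ C) (x : E) : ‖aeval T p x‖ ≤ C * ‖x‖ := by
  let U := Unitary.linearIsometryEquiv.symm
    (LinearIsometryEquiv.ofSurjective (unitaryDilation T hT) (unitaryDilation_surjective T hT))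
  have hU : ∀ z, (U : WithLp 2 (E × E) →L[ℂ] WithLp 2 (E × E)) z = unitaryDilation T hT z :=
    fun z => rfl
  -- The first summand is invariant under the dilation, which acts there as `T`; so `p(U)` restricts
  -- to `p(T)`.
  have h1 := aeval_apply_of_intertwine (T := T)
    (U := (U : WithLp 2 (E × E) →L[ℂ] WithLp 2 (E × E)))
    (J := fun x => WithLp.toLp 2 (x, (0 : E))) (by simp [← WithLp.toLp_add])
    (by simp [← WithLp.toLp_smul])
    (fun x => by rw [hU]; change WithLp.toLp 2 (_, _) = _; congr 2 <;> simp) p x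
  have hn : ∀ y : E, ‖WithLp.toLp 2 (y, (0 : E))‖ = ‖y‖ := fun y => by
    rw [← sq_eq_sq₀ (norm_nonneg _) (norm_nonneg _), WithLp.prod_norm_sq_eq_of_L2]
    simp
  rw [← hn, ← hn x, ← h1]
  exact (ContinuousLinearMap.le_opNorm _ _).trans
    (mul_le_mul_of_nonneg_right (norm_aeval_unitary_le U.2 p hp) (norm_nonneg _))

end VonNeumann

/-! ### The operators `φ(rT)` and their strong limit -/

section Functional

variable {E : Type*} [NormedAddCommGroup E] [InnerProductSpace ℂ E]

/-- The operator `φ(r T) = ∑ aₙ rⁿ Tⁿ`. -/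
def abelSum (T : E →L[ℂ] E) (a : ℕ → ℂ) (r : ℝ) : E →L[ℂ] E :=
  ∑' n, (a n * (r : ℂ) ^ n) • T ^ n

variable {T : E →L[ℂ] E} {a : ℕ → ℂ} {r : ℝ}

theorem norm_pow_le_one (hT : ‖T‖ ≤ 1) (n : ℕ) : ‖T ^ n‖ ≤ 1 := by
  induction n with
  | zero => exact ContinuousLinearMap.norm_id_le
  | succ n ih =>
    rw [pow_succ]
    exact (norm_mul_le _ _).trans (mul_le_one₀ ih (norm_nonneg _) hT)

theorem norm_le_one_of_isometry (hT : ∀ x, ‖T x‖ = ‖x‖) : ‖T‖ ≤ 1 :=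
  T.opNorm_le_bound zero_le_one fun x => by rw [hT, one_mul]

variable [CompleteSpace E]

theorem summable_abelSum (hT : ‖T‖ ≤ 1) (ha : ∀ n, ‖a n‖ ≤ 1) (h0 : 0 ≤ r) (h1 : r < 1) :
    Summable fun n => (a n * (r : ℂ) ^ n) • T ^ n := by
  refine Summable.of_norm_bounded (summable_geometric_of_lt_one h0 h1) fun n => ?_
  rw [norm_smul, norm_mul, norm_pow, Complex.norm_real, Real.norm_of_nonneg h0]
  have := mul_le_mul (ha n) (norm_pow_le_one hT n) (norm_nonneg _) zero_le_one
  nlinarith [pow_nonneg h0 n]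

theorem hasSum_abelSum_apply (hT : ‖T‖ ≤ 1) (ha : ∀ n, ‖a n‖ ≤ 1) (h0 : 0 ≤ r) (h1 : r < 1)
    (x : E) : HasSum (fun n => (a n * (r : ℂ) ^ n) • (T ^ n) x) (abelSum T a r x) := by
  have h := (summable_abelSum hT ha h0 h1).hasSum.map (ContinuousLinearMap.apply ℂ E x)
    (ContinuousLinearMap.continuous _)
  simp only [Function.comp_def, ContinuousLinearMap.apply_apply, smul_apply] at h
  exact h

/-- The partial sums of `φ(rw)` are polynomials bounded on the circle by `1` plus a tail of the
geometric series. Von Neumann's inequality applies to each, and the tail vanishes in the limit. -/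
theorem norm_abelSum_apply_le (hT : ∀ x, ‖T x‖ = ‖x‖) (ha : ∀ n, ‖a n‖ ≤ 1)
    (hφ : ∀ w : ℂ, ‖w‖ < 1 → ‖∑' n, a n * w ^ n‖ ≤ 1) (h0 : 0 ≤ r) (h1 : r < 1) (x : E) :
    ‖abelSum T a r x‖ ≤ ‖x‖ := by
  have hg := summable_geometric_of_lt_one h0 h1
  have hb : ∀ (w : ℂ), ‖w‖ = 1 → ∀ n, ‖a n * (r * w) ^ n‖ ≤ r ^ n := by
    intro w hw n
    rw [norm_mul, norm_pow, norm_mul, Complex.norm_real, Real.norm_of_nonneg h0, hw, mul_one]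
    exact mul_le_of_le_one_left (pow_nonneg h0 n) (ha n)
  let p : ℕ → Polynomial ℂ := fun m =>
    ∑ n ∈ Finset.range m, Polynomial.monomial n (a n * (r : ℂ) ^ n)
  have hp : ∀ m (w : ℂ), ‖w‖ = 1 → ‖(p m).eval w‖ ≤ 1 + ∑' k, r ^ (k + m) := by
    intro m w hw
    have hs : Summable fun n => a n * (r * w) ^ n := Summable.of_norm_bounded hg (hb w hw)
    have h2 := hs.sum_add_tsum_nat_add m
    have h3 : (p m).eval w = ∑ n ∈ Finset.range m, a n * (r * w) ^ n := by
      simp only [p, Polynomial.eval_finsetSum, Polynomial.eval_monomial, mul_pow, mul_assoc]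
    rw [h3, eq_sub_of_add_eq h2]
    refine (norm_sub_le _ _).trans (add_le_add (hφ _ ?_) ?_)
    · rwa [norm_mul, Complex.norm_real, Real.norm_of_nonneg h0, hw, mul_one]
    · exact tsum_of_norm_bounded ((summable_nat_add_iff m).2 hg).hasSum fun k => hb w hw _
  have hlim1 : Filter.Tendsto (fun m => ‖Polynomial.aeval T (p m) x‖) Filter.atTop
      (𝓝 ‖abelSum T a r x‖) := by
    have := (hasSum_abelSum_apply (norm_le_one_of_isometry hT) ha h0 h1 x).tendsto_sum_nat.norm
    refine this.congr fun m => ?_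
    simp [p, Polynomial.aeval_monomial, Algebra.algebraMap_eq_smul_one, mul_smul]
  have hlim2 : Filter.Tendsto (fun m : ℕ => (1 + ∑' k, r ^ (k + m)) * ‖x‖) Filter.atTop
      (𝓝 ((1 + 0) * ‖x‖)) :=
    (tendsto_const_nhds.add (tendsto_sum_nat_add fun k => r ^ k)).mul_const _
  rw [add_zero, one_mul] at hlim2
  exact le_of_tendsto_of_tendsto' hlim1 hlim2 fun m => norm_aeval_isometry_le hT (p m) (hp m) x

/-- The form in which purity is used: a closed linear condition need only be checked on the vectors
`Tⁿ c`, `c ∈ N`. -/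
theorem IsPure.eq_top (hp : IsPure T) (Q : Submodule ℂ E) (hQ : IsClosed (Q : Set E))
    (h : ∀ n : ℕ, ∀ c ∈ wandering T, (T ^ n) c ∈ Q) : Q = ⊤ := by
  have : CompleteSpace Q := hQ.completeSpace_coe
  rw [← Submodule.orthogonal_eq_bot_iff, Submodule.eq_bot_iff]
  exact fun x hx => hp x fun n c hc => hx _ (h n c hc)

theorem eventually_unit_interval : ∀ᶠ r : ℝ in 𝓝[<] 1, 0 ≤ r ∧ r < 1 := by
  filter_upwards [self_mem_nhdsWithin, mem_nhdsWithin_of_mem_nhds (Ioi_mem_nhds zero_lt_one)]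
    with r h1 h0 using ⟨le_of_lt h0, h1⟩

/-- Orthonormality of `Tⁿ e` turns the squared distance into `∑ ‖aₙ rⁿ - aₙ‖²`, to which dominated
convergence applies. -/
theorem tendsto_abelSum_wandering (hT : ∀ x, ‖T x‖ = ‖x‖) (ha : ∀ n, ‖a n‖ ≤ 1)
    (h2 : Summable fun n => ‖a n‖ ^ 2) {e : E} (he : e ∈ wandering T) (h1 : ‖e‖ = 1) :
    Filter.Tendsto (fun r => abelSum T a r e) (𝓝[<] 1) (𝓝 (∑' n, a n • (T ^ n) e)) := by
  have hv := orthonormal_pow hT he h1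
  have hs := ((hv.summable_smul_iff a).2 h2).hasSum
  have hlim : Filter.Tendsto (fun r : ℝ => ∑' n, ‖a n * (r : ℂ) ^ n - a n‖ ^ 2) (𝓝[<] 1)
      (𝓝 (∑' n : ℕ, (0 : ℝ))) := by
    refine tendsto_tsum_of_dominated_convergence h2 (fun n => ?_) ?_
    · have : Continuous fun r : ℝ => ‖a n * (r : ℂ) ^ n - a n‖ ^ 2 := by fun_prop
      have h := this.tendsto 1
      simp only [Complex.ofReal_one, one_pow, mul_one, sub_self, norm_zero] at h
      simpa using h.mono_left nhdsWithin_le_nhds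
    · filter_upwards [eventually_unit_interval] with r hr n
      have h3 : a n * (r : ℂ) ^ n - a n = a n * ((r ^ n - 1 : ℝ) : ℂ) := by push_cast; ring
      have h4 : |r ^ n - 1| ≤ 1 := by
        rw [abs_le]
        constructor <;> nlinarith [pow_nonneg hr.1 n, pow_le_one₀ hr.1 hr.2.le (n := n)]
      rw [h3, norm_mul, Complex.norm_real, mul_pow, Real.norm_eq_abs, Real.norm_eq_abs,
        abs_of_nonneg (by positivity)]
      exact mul_le_of_le_one_right (by positivity) (pow_le_one₀ (abs_nonneg _) h4)
  rw [tsum_zero] at hlim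
  rw [tendsto_iff_norm_sub_tendsto_zero]
  have h5 : Filter.Tendsto (fun r => ‖abelSum T a r e - ∑' n, a n • (T ^ n) e‖ ^ 2) (𝓝[<] 1)
      (𝓝 0) := by
    refine hlim.congr' ?_
    filter_upwards [eventually_unit_interval] with r hr
    have h6 := (hasSum_abelSum_apply (norm_le_one_of_isometry hT) ha hr.1 hr.2 e).sub hs
    simp only [← sub_smul] at h6
    exact (hv.hasSum_norm_sq h6).tsum_eq
  have := h5.sqrt
  simpa [Real.sqrt_sq] using this

/-- The subspace on which `φ(r T)` converges as `r` tends to `1`. -/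
def abelConvergence (T : E →L[ℂ] E) (a : ℕ → ℂ) : Submodule ℂ E where
  carrier := {x | ∃ y, Filter.Tendsto (fun r => abelSum T a r x) (𝓝[<] 1) (𝓝 y)}
  add_mem' := by
    rintro x x' ⟨y, hy⟩ ⟨y', hy'⟩
    exact ⟨y + y', by simpa using hy.add hy'⟩
  zero_mem' := ⟨0, by simp⟩
  smul_mem' := by
    rintro c x ⟨y, hy⟩
    exact ⟨c • y, by simpa using hy.const_smul c⟩

/-- The operators are uniformly bounded near `r = 1`, so the Cauchy property passes from nearby
vectors to limits. -/
theorem isClosed_abelConvergence (hb : ∀ᶠ r in 𝓝[<] (1 : ℝ), ∀ x, ‖abelSum T a r x‖ ≤ ‖x‖) :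
    IsClosed (abelConvergence T a : Set E) := by
  rw [← closure_subset_iff_isClosed]
  intro x hx
  change ∃ y, _
  rw [← cauchy_map_iff_exists_tendsto, Metric.cauchy_iff]
  refine ⟨inferInstance, fun ε hε => ?_⟩
  obtain ⟨x', ⟨y, hy⟩, hx'⟩ := Metric.mem_closure_iff.1 hx (ε / 4) (by positivity)
  have h1 := hy.eventually (Metric.ball_mem_nhds y (show 0 < ε / 4 by positivity))
  refine ⟨Metric.ball y (ε / 2), ?_, ?_⟩
  · rw [Filter.mem_map]
    filter_upwards [h1, hb] with r hr hbr
    have h2 := hbr (x - x')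
    rw [map_sub, ← dist_eq_norm, ← dist_eq_norm] at h2
    have h3 := dist_triangle (abelSum T a r x) (abelSum T a r x') y
    change dist (abelSum T a r x) y < ε / 2
    linarith
  · intro u hu w hw
    rw [Metric.mem_ball] at hu hw
    have := dist_triangle_right u w y
    linarith

theorem abelSum_comm (hT : ‖T‖ ≤ 1) (ha : ∀ n, ‖a n‖ ≤ 1) (h0 : 0 ≤ r) (h1 : r < 1)
    {S : E →L[ℂ] E} (h : ∀ x, S (T x) = T (S x)) (x : E) :
    S (abelSum T a r x) = abelSum T a r (S x) := by
  have h2 := S.hasSum (hasSum_abelSum_apply hT ha h0 h1 x)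
  refine h2.unique ?_
  have hn : ∀ n x, S ((T ^ n) x) = (T ^ n) (S x) := by
    intro n x
    induction n with
    | zero => simp
    | succ n ih => rw [pow_succ_apply_left, h, ih, pow_succ_apply_left]
  simpa only [map_smul, hn] using hasSum_abelSum_apply hT ha h0 h1 (S x)

/-- For a function `φ w = ∑ aₙ wⁿ` which is bounded by `1` in the unit disc and has norm `1` in
`H²`, the operators `φ(r T)` converge strongly to an isometry. -/
theorem exists_isometry_of_abelSum (hT : ∀ x, ‖T x‖ = ‖x‖) (hp : IsPure T)
    (h2 : HasSum (fun n => ‖a n‖ ^ 2) 1) (hφ : ∀ w : ℂ, ‖w‖ < 1 → ‖∑' n, a n * w ^ n‖ ≤ 1) :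
    ∃ S : E →L[ℂ] E, (∀ x, Filter.Tendsto (fun r => abelSum T a r x) (𝓝[<] 1) (𝓝 (S x))) ∧
      (∀ x, ‖S x‖ = ‖x‖) ∧ (∀ x, S (T x) = T (S x)) ∧
      ∀ c ∈ wandering T, HasSum (fun n => a n • (T ^ n) c) (S c) := by
  have ha : ∀ n, ‖a n‖ ≤ 1 := fun n => by
    have := le_hasSum h2 n fun _ _ => by positivity
    exact (sq_le_one_iff₀ (norm_nonneg _)).1 this
  have hT1 := norm_le_one_of_isometry hT
  have hb : ∀ᶠ r in 𝓝[<] (1 : ℝ), ∀ x, ‖abelSum T a r x‖ ≤ ‖x‖ := by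
    filter_upwards [eventually_unit_interval] with r hr x
    exact norm_abelSum_apply_le hT ha hφ hr.1 hr.2 x
  have hcomm : ∀ n : ℕ, ∀ᶠ r in 𝓝[<] (1 : ℝ), ∀ x,
      (T ^ n) (abelSum T a r x) = abelSum T a r ((T ^ n) x) := by
    intro n
    filter_upwards [eventually_unit_interval] with r hr x
    exact abelSum_comm hT1 ha hr.1 hr.2
      (fun x => by rw [← pow_succ_apply_left, ← pow_succ_apply_right]) x
  have hpow : ∀ n x, x ∈ abelConvergence T a → (T ^ n) x ∈ abelConvergence T a := by
    rintro n x ⟨y, hy⟩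
    refine ⟨(T ^ n) y, (((T ^ n).continuous.tendsto y).comp hy).congr' ?_⟩
    filter_upwards [hcomm n] with r hr using hr x
  -- Convergence holds on `N`, passes to `Tⁿ N` because `T` commutes with `φ(rT)`, and then extends
  -- by purity.
  have htop : abelConvergence T a = ⊤ := by
    refine hp.eq_top _ (isClosed_abelConvergence hb) fun n c hc => hpow n c ?_
    rcases eq_or_ne c 0 with rfl | h0
    · exact Submodule.zero_mem _
    · have h3 := tendsto_abelSum_wandering hT ha h2.summable (Submodule.smul_mem _ ((‖c‖ : ℂ)⁻¹) hc)
        (by rw [norm_smul, norm_inv, Complex.norm_real, norm_norm,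
          inv_mul_cancel₀ (norm_ne_zero_iff.2 h0)])
      have h4 : ((‖c‖ : ℂ)⁻¹) • c ∈ abelConvergence T a := ⟨_, h3⟩
      rwa [Submodule.smul_mem_iff] at h4
      simpa using h0
  have hex : ∀ x, ∃ y, Filter.Tendsto (fun r => abelSum T a r x) (𝓝[<] 1) (𝓝 y) := fun x => by
    have : x ∈ abelConvergence T a := htop ▸ Submodule.mem_top
    exact this
  choose f hf using hex
  let S : E →L[ℂ] E := LinearMap.mkContinuous
    { toFun := f
      map_add' := fun x y => tendsto_nhds_unique (hf (x + y)) (by simpa using (hf x).add (hf y))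
      map_smul' := fun c x =>
        tendsto_nhds_unique (hf (c • x)) (by simpa using (hf x).const_smul c) } 1 (fun x => by
      rw [one_mul]
      refine le_of_tendsto (hf x).norm ?_
      filter_upwards [hb] with r hr using hr x)
  have hS : ∀ x, Filter.Tendsto (fun r => abelSum T a r x) (𝓝[<] 1) (𝓝 (S x)) := hf
  have hST : ∀ x, S (T x) = T (S x) := by
    intro x
    refine tendsto_nhds_unique (hS (T x)) (((T.continuous.tendsto _).comp (hS x)).congr' ?_)
    filter_upwards [hcomm 1] with r hr
    simpa using hr x
  have hSTn : ∀ (n : ℕ) x, S ((T ^ n) x) = (T ^ n) (S x) := by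
    intro n x
    induction n with
    | zero => simp
    | succ n ih => rw [pow_succ_apply_left, hST, ih, pow_succ_apply_left]
  have hle : ∀ x, ‖S x‖ ≤ ‖x‖ := by
    intro x
    refine le_of_tendsto (hS x).norm ?_
    filter_upwards [hb] with r hr using hr x
  have hN1 : ∀ e ∈ wandering T, ‖e‖ = 1 → HasSum (fun n => a n • (T ^ n) e) (S e) := by
    intro e he h1
    have hv := orthonormal_pow hT he h1
    rw [tendsto_nhds_unique (hS e) (tendsto_abelSum_wandering hT ha h2.summable he h1)]
    exact ((hv.summable_smul_iff a).2 h2.summable).hasSum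
  have hN : ∀ c ∈ wandering T, HasSum (fun n => a n • (T ^ n) c) (S c) := by
    intro c hc
    rcases eq_or_ne c 0 with rfl | h0
    · simp
    · have h0' : (‖c‖ : ℂ) ≠ 0 := by simpa using h0
      have h3 := (hN1 _ (Submodule.smul_mem _ ((‖c‖ : ℂ)⁻¹) hc)
        (by rw [norm_smul, norm_inv, Complex.norm_real, norm_norm,
          inv_mul_cancel₀ (norm_ne_zero_iff.2 h0)])).const_smul (‖c‖ : ℂ)
      simpa only [map_smul, smul_comm (a _), smul_inv_smul₀ h0'] using h3
  have hnorm : ∀ c ∈ wandering T, ‖S c‖ = ‖c‖ := by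
    intro c hc
    rcases eq_or_ne c 0 with rfl | h0
    · simp
    · have h1 : ‖((‖c‖ : ℂ)⁻¹) • c‖ = 1 := by
        rw [norm_smul, norm_inv, Complex.norm_real, norm_norm,
          inv_mul_cancel₀ (norm_ne_zero_iff.2 h0)]
      have hm := Submodule.smul_mem _ ((‖c‖ : ℂ)⁻¹) hc
      have h3 := ((orthonormal_pow hT hm h1).hasSum_norm_sq (hN1 _ hm h1)).unique h2
      rw [pow_eq_one_iff_of_nonneg (norm_nonneg _) two_ne_zero, map_smul, norm_smul,
        norm_inv, Complex.norm_real, norm_norm,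
        inv_mul_eq_one₀ (norm_ne_zero_iff.2 h0)] at h3
      exact h3.symm
  -- The set where `‖S x‖ = ‖x‖` is not visibly linear. For a contraction this equality forces `S* S
  -- x = x`, which is a closed linear condition.
  let Q : Submodule ℂ E :=
    LinearMap.ker ((ContinuousLinearMap.adjoint S * S - 1 : E →L[ℂ] E) : E →ₗ[ℂ] E)
  have hQm : ∀ x, x ∈ Q ↔ ContinuousLinearMap.adjoint S (S x) = x := by
    intro x
    simp [Q, sub_eq_zero]
  have hQ : Q = ⊤ := by
    refine hp.eq_top Q (ContinuousLinearMap.isClosed_ker _) fun n c hc => ?_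
    set x := (T ^ n) c
    have h1 : ‖S x‖ = ‖x‖ := by rw [hSTn, norm_pow_apply hT, norm_pow_apply hT, hnorm c hc]
    have h3 : ‖ContinuousLinearMap.adjoint S (S x)‖ ≤ ‖x‖ := by
      have h4 : ‖ContinuousLinearMap.adjoint S‖ ≤ 1 := by
        rw [LinearIsometryEquiv.norm_map]
        exact S.opNorm_le_bound zero_le_one fun x => by rw [one_mul]; exact hle x
      have := (ContinuousLinearMap.adjoint S).le_of_opNorm_le h4 (S x)
      rwa [one_mul, h1] at this
    rw [hQm, ← sub_eq_zero, ← norm_eq_zero, ← sq_eq_zero_iff]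
    refine le_antisymm ?_ (sq_nonneg _)
    rw [@norm_sub_sq ℂ, ContinuousLinearMap.adjoint_inner_left, inner_self_eq_norm_sq, h1]
    nlinarith [norm_nonneg (ContinuousLinearMap.adjoint S (S x))]
  refine ⟨S, hS, fun x => ?_, hST, hN⟩
  have h1 : ContinuousLinearMap.adjoint S (S x) = x := (hQm x).1 (hQ ▸ Submodule.mem_top)
  rw [← sq_eq_sq₀ (norm_nonneg _) (norm_nonneg _), ← @inner_self_eq_norm_sq ℂ,
    ← ContinuousLinearMap.adjoint_inner_left, h1, inner_self_eq_norm_sq]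

end Functional
end

noncomputable section

/-! ### Nontangential limits of derivatives -/

section NontangentialLimits

open Complex in
/-- If `G` is holomorphic in the upper half-plane, of linear growth at a boundary point `θ`, and
`o(|t - θ|)` along the real axis, then it is `o(|z - θ|)` in cones with vertex `θ`. The product of
the four rotations of `G` about the centre of a square is estimated on its boundary. -/
theorem exists_norm_le_of_isLittleO_real {G : ℂ → ℂ} {θ M : ℝ}
    (hG : DiffContOnCl ℂ G {z : ℂ | 0 < z.im}) (hM : 0 ≤ M)
    (hb : ∀ z : ℂ, 0 ≤ z.im → ‖G z‖ ≤ M * ‖z - θ‖)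
    (ho : ∀ ε > 0, ∃ δ > 0, ∀ t : ℝ, |t - θ| ≤ δ → ‖G t‖ ≤ ε * |t - θ|)
    {C : ℝ} (hC : 0 ≤ C) {ε : ℝ} (hε : 0 < ε) :
    ∃ δ > 0, ∀ z : ℂ, 0 < z.im → z.im ≤ δ → ‖z - θ‖ ≤ C * z.im → ‖G z‖ ≤ ε * z.im := by
  -- On the boundary of the square one factor is at most `ε' (C + 2) η` and the other three at most
  -- `(M + 1)(C + 2) η`. The constant `ε'` makes the product equal to `(ε η)⁴`; `M + 1` keeps the
  -- divisor positive.
  obtain ⟨δ, hδ, ho⟩ := ho (ε ^ 4 / ((M + 1) ^ 3 * (C + 2) ^ 4)) (by positivity)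
  refine ⟨δ / (C + 2), by positivity, fun c hc0 hcδ hcC => ?_⟩
  set η := c.im with hη
  set ε' := ε ^ 4 / ((M + 1) ^ 3 * (C + 2) ^ 4) with hε'
  have hη2 : (C + 2) * η ≤ δ := by rw [le_div_iff₀ (by positivity)] at hcδ; linarith
  -- The square of side `2η` centred at `c`, whose lower side lies on the real axis.
  let U : Set ℂ := Set.Ioo (c.re - η) (c.re + η) ×ℂ Set.Ioo 0 (2 * η)
  have hcl : closure U = Set.Icc (c.re - η) (c.re + η) ×ℂ Set.Icc 0 (2 * η) := by
    rw [closure_reProdIm, closure_Ioo (by linarith), closure_Ioo (by linarith)]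
  let ρ : ℂ → ℂ → ℂ := fun u z => c + u * (z - c)
  have hρ : ∀ u, (u = 1 ∨ u = I ∨ u = -1 ∨ u = -I) → DiffContOnCl ℂ (fun z => G (ρ u z)) U := by
    intro u hu
    have hd : Differentiable ℂ (ρ u) := by unfold ρ; fun_prop
    refine hG.comp hd.diffContOnCl fun z hz => ?_
    rw [mem_reProdIm] at hz
    obtain ⟨⟨h1, h2⟩, h3, h4⟩ := hz
    rcases hu with rfl | rfl | rfl | rfl <;> simp [ρ] <;> linarith
  have him : ∀ u, (u = 1 ∨ u = I ∨ u = -1 ∨ u = -I) → ∀ z ∈ closure U, 0 ≤ (ρ u z).im := by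
    intro u hu z hz
    rw [hcl, mem_reProdIm] at hz
    obtain ⟨⟨h1, h2⟩, h3, h4⟩ := hz
    rcases hu with rfl | rfl | rfl | rfl <;> simp [ρ] <;> linarith
  have hdist : ∀ u, (u = 1 ∨ u = I ∨ u = -1 ∨ u = -I) → ∀ z ∈ closure U,
      ‖ρ u z - θ‖ ≤ (C + 2) * η := by
    intro u hu z hz
    rw [hcl, mem_reProdIm] at hz
    obtain ⟨⟨h1, h2⟩, h3, h4⟩ := hz
    have hu1 : ‖u‖ = 1 := by rcases hu with rfl | rfl | rfl | rfl <;> simp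
    have h5 : ‖z - c‖ ≤ 2 * η := by
      refine (Complex.norm_le_abs_re_add_abs_im _).trans ?_
      have h6 : |(z - c).re| ≤ η := by rw [abs_le, sub_re]; constructor <;> linarith
      have h7 : |(z - c).im| ≤ η := by rw [abs_le, sub_im]; constructor <;> linarith
      linarith
    have h8 : ρ u z - θ = (c - θ) + u * (z - c) := by simp only [ρ]; ring
    rw [h8]
    refine (norm_add_le _ _).trans ?_
    rw [norm_mul, hu1, one_mul]
    linarith
  have hfac : ∀ u, (u = 1 ∨ u = I ∨ u = -1 ∨ u = -I) → ∀ z ∈ closure U,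
      ‖G (ρ u z)‖ ≤ (M + 1) * ((C + 2) * η) := by
    intro u hu z hz
    refine (hb _ (him u hu z hz)).trans ?_
    have := hdist u hu z hz
    gcongr
    linarith
  have hsmall : ∀ u, (u = 1 ∨ u = I ∨ u = -1 ∨ u = -I) → ∀ z ∈ closure U, (ρ u z).im = 0 →
      ‖G (ρ u z)‖ ≤ ε' * ((C + 2) * η) := by
    intro u hu z hz h0
    have h1 := hdist u hu z hz
    have h2 : ρ u z = ((ρ u z).re : ℂ) := by apply Complex.ext <;> simp [h0]
    rw [h2, ← ofReal_sub, norm_real, Real.norm_eq_abs] at h1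
    rw [h2]
    refine (ho _ (h1.trans hη2)).trans ?_
    gcongr
  let P : ℂ → ℂ := fun z => G (ρ 1 z) * G (ρ I z) * (G (ρ (-1) z) * G (ρ (-I) z))
  have hP : DiffContOnCl ℂ P U := by
    have h1 := (hρ 1 (by simp)).smul (hρ I (by simp))
    have h2 := (hρ (-1) (by simp)).smul (hρ (-I) (by simp))
    exact h1.smul h2
  have hbd : ∀ z ∈ frontier U, ‖P z‖ ≤ (ε * η) ^ 4 := by
    intro z hz
    have hzc : z ∈ closure U := frontier_subset_closure hz
    have h1 := hfac 1 (by simp) z hzc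
    have h2 := hfac I (by simp) z hzc
    have h3 := hfac (-1) (by simp) z hzc
    have h4 := hfac (-I) (by simp) z hzc
    set A := (M + 1) * ((C + 2) * η) with hA
    set A' := ε' * ((C + 2) * η) with hA'
    have hprod : A' * A ^ 3 = (ε * η) ^ 4 := by
      rw [hA, hA', hε']; field_simp
    have hA0 : 0 ≤ A := by positivity
    have hA0' : 0 ≤ A' := by positivity
    rw [← hprod]
    simp only [P, norm_mul]
    -- Each side of the square is carried to the lower side by one of the four quarter-turns about
    -- `c`.
    have hcase : (ρ 1 z).im = 0 ∨ (ρ I z).im = 0 ∨ (ρ (-1) z).im = 0 ∨ (ρ (-I) z).im = 0 := by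
      rw [frontier_reProdIm, frontier_Ioo (by linarith), frontier_Ioo (by linarith)] at hz
      rcases hz with hz | hz <;> rw [mem_reProdIm] at hz
      · rcases hz.2 with h | h
        · left; simp [ρ, h]
        · right; right; left; rw [Set.mem_singleton_iff] at h; simp [ρ, h, hη]; ring
      · rcases hz.1 with h | h
        · right; left; simp [ρ, h, hη]
        · right; right; right; rw [Set.mem_singleton_iff] at h; simp [ρ, h, hη]
    rcases hcase with h | h | h | h
    · have h5 := hsmall 1 (by simp) z hzc h
      calc _ ≤ A' * A * (A * A) := by gcongr
        _ = _ := by ring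
    · have h5 := hsmall I (by simp) z hzc h
      calc _ ≤ A * A' * (A * A) := by gcongr
        _ = _ := by ring
    · have h5 := hsmall (-1) (by simp) z hzc h
      calc _ ≤ A * A * (A' * A) := by gcongr
        _ = _ := by ring
    · have h5 := hsmall (-I) (by simp) z hzc h
      calc _ ≤ A * A * (A * A') := by gcongr
        _ = _ := by ring
  have hUb : Bornology.IsBounded U := (Metric.isBounded_Ioo _ _).reProdIm (Metric.isBounded_Ioo _ _)
  have hcU : c ∈ closure U := by
    rw [hcl, mem_reProdIm]
    refine ⟨⟨?_, ?_⟩, ?_, ?_⟩ <;> linarith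
  have := norm_le_of_forall_mem_frontier_norm_le hUb hP hbd hcU
  simp only [P, ρ, sub_self, mul_zero, add_zero, norm_mul] at this
  exact (pow_le_pow_iff_left₀ (norm_nonneg _) (by positivity) four_ne_zero).1
    (le_trans (by rw [pow_succ, pow_succ, pow_succ, pow_one, mul_assoc (_ * _)]) this)

/-- The cone with vertex `θ` and aperture `C` in the upper half-plane. -/
def boundaryCone (θ C : ℝ) : Set ℂ := {z | 0 < z.im ∧ ‖z - θ‖ ≤ C * z.im}

/-- The derivative of a Lipschitz holomorphic function has a nontangential limit at every point of
differentiability of its boundary function. -/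
theorem tendsto_deriv_boundaryCone {G : ℂ → ℂ} {θ M : ℝ} {g : ℂ}
    (hG : DiffContOnCl ℂ G {z : ℂ | 0 < z.im})
    (hb : ∀ z : ℂ, 0 ≤ z.im → ‖G z - G θ‖ ≤ M * ‖z - θ‖)
    (hg : HasDerivAt (fun t : ℝ => G t) g θ) {C : ℝ} (hC : 0 ≤ C) :
    Filter.Tendsto (deriv G) (𝓝[boundaryCone θ C] (θ : ℂ)) (𝓝 g) := by
  -- Removing the first-order part at `θ` leaves a function that is `o(|t - θ|)` on the real axis.
  let K : ℂ → ℂ := fun z => G z - (G θ + g * (z - θ))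
  have hd : Differentiable ℂ fun z : ℂ => G θ + g * (z - θ) := by fun_prop
  have hK : DiffContOnCl ℂ K {z : ℂ | 0 < z.im} := hG.sub hd.diffContOnCl
  have hKb : ∀ z : ℂ, 0 ≤ z.im → ‖K z‖ ≤ (|M| + ‖g‖) * ‖z - θ‖ := by
    intro z hz
    have h1 : K z = (G z - G θ) - g * (z - θ) := by simp only [K]; ring
    rw [h1, add_mul]
    refine (norm_sub_le _ _).trans (add_le_add ((hb z hz).trans ?_) (norm_mul _ _).le)
    gcongr
    exact le_abs_self M
  have hKo : ∀ ε > 0, ∃ δ > 0, ∀ t : ℝ, |t - θ| ≤ δ → ‖K t‖ ≤ ε * |t - θ| := by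
    intro ε hε
    have h1 := (hasDerivAt_iff_isLittleO.1 hg).def hε
    obtain ⟨δ, hδ, h2⟩ := Metric.eventually_nhds_iff.1 h1
    refine ⟨δ / 2, by positivity, fun t ht => ?_⟩
    have h3 := h2 (show dist t θ < δ by rw [Real.dist_eq]; linarith)
    rw [Real.norm_eq_abs] at h3
    have h4 : K t = G t - G θ - (t - θ) • g := by
      simp only [K, Complex.real_smul]
      push_cast
      ring
    rw [h4]
    exact h3
  rw [Metric.tendsto_nhdsWithin_nhds]
  intro ε hε
  -- The circle of radius `z.im / 2` about `z` has heights between `z.im / 2` and `3 z.im / 2` and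
  -- stays in the cone of aperture `2C + 1`. Cauchy's estimate on it then gives `3ε / 4`.
  obtain ⟨δ, hδ, h⟩ := exists_norm_le_of_isLittleO_real hK (by positivity) hKb hKo
    (show 0 ≤ 2 * C + 1 by positivity) (show 0 < ε / 4 by positivity)
  refine ⟨δ / 2, by positivity, fun z hz hzδ => ?_⟩
  obtain ⟨hz0, hzC⟩ := hz
  have hzi : z.im < δ / 2 := by
    have := Complex.abs_im_le_norm (z - θ)
    rw [Complex.sub_im, Complex.ofReal_im, sub_zero, abs_of_pos hz0] at this
    rw [dist_eq_norm] at hzδ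
    linarith
  have hsub : Metric.closedBall z (z.im / 2) ⊆ {w : ℂ | 0 < w.im} := by
    intro w hw
    have h1 := (Complex.abs_im_le_norm (w - z)).trans (mem_closedBall_iff_norm.1 hw)
    rw [Complex.sub_im, abs_le] at h1
    change 0 < w.im
    linarith [h1.1]
  have hKz : deriv K z = deriv G z - g := by
    have h1 : DifferentiableAt ℂ G z :=
      hG.differentiableOn.differentiableAt
        ((isOpen_lt continuous_const Complex.continuous_im).mem_nhds hz0)
    have h2 : HasDerivAt (fun z : ℂ => G θ + g * (z - θ)) g z := by
      simpa using (((hasDerivAt_id z).sub_const (θ : ℂ)).const_mul g).const_add (G θ)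
    exact (h1.hasDerivAt.sub h2).deriv
  have hsph : ∀ w ∈ Metric.sphere z (z.im / 2), ‖K w‖ ≤ ε / 4 * (3 / 2 * z.im) := by
    intro w hw
    have h0 : ‖w - z‖ = z.im / 2 := mem_sphere_iff_norm.1 hw
    have h1 := Complex.abs_im_le_norm (w - z)
    rw [h0, Complex.sub_im, abs_le] at h1
    have h2 : ‖w - θ‖ ≤ ‖w - z‖ + ‖z - θ‖ := norm_sub_le_norm_sub_add_norm_sub _ _ _
    refine (h w (by linarith [h1.1]) (by linarith [h1.2]) ?_).trans ?_
    · nlinarith [h1.1]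
    · gcongr
      linarith [h1.2]
  have hder := Complex.norm_deriv_le_of_forall_mem_sphere_norm_le (half_pos hz0)
    (hK.mono (Metric.ball_subset_closedBall.trans hsub)) hsph
  rw [dist_eq_norm, ← hKz]
  refine hder.trans_lt ?_
  rw [div_lt_iff₀ (by positivity)]
  nlinarith [mul_pos hε hz0]

end NontangentialLimits
end

noncomputable section

/-! ### Fatou's theorem and Parseval's identity for power series -/

section PowerSeries

open Complex

/-- The function `∑ aₙ wⁿ`. -/
def powerSum (a : ℕ → ℂ) (w : ℂ) : ℂ := ∑' n, a n * w ^ n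

variable {a : ℕ → ℂ}

theorem hasFPowerSeriesOnBall_powerSum (ha : ∀ n, ‖a n‖ ≤ 1) :
    HasFPowerSeriesOnBall (powerSum a) (FormalMultilinearSeries.ofScalars ℂ a) 0 1 where
  r_le := by
    have := FormalMultilinearSeries.le_radius_of_bound (FormalMultilinearSeries.ofScalars ℂ a)
      (r := 1) 1 (fun n => by simpa using ha n)
    simpa using this
  r_pos := one_pos
  hasSum := by
    intro y hy
    have hy' : ‖y‖ < 1 := by
      have h := hy
      rw [← ENNReal.ofReal_one, Metric.eball_ofReal, mem_ball_zero_iff] at h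
      exact h
    have hs : Summable fun n => a n * y ^ n := by
      refine Summable.of_norm_bounded (summable_geometric_of_lt_one (norm_nonneg y) hy') fun n => ?_
      rw [norm_mul, norm_pow]
      exact mul_le_of_le_one_left (by positivity) (ha n)
    simpa [FormalMultilinearSeries.ofScalars, powerSum] using hs.hasSum

theorem differentiableAt_powerSum (ha : ∀ n, ‖a n‖ ≤ 1) {w : ℂ} (hw : ‖w‖ < 1) :
    DifferentiableAt ℂ (powerSum a) w := by
  refine ((hasFPowerSeriesOnBall_powerSum ha).analyticAt_of_mem ?_).differentiableAt
  rwa [← ENNReal.ofReal_one, Metric.eball_ofReal, mem_ball_zero_iff]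

theorem iteratedDeriv_powerSum (ha : ∀ n, ‖a n‖ ≤ 1) (n : ℕ) :
    iteratedDeriv n (powerSum a) 0 / (n ! : ℂ) = a n := by
  have h := (hasFPowerSeriesOnBall_powerSum ha).factorial_smul 1 n
  rw [iteratedDeriv_eq_iteratedFDeriv, ← h, nsmul_eq_mul]
  have : (n ! : ℂ) ≠ 0 := Nat.cast_ne_zero.2 n.factorial_ne_zero
  simp [FormalMultilinearSeries.ofScalars, this]

/-- From `2xy ≤ x² + y²`. It makes the primitive converge absolutely up to the unit circle, where
the series itself need not converge. -/
theorem summable_norm_div_succ (h2 : Summable fun n => ‖a n‖ ^ 2) :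
    Summable fun n : ℕ => ‖a n‖ / (n + 1) := by
  have h3 : Summable fun n : ℕ => (1 : ℝ) / ((n : ℝ) + 1) ^ 2 := by
    have := (summable_nat_add_iff 1).2 (Real.summable_one_div_nat_pow.2 one_lt_two)
    simpa using this
  refine Summable.of_nonneg_of_le (fun n => by positivity) (fun n => ?_) (h2.add h3)
  have h4 := two_mul_le_add_sq ‖a n‖ (1 / ((n : ℝ) + 1))
  rw [div_pow, one_pow] at h4
  have h5 : ‖a n‖ / ((n : ℝ) + 1) = ‖a n‖ * (1 / ((n : ℝ) + 1)) := by ring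
  have h6 : 0 ≤ ‖a n‖ * (1 / ((n : ℝ) + 1)) := by positivity
  rw [h5]
  linarith

/-- The primitive `∑ aₙ wⁿ⁺¹ / (n + 1)` of `∑ aₙ wⁿ`. -/
def powerPrimitive (a : ℕ → ℂ) (w : ℂ) : ℂ := ∑' n : ℕ, a n / (n + 1) * w ^ (n + 1)

theorem continuousOn_powerPrimitive (h2 : Summable fun n => ‖a n‖ ^ 2) :
    ContinuousOn (powerPrimitive a) (Metric.closedBall 0 1) := by
  refine continuousOn_tsum (fun n => by fun_prop) (summable_norm_div_succ h2) fun n w hw => ?_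
  rw [mem_closedBall_zero_iff] at hw
  rw [norm_mul, norm_div, norm_pow]
  have h3 : ‖(n : ℂ) + 1‖ = n + 1 := by
    rw [← Nat.cast_add_one, Complex.norm_natCast, Nat.cast_add_one]
  rw [h3]
  exact mul_le_of_le_one_right (by positivity) (pow_le_one₀ (norm_nonneg _) hw)

theorem hasDerivAt_powerPrimitive (ha : ∀ n, ‖a n‖ ≤ 1) {w : ℂ} (hw : ‖w‖ < 1) :
    HasDerivAt (powerPrimitive a) (powerSum a w) w := by
  obtain ⟨r, hr1, hr2⟩ := exists_between hw
  have hr0 : 0 < r := (norm_nonneg _).trans_lt hr1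
  change HasDerivAt (fun z : ℂ => ∑' n : ℕ, a n / (n + 1) * z ^ (n + 1)) (∑' n, a n * w ^ n) w
  refine hasDerivAt_tsum_of_isPreconnected (𝕜 := ℂ) (F := ℂ) (y₀ := 0)
    (g := fun (n : ℕ) z => a n / (n + 1) * z ^ (n + 1)) (g' := fun n z => a n * z ^ n)
    (summable_geometric_of_lt_one hr0.le hr2)
    Metric.isOpen_ball (convex_ball (0 : ℂ) r).isPreconnected (fun n y hy => ?_) (fun n y hy => ?_)
    (Metric.mem_ball_self hr0) ?_ (by simpa using hr1)
  · have h := (hasDerivAt_pow (n + 1) y).const_mul (a n / ((n : ℂ) + 1))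
    have h3 : (n : ℂ) + 1 ≠ 0 := Nat.cast_add_one_ne_zero n
    have h4 : a n / ((n : ℂ) + 1) * (((n + 1 : ℕ) : ℂ) * y ^ (n + 1 - 1)) = a n * y ^ n := by
      push_cast
      field_simp
    rw [h4] at h
    exact h
  · rw [mem_ball_zero_iff] at hy
    rw [norm_mul, norm_pow]
    exact (mul_le_of_le_one_left (by positivity) (ha n)).trans (by gcongr)
  · simp

/-- The function `z ↦ ∑ aₙ w ^ (n + 1) / (n + 1)`, `w = exp (i z)`, of the upper half-plane. -/
def stripPrimitive (a : ℕ → ℂ) (z : ℂ) : ℂ := powerPrimitive a (exp (I * z))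

theorem norm_exp_I_mul (z : ℂ) : ‖exp (I * z)‖ = Real.exp (-z.im) := by
  rw [Complex.norm_exp]; simp

theorem norm_exp_I_mul_lt_one {z : ℂ} (hz : 0 < z.im) : ‖exp (I * z)‖ < 1 := by
  rw [norm_exp_I_mul, Real.exp_lt_one_iff]; linarith

theorem hasDerivAt_stripPrimitive (ha : ∀ n, ‖a n‖ ≤ 1) {z : ℂ} (hz : 0 < z.im) :
    HasDerivAt (stripPrimitive a) (powerSum a (exp (I * z)) * (exp (I * z) * I)) z := by
  have h1 : HasDerivAt (fun z => exp (I * z)) (exp (I * z) * I) z := by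
    simpa using ((hasDerivAt_id z).const_mul I).cexp
  exact (hasDerivAt_powerPrimitive ha (norm_exp_I_mul_lt_one hz)).comp z h1

theorem closure_upperHalfPlane : closure {z : ℂ | 0 < z.im} = {z : ℂ | 0 ≤ z.im} :=
  Complex.closure_setOfPred_lt_im 0

theorem diffContOnCl_stripPrimitive (ha : ∀ n, ‖a n‖ ≤ 1) (h2 : Summable fun n => ‖a n‖ ^ 2) :
    DiffContOnCl ℂ (stripPrimitive a) {z : ℂ | 0 < z.im} where
  differentiableOn := fun _ hz =>
    (hasDerivAt_stripPrimitive ha hz).differentiableAt.differentiableWithinAt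
  continuousOn := by
    rw [closure_upperHalfPlane]
    refine (continuousOn_powerPrimitive h2).comp (by fun_prop) fun z hz => ?_
    rw [mem_closedBall_zero_iff, norm_exp_I_mul, Real.exp_le_one_iff]
    exact neg_nonpos.2 hz

/-- The derivative is `i w φ(w)`, of modulus at most `1` on the convex open half-plane; continuity
carries the estimate to the closure. -/
theorem lipschitzOnWith_stripPrimitive (ha : ∀ n, ‖a n‖ ≤ 1) (h2 : Summable fun n => ‖a n‖ ^ 2)
    (hφ : ∀ w : ℂ, ‖w‖ < 1 → ‖powerSum a w‖ ≤ 1) :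
    LipschitzOnWith 1 (stripPrimitive a) {z : ℂ | 0 ≤ z.im} := by
  rw [← closure_upperHalfPlane]
  refine LipschitzOnWith.closure (diffContOnCl_stripPrimitive ha h2).continuousOn ?_
  refine Convex.lipschitzOnWith_of_nnnorm_deriv_le (𝕜 := ℂ)
    (fun z hz => (hasDerivAt_stripPrimitive ha hz).differentiableAt) (fun z hz => ?_)
    (convex_halfSpace_im_gt 0)
  rw [(hasDerivAt_stripPrimitive ha hz).deriv, ← NNReal.coe_le_coe, coe_nnnorm, norm_mul, norm_mul,
    norm_I, mul_one, NNReal.coe_one]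
  have h1 := norm_exp_I_mul_lt_one hz
  exact mul_le_one₀ (hφ _ h1) (norm_nonneg _) h1.le

/-- Fatou's theorem for a bounded power series, in the coordinate `z` with `w = exp (i z)`. -/
theorem ae_exists_tendsto_norm_powerSum (ha : ∀ n, ‖a n‖ ≤ 1)
    (h2 : Summable fun n => ‖a n‖ ^ 2) (hφ : ∀ w : ℂ, ‖w‖ < 1 → ‖powerSum a w‖ ≤ 1) :
    ∀ᵐ θ : ℝ, ∃ g : ℝ, ∀ C : ℝ, 0 ≤ C → Filter.Tendsto (fun z => ‖powerSum a (exp (I * z))‖)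
      (𝓝[boundaryCone θ C] (θ : ℂ)) (𝓝 g) := by
  have hlip := lipschitzOnWith_stripPrimitive ha h2 hφ
  have hreal : LipschitzWith 1 fun t : ℝ => stripPrimitive a t := by
    refine LipschitzWith.of_dist_le_mul fun s t => ?_
    have := hlip.dist_le_mul (s : ℂ) (by simp) (t : ℂ) (by simp)
    rwa [Complex.dist_eq (s : ℂ), ← ofReal_sub, norm_real, ← dist_eq_norm] at this
  -- Rademacher's theorem for the Lipschitz boundary function. At a point of differentiability `i w
  -- φ(w)` has a nontangential limit, and dividing its modulus by `|w| → 1` leaves that of `φ`.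
  filter_upwards [hreal.ae_differentiableAt] with θ hθ
  refine ⟨‖deriv (fun t : ℝ => stripPrimitive a t) θ‖, fun C hC => ?_⟩
  have h3 := (tendsto_deriv_boundaryCone (M := 1) (diffContOnCl_stripPrimitive ha h2)
    (fun z hz => ?_) hθ.hasDerivAt hC).norm
  · have h4 : Filter.Tendsto (fun z : ℂ => ‖exp (I * z)‖) (𝓝[boundaryCone θ C] (θ : ℂ)) (𝓝 1) := by
      have h5 : Continuous fun z : ℂ => ‖exp (I * z)‖ := by fun_prop
      have h6 := h5.tendsto (θ : ℂ)
      rw [norm_exp_I_mul] at h6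
      simpa using h6.mono_left nhdsWithin_le_nhds
    have h5 := h3.div h4 one_ne_zero
    rw [div_one] at h5
    refine h5.congr' ?_
    filter_upwards [self_mem_nhdsWithin] with z hz
    rw [Pi.div_apply, (hasDerivAt_stripPrimitive ha hz.1).deriv, norm_mul, norm_mul, norm_I,
      mul_one,
      mul_div_cancel_right₀]
    exact norm_ne_zero_iff.2 (exp_ne_zero _)
  · have := hlip.dist_le_mul z hz (θ : ℂ) (by simp)
    simpa [dist_eq_norm] using this

/-- Parseval's identity for an absolutely convergent Fourier series. -/
theorem integral_norm_sq_fourierSeries {c : ℕ → ℂ} (hc : Summable fun n => ‖c n‖) :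
    ∫ θ in (0 : ℝ)..2 * Real.pi, ‖∑' n : ℕ, c n * exp (I * θ) ^ n‖ ^ 2 =
      2 * Real.pi * ∑' n, ‖c n‖ ^ 2 := by
  have he : ∀ θ : ℝ, ‖exp (I * θ)‖ = 1 := fun θ => by rw [norm_exp_I_mul]; simp
  have hcont : Continuous fun θ : ℝ => ∑' n : ℕ, c n * exp (I * θ) ^ n :=
    continuous_tsum (fun n => by fun_prop) hc (fun n θ => by simp [he])
  have hsum : ∀ θ : ℝ, Summable fun n => c n * exp (I * θ) ^ n := fun θ =>
    Summable.of_norm_bounded hc (fun n => by simp [he])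
  have horth : ∀ m n : ℕ, ∫ θ in (0 : ℝ)..2 * Real.pi,
      exp (I * θ) ^ n * (starRingEnd ℂ) (exp (I * θ) ^ m) = if n = m then 2 * Real.pi else 0 := by
    intro m n
    have h1 : ∀ θ : ℝ, exp (I * θ) ^ n * (starRingEnd ℂ) (exp (I * θ) ^ m) =
        exp ((((n : ℂ) - m) * I) * θ) := by
      intro θ
      rw [map_pow, ← exp_conj, ← exp_nat_mul, ← exp_nat_mul, ← exp_add]
      congr 1
      simp only [map_mul, conj_I, conj_ofReal]
      ring
    simp_rw [h1]
    split_ifs with h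
    · simp [h]
    · have h2 : ((n : ℂ) - m) * I ≠ 0 :=
        mul_ne_zero (sub_ne_zero.2 (Nat.cast_injective.ne h)) I_ne_zero
      rw [integral_exp_mul_complex h2]
      have h3 : ((n : ℂ) - m) * I * ((2 * Real.pi : ℝ) : ℂ) =
          (((n : ℤ) - (m : ℤ) : ℤ) : ℂ) * (2 * Real.pi * I) := by push_cast; ring
      rw [h3, exp_int_mul_two_pi_mul_I]
      simp
  have hcoef : ∀ m : ℕ, ∫ θ in (0 : ℝ)..2 * Real.pi,
      (∑' n : ℕ, c n * exp (I * θ) ^ n) * (starRingEnd ℂ) (exp (I * θ) ^ m) =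
        2 * Real.pi * c m := by
    intro m
    have h1 := intervalIntegral.hasSum_integral_of_dominated_convergence (μ := MeasureTheory.volume)
      (a := 0) (b := 2 * Real.pi)
      (F := fun (n : ℕ) (θ : ℝ) => (c n * exp (I * θ) ^ n) * (starRingEnd ℂ) (exp (I * θ) ^ m))
      (f := fun θ : ℝ => (∑' n : ℕ, c n * exp (I * θ) ^ n) * (starRingEnd ℂ) (exp (I * θ) ^ m))
      (fun n _ => ‖c n‖)
      (fun n => (by fun_prop : Continuous _).aestronglyMeasurable)
      (fun n => Filter.Eventually.of_forall fun θ _ => by simp [he])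
      (Filter.Eventually.of_forall fun θ _ => hc) (by simp)
      (Filter.Eventually.of_forall fun θ _ => (hsum θ).hasSum.mul_right _)
    have h2 : ∀ n, ∫ θ in (0 : ℝ)..2 * Real.pi, (c n * exp (I * θ) ^ n) *
        (starRingEnd ℂ) (exp (I * θ) ^ m) = if n = m then 2 * Real.pi * c m else 0 := by
      intro n
      simp_rw [mul_assoc]
      rw [intervalIntegral.integral_const_mul, horth]
      split_ifs with h
      · rw [h]; push_cast; ring
      · simp
    simp_rw [h2] at h1
    exact h1.unique (hasSum_ite_eq m _)
  -- Only the conjugate factor is expanded here; each resulting integral is a Fourier coefficient,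
  -- known from `hcoef`.
  have h1 := intervalIntegral.hasSum_integral_of_dominated_convergence (μ := MeasureTheory.volume)
    (a := 0) (b := 2 * Real.pi)
    (F := fun (m : ℕ) (θ : ℝ) => (∑' n : ℕ, c n * exp (I * θ) ^ n) *
      (starRingEnd ℂ) (c m * exp (I * θ) ^ m))
    (f := fun θ : ℝ => (∑' n : ℕ, c n * exp (I * θ) ^ n) *
      (starRingEnd ℂ) (∑' n : ℕ, c n * exp (I * θ) ^ n))
    (fun m _ => (∑' n, ‖c n‖) * ‖c m‖)
    (fun n => (hcont.mul (by fun_prop)).aestronglyMeasurable)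
    (fun n => Filter.Eventually.of_forall fun θ _ => by
      rw [norm_mul, RCLike.norm_conj, norm_mul, norm_pow, he, one_pow, mul_one]
      gcongr
      exact tsum_of_norm_bounded hc.hasSum fun n => by simp [he])
    (Filter.Eventually.of_forall fun θ _ => hc.mul_left _) (by simp)
    (Filter.Eventually.of_forall fun θ _ =>
      (((hsum θ).hasSum.map (starRingEnd ℂ) continuous_conj).mul_left _))
  have h2 : ∀ m : ℕ, ∫ θ in (0 : ℝ)..2 * Real.pi, (∑' n : ℕ, c n * exp (I * θ) ^ n) *
      (starRingEnd ℂ) (c m * exp (I * θ) ^ m) = ((2 * Real.pi * ‖c m‖ ^ 2 : ℝ) : ℂ) := by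
    intro m
    simp_rw [map_mul, mul_left_comm _ ((starRingEnd ℂ) (c m))]
    rw [intervalIntegral.integral_const_mul, hcoef]
    push_cast
    rw [← mul_conj']
    ring
  have h3 : ∀ θ : ℝ, (∑' n : ℕ, c n * exp (I * θ) ^ n) *
      (starRingEnd ℂ) (∑' n : ℕ, c n * exp (I * θ) ^ n) =
        ((‖∑' n : ℕ, c n * exp (I * θ) ^ n‖ ^ 2 : ℝ) : ℂ) := by
    intro θ; rw [mul_conj']; push_cast; rfl
  simp_rw [h2, h3] at h1
  rw [intervalIntegral.integral_ofReal, Complex.hasSum_ofReal] at h1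
  rw [← tsum_mul_left]
  exact h1.tsum_eq.symm

end PowerSeries
end

noncomputable section

/-! ### Boundary modulus one, and passage to the half-plane -/

section InnerFunctions

open Complex MeasureTheory

variable {a : ℕ → ℂ}

theorem tendsto_tsum_norm_sq_mul_exp (h2 : HasSum (fun n => ‖a n‖ ^ 2) 1) {y : ℕ → ℝ}
    (hy0 : ∀ k, 0 ≤ y k) (hy : Filter.Tendsto y Filter.atTop (𝓝 0)) :
    Filter.Tendsto (fun k => ∑' n, ‖a n * (Real.exp (-y k) : ℂ) ^ n‖ ^ 2) Filter.atTop (𝓝 1) := by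
  rw [← h2.tsum_eq]
  refine tendsto_tsum_of_dominated_convergence h2.summable (fun n => ?_)
    (Filter.Eventually.of_forall fun k n => ?_)
  · have hc : Continuous fun t : ℝ => ‖a n * (Real.exp (-t) : ℂ) ^ n‖ ^ 2 := by fun_prop
    simpa [Function.comp_def] using (hc.tendsto 0).comp hy
  · rw [Real.norm_of_nonneg (by positivity), norm_mul, norm_pow, norm_real,
      Real.norm_of_nonneg (Real.exp_pos _).le]
    gcongr
    refine mul_le_of_le_one_right (norm_nonneg _) (pow_le_one₀ (Real.exp_pos _).le ?_)
    rw [Real.exp_le_one_iff]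
    linarith [hy0 k]

theorem integral_norm_sq_powerSum (ha : ∀ n, ‖a n‖ ≤ 1) {y : ℝ} (hy : 0 < y) :
    ∫ θ in (0 : ℝ)..2 * Real.pi, ‖powerSum a (exp (I * (θ + y * I)))‖ ^ 2 =
      2 * Real.pi * ∑' n, ‖a n * (Real.exp (-y) : ℂ) ^ n‖ ^ 2 := by
  have hs : Summable fun n => ‖a n * (Real.exp (-y) : ℂ) ^ n‖ := by
    refine Summable.of_nonneg_of_le (fun n => norm_nonneg _) (fun n => ?_)
      (summable_geometric_of_lt_one (Real.exp_pos (-y)).le (by rw [Real.exp_lt_one_iff]; linarith))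
    rw [norm_mul, norm_pow, norm_real, Real.norm_of_nonneg (Real.exp_pos _).le]
    exact mul_le_of_le_one_left (by positivity) (ha n)
  rw [← integral_norm_sq_fourierSeries hs]
  refine intervalIntegral.integral_congr fun θ _ => ?_
  have h1 : exp (I * (θ + y * I)) = Real.exp (-y) * exp (I * θ) := by
    rw [ofReal_exp, ← exp_add]
    congr 1
    push_cast
    linear_combination (y : ℂ) * I_mul_I
  simp only [h1, powerSum, mul_pow, mul_assoc]

/-- Let `g` be the nontangential limit of `|φ|`. By Parseval and `∑ ‖aₙ‖² = 1`, the integrals of `1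
- |φ|² ≥ 0` over circles approaching the boundary tend to `0`. Fatou's lemma then gives `∫ (1 - g²)
= 0`, so `g = 1` almost everywhere. -/
theorem ae_tendsto_norm_powerSum_one (h2 : HasSum (fun n => ‖a n‖ ^ 2) 1)
    (hφ : ∀ w : ℂ, ‖w‖ < 1 → ‖powerSum a w‖ ≤ 1) :
    ∀ᵐ θ : ℝ, θ ∈ Set.Ioc 0 (2 * Real.pi) → ∀ C : ℝ, 0 ≤ C →
      Filter.Tendsto (fun z => ‖powerSum a (exp (I * z))‖) (𝓝[boundaryCone θ C] (θ : ℂ)) (𝓝 1) := by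
  have ha : ∀ n, ‖a n‖ ≤ 1 := fun n => by
    have := le_hasSum h2 n fun _ _ => by positivity
    exact (sq_le_one_iff₀ (norm_nonneg _)).1 this
  let y : ℕ → ℝ := fun k => 1 / ((k : ℝ) + 1)
  have hy0 : ∀ k, 0 < y k := fun k => by positivity
  have hy : Filter.Tendsto y Filter.atTop (𝓝 0) := tendsto_one_div_add_atTop_nhds_zero_nat
  have him : ∀ (θ : ℝ) k, ((θ : ℂ) + y k * I).im = y k := fun θ k => by simp
  have hlt : ∀ (θ : ℝ) k, ‖exp (I * (θ + y k * I))‖ < 1 := fun θ k =>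
    norm_exp_I_mul_lt_one (by rw [him]; exact hy0 k)
  let D : ℕ → ℝ → ℝ := fun k θ => 1 - ‖powerSum a (exp (I * (θ + y k * I)))‖ ^ 2
  have hD0 : ∀ k θ, 0 ≤ D k θ := fun k θ =>
    sub_nonneg.2 (pow_le_one₀ (norm_nonneg _) (hφ _ (hlt θ k)))
  have hDc : ∀ k, Continuous (D k) := by
    intro k
    have h1 : Continuous fun θ : ℝ => powerSum a (exp (I * (θ + y k * I))) := by
      rw [continuous_iff_continuousAt]
      intro θ
      have h3 : ContinuousAt (fun θ : ℝ => exp (I * (θ + y k * I))) θ := by fun_prop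
      exact ContinuousAt.comp (f := fun θ : ℝ => exp (I * (θ + y k * I)))
        (differentiableAt_powerSum ha (hlt θ k)).continuousAt h3
    fun_prop
  have hπ : (0 : ℝ) ≤ 2 * Real.pi := by positivity
  have hDint : Filter.Tendsto (fun k => ∫ θ in Set.Ioc 0 (2 * Real.pi), D k θ) Filter.atTop
      (𝓝 0) := by
    have h1 : ∀ k, ∫ θ in Set.Ioc 0 (2 * Real.pi), D k θ =
        2 * Real.pi - 2 * Real.pi * ∑' n, ‖a n * (Real.exp (-y k) : ℂ) ^ n‖ ^ 2 := by
      intro k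
      have h3 : Continuous fun θ : ℝ => ‖powerSum a (exp (I * (θ + y k * I)))‖ ^ 2 := by
        have := (continuous_const (y := (1 : ℝ))).sub (hDc k)
        simpa [D, Pi.sub_def] using this
      rw [← intervalIntegral.integral_of_le hπ, intervalIntegral.integral_sub
        (continuous_const.intervalIntegrable _ _) (h3.intervalIntegrable _ _),
        integral_norm_sq_powerSum ha (hy0 k)]
      simp
    simp_rw [h1]
    have := (tendsto_tsum_norm_sq_mul_exp h2 (fun k => (hy0 k).le) hy).const_mul (2 * Real.pi)
    simpa using this.const_sub (2 * Real.pi)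
  have hfat : ∫⁻ θ in Set.Ioc 0 (2 * Real.pi),
      Filter.liminf (fun k => ENNReal.ofReal (D k θ)) Filter.atTop = 0 := by
    refine le_antisymm ((lintegral_liminf_le fun k =>
      (hDc k).measurable.ennreal_ofReal).trans ?_) zero_le
    have h1 : ∀ k, ∫⁻ θ in Set.Ioc 0 (2 * Real.pi), ENNReal.ofReal (D k θ) =
        ENNReal.ofReal (∫ θ in Set.Ioc 0 (2 * Real.pi), D k θ) := fun k =>
      (ofReal_integral_eq_lintegral_ofReal
        ((hDc k).integrableOn_Icc.mono_set Set.Ioc_subset_Icc_self)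
        (Filter.Eventually.of_forall fun θ => hD0 k θ)).symm
    simp_rw [h1]
    have h3 := ENNReal.tendsto_ofReal hDint
    rw [h3.liminf_eq, ENNReal.ofReal_zero]
  rw [lintegral_eq_zero_iff (.liminf fun k => (hDc k).measurable.ennreal_ofReal),
    Filter.EventuallyEq, ae_restrict_iff' measurableSet_Ioc] at hfat
  filter_upwards [hfat, ae_exists_tendsto_norm_powerSum ha h2.summable hφ] with θ h0 ⟨g, hg⟩ hθ
  have h1 := h0 hθ
  have hcone : Filter.Tendsto (fun k => (θ : ℂ) + y k * I) Filter.atTop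
      (𝓝[boundaryCone θ 1] (θ : ℂ)) := by
    refine tendsto_nhdsWithin_iff.2 ⟨?_, Filter.Eventually.of_forall fun k => ⟨?_, ?_⟩⟩
    · have hc : Continuous fun t : ℝ => (θ : ℂ) + t * I := by fun_prop
      simpa [Function.comp_def] using (hc.tendsto 0).comp hy
    · rw [him]; exact hy0 k
    · rw [him, add_sub_cancel_left, norm_mul, norm_I, norm_real,
        Real.norm_of_nonneg (hy0 k).le, mul_one, one_mul]
  have h3 : Filter.Tendsto (fun k => D k θ) Filter.atTop (𝓝 (1 - g ^ 2)) :=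
    (((hg 1 zero_le_one).comp hcone).pow 2).const_sub 1
  rw [Pi.zero_apply, (ENNReal.tendsto_ofReal h3).liminf_eq, ENNReal.ofReal_eq_zero] at h1
  have h4 : 0 ≤ 1 - g ^ 2 := ge_of_tendsto' h3 fun k => hD0 k θ
  have h5 : 0 ≤ g := ge_of_tendsto' ((hg 1 zero_le_one).comp hcone) fun k => norm_nonneg _
  have h6 : g = 1 := by nlinarith
  rw [← h6]
  exact hg

/-- The square of `exp (i arctan x) = (1 + i x) / √(1 + x²)` is `(1 + i x) / (1 - i x)`, and the
term `π` changes its sign. -/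
theorem exp_I_mul_pi_add_two_arctan (x : ℝ) :
    exp (I * ((Real.pi + 2 * Real.arctan x : ℝ) : ℂ)) = (x - I) / (x + I) := by
  have hx : (x : ℂ) + I ≠ 0 := fun h => by simpa using congrArg Complex.im h
  have h1 : exp (I * Real.arctan x) = ((1 / √(1 + x ^ 2) : ℝ) : ℂ) * (1 + x * I) := by
    rw [mul_comm, exp_mul_I, ← ofReal_cos, ← ofReal_sin, Real.cos_arctan, Real.sin_arctan]
    push_cast
    ring
  have h2 : exp (I * ((Real.pi + 2 * Real.arctan x : ℝ) : ℂ)) =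
      exp (Real.pi * I) * exp (I * Real.arctan x) ^ 2 := by
    rw [← exp_nat_mul, ← exp_add]
    congr 1
    push_cast
    ring
  have h3 : ((1 / √(1 + x ^ 2) : ℝ) : ℂ) ^ 2 * (1 + x ^ 2) = 1 := by
    have : (1 / √(1 + x ^ 2)) ^ 2 * (1 + x ^ 2) = 1 := by
      rw [div_pow, Real.sq_sqrt (by positivity)]
      field_simp
    exact_mod_cast this
  rw [h2, h1, exp_pi_mul_I, eq_div_iff hx, mul_pow]
  linear_combination (x - I) * h3 +
    (((1 / √(1 + x ^ 2) : ℝ) : ℂ) ^ 2 * (-x ^ 3 - x ^ 2 * I - 2 * x)) * I_sq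

/-- The inverse map `θ ↦ tan ((θ - π) / 2)` is differentiable on `(0, 2π)`, hence sends null sets to
null sets. -/
theorem ae_of_ae_pi_add_two_arctan {p : ℝ → Prop}
    (h : ∀ᵐ θ : ℝ, θ ∈ Set.Ioc 0 (2 * Real.pi) → p θ) :
    ∀ᵐ x : ℝ, p (Real.pi + 2 * Real.arctan x) := by
  rw [ae_iff] at h ⊢
  let s : Set ℝ := {θ | ¬ (θ ∈ Set.Ioc 0 (2 * Real.pi) → p θ)} ∩ Set.Ioo 0 (2 * Real.pi)
  have hs : volume s = 0 := measure_mono_null Set.inter_subset_left h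
  let f : ℝ → ℝ := fun θ => Real.tan ((θ - Real.pi) / 2)
  have hf : DifferentiableOn ℝ f s := by
    rintro θ ⟨-, h1, h2⟩
    have hc : Real.cos ((θ - Real.pi) / 2) ≠ 0 :=
      (Real.cos_pos_of_mem_Ioo ⟨by linarith, by linarith⟩).ne'
    refine DifferentiableAt.differentiableWithinAt ?_
    have h3 : DifferentiableAt ℝ (fun θ : ℝ => (θ - Real.pi) / 2) θ := by fun_prop
    exact DifferentiableAt.comp (g := Real.tan) θ (Real.differentiableAt_tan.2 hc) h3
  refine measure_mono_null (fun x hx => ?_)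
    (addHaar_image_eq_zero_of_differentiableOn_of_addHaar_eq_zero volume hf hs)
  have h1 := Real.neg_pi_div_two_lt_arctan x
  have h2 := Real.arctan_lt_pi_div_two x
  refine ⟨Real.pi + 2 * Real.arctan x, ⟨?_, by constructor <;> linarith⟩, ?_⟩
  · intro h3
    exact hx (h3 ⟨by linarith, by linarith⟩)
  · simp only [f]
    rw [add_sub_cancel_left, mul_div_cancel_left₀ _ two_ne_zero, Real.tan_arctan]

/-- The vertical line over `x` is mapped to a nontangential path by the coordinate change from
`(z - i) / (z + i)` to `exp (i z)`. -/
theorem exists_tendsto_boundaryCone (x : ℝ) : ∃ (γ : ℝ → ℂ) (C : ℝ), 0 ≤ C ∧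
    (∀ᶠ y in 𝓝[>] (0 : ℝ), exp (I * γ y) = (x + y * I - I) / (x + y * I + I)) ∧
    Filter.Tendsto γ (𝓝[>] 0)
      (𝓝[boundaryCone (Real.pi + 2 * Real.arctan x) C]
        ((Real.pi + 2 * Real.arctan x : ℝ) : ℂ)) := by
  have hx : (x : ℂ) + I ≠ 0 := fun h => by simpa using congrArg Complex.im h
  have hx' : (x : ℂ) - I ≠ 0 := fun h => by simpa using congrArg Complex.im h
  set θ := Real.pi + 2 * Real.arctan x with hθ
  have hexp := exp_I_mul_pi_add_two_arctan x
  rw [← hθ] at hexp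
  -- Dividing by the boundary value normalises `q 0 = 1`, so the principal logarithm is smooth near
  -- it, and `θ - i log q` lifts the path to the coordinate `exp (i z)`.
  let q : ℝ → ℂ := fun y => (x + y * I - I) / (x + y * I + I) * ((x + I) / (x - I))
  let l : ℝ → ℂ := fun y => log (q y)
  let κ : ℝ := 2 / (x ^ 2 + 1)
  have hκ : 0 < κ := by positivity
  have hq0 : q 0 = 1 := by
    simp only [q, ofReal_zero, zero_mul, add_zero]
    field_simp
  have hq : HasDerivAt q (-κ : ℂ) 0 := by
    have h1 : HasDerivAt (fun y : ℝ => (x : ℂ) + y * I - I) I 0 := by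
      simpa using ((((hasDerivAt_id (0 : ℝ)).ofReal_comp).mul_const I).const_add
          (x : ℂ)).sub_const I
    have h2 : HasDerivAt (fun y : ℝ => (x : ℂ) + y * I + I) I 0 := by
      simpa using ((((hasDerivAt_id (0 : ℝ)).ofReal_comp).mul_const I).const_add
          (x : ℂ)).add_const I
    have h3 := (h1.div h2 (by simpa using hx)).mul_const (((x : ℂ) + I) / (x - I))
    have h4 : ((x : ℂ) + I) * (x - I) = x ^ 2 + 1 := by linear_combination -I_sq
    have h5 : (I * (x + (0 : ℝ) * I + I) - (x + (0 : ℝ) * I - I) * I) /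
        (x + (0 : ℝ) * I + I) ^ 2 * (((x : ℂ) + I) / (x - I)) = -κ := by
      simp only [κ, ofReal_zero, zero_mul, add_zero]
      push_cast
      rw [← h4]
      field_simp
      linear_combination 2 * I_sq
    rw [h5] at h3
    exact h3
  have hl : HasDerivAt l (-κ : ℂ) 0 := by
    have h1 := hq.clog_real (by rw [hq0]; exact one_mem_slitPlane)
    rwa [hq0, div_one] at h1
  have hl0 : l 0 = 0 := by simp [l, hq0]
  -- As `l y = -κ y + o(y)`, the path has height at least `κ y / 2` and distance at most `3 κ y / 2`
  -- from `θ`; their ratio is the aperture `3`.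
  refine ⟨fun y => θ - I * l y, 3, by norm_num, ?_, tendsto_nhdsWithin_iff.2 ⟨?_, ?_⟩⟩
  · have h1 : ∀ᶠ y in 𝓝 (0 : ℝ), q y ≠ 0 :=
      hq.continuousAt.eventually_ne (by rw [hq0]; exact one_ne_zero)
    filter_upwards [h1.filter_mono nhdsWithin_le_nhds] with y hy
    have h2 : I * (θ - I * l y) = I * θ + l y := by linear_combination -(l y) * I_sq
    rw [h2, exp_add, hexp, exp_log hy]
    simp only [q]
    field_simp
  · have h1 : Filter.Tendsto (fun y => (θ : ℂ) - I * l y) (𝓝 0) (𝓝 (θ - I * l 0)) :=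
      ((show Filter.Tendsto l (𝓝 0) (𝓝 (l 0)) from hl.continuousAt).const_mul I).const_sub _
    rw [hl0, mul_zero, sub_zero] at h1
    exact h1.mono_left nhdsWithin_le_nhds
  · have h1 := (hasDerivAt_iff_isLittleO.1 hl).def (half_pos hκ)
    filter_upwards [h1.filter_mono nhdsWithin_le_nhds, self_mem_nhdsWithin] with y h2 hy
    have hy' : 0 < y := hy
    rw [hl0, sub_zero, sub_zero, Real.norm_of_nonneg hy'.le, real_smul] at h2
    have h3 := (abs_re_le_norm _).trans h2
    have h4 : (l y - y * (-κ : ℂ)).re = (l y).re + y * κ := by simp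
    rw [h4, abs_le] at h3
    have h5 : ‖l y‖ ≤ 3 / 2 * κ * y := by
      have h6 : ‖l y‖ ≤ ‖l y - y * (-κ : ℂ)‖ + ‖(y * (-κ : ℂ))‖ := norm_le_norm_sub_add _ _
      have h7 : ‖(y * (-κ : ℂ))‖ = y * κ := by
        rw [norm_mul, norm_neg, norm_real, norm_real, Real.norm_of_nonneg hy'.le,
          Real.norm_of_nonneg hκ.le]
      linarith
    have h6 : ((θ : ℂ) - I * l y).im = -(l y).re := by simp
    have h7 : 0 < y * κ := mul_pos hy' hκ
    refine ⟨?_, ?_⟩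
    · rw [h6]; nlinarith
    · rw [h6, sub_sub_cancel_left, norm_neg, norm_mul, norm_I, one_mul]
      nlinarith

/-- The function of the upper half-plane which corresponds to `∑ aₙ wⁿ`. -/
def halfPlaneSum (a : ℕ → ℂ) (z : ℂ) : ℂ := powerSum a ((z - I) / (z + I))

theorem norm_cayley_lt_one {z : ℂ} (hz : 0 < z.im) : ‖(z - I) / (z + I)‖ < 1 := by
  have h0 : z + I ≠ 0 := fun h => by
    have := congrArg Complex.im h
    simp at this
    linarith
  rw [norm_div, div_lt_one (norm_pos_iff.2 h0), ← sq_lt_sq₀ (norm_nonneg _) (norm_nonneg _),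
    Complex.sq_norm, Complex.sq_norm, normSq_apply, normSq_apply]
  simp
  nlinarith

theorem isInnerUpperHalfPlane_halfPlaneSum (h2 : HasSum (fun n => ‖a n‖ ^ 2) 1)
    (hφ : ∀ w : ℂ, ‖w‖ < 1 → ‖powerSum a w‖ ≤ 1) : IsInnerUpperHalfPlane (halfPlaneSum a) where
  holomorphic := by
    have ha : ∀ n, ‖a n‖ ≤ 1 := fun n => by
      have := le_hasSum h2 n fun _ _ => by positivity
      exact (sq_le_one_iff₀ (norm_nonneg _)).1 this
    intro z hz
    have h0 : z + I ≠ 0 := fun h => by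
      have := congrArg Complex.im h
      have hz' : 0 < z.im := hz
      simp at this
      linarith
    refine DifferentiableAt.differentiableWithinAt ?_
    have h1 : DifferentiableAt ℂ (fun z => (z - I) / (z + I)) z := by fun_prop (disch := exact h0)
    exact DifferentiableAt.comp (f := fun z => (z - I) / (z + I)) z
      (differentiableAt_powerSum ha (norm_cayley_lt_one hz)) h1
  bounded := ⟨1, fun z hz => hφ _ (norm_cayley_lt_one hz)⟩
  boundary := by
    filter_upwards [ae_of_ae_pi_add_two_arctan (ae_tendsto_norm_powerSum_one h2 hφ)] with x hx
    obtain ⟨γ, C, hC, hγ, hlim⟩ := exists_tendsto_boundaryCone x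
    refine ((hx C hC).comp hlim).congr' ?_
    filter_upwards [hγ] with y hy
    simp only [Function.comp_apply, hy, halfPlaneSum]

theorem discCoeff_halfPlaneSum (ha : ∀ n, ‖a n‖ ≤ 1) (n : ℕ) :
    discCoeff (halfPlaneSum a) n = a n := by
  rw [← iteratedDeriv_powerSum ha n, discCoeff]
  congr 1
  refine Filter.EventuallyEq.iteratedDeriv_eq n ?_
  have h1 : ∀ᶠ w : ℂ in 𝓝 0, w ≠ 1 := isOpen_ne.mem_nhds zero_ne_one
  filter_upwards [h1] with w hw
  have hw' : 1 - w ≠ 0 := sub_ne_zero.2 hw.symm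
  have h3 : I * (1 + w) / (1 - w) + I ≠ 0 := by
    have : I * (1 + w) / (1 - w) + I = 2 * I / (1 - w) := by field_simp; ring
    rw [this]
    exact div_ne_zero (by simp) hw'
  simp only [halfPlaneSum]
  congr 1
  rw [div_eq_iff h3]
  field_simp
  ring

end InnerFunctions
end

noncomputable section

/-! ### The Cayley transform of the generator of a unitary group -/

section UnitaryGroup

open MeasureTheory

variable {H : Type*} [NormedAddCommGroup H] [InnerProductSpace ℂ H]

/-- `W` is a strongly continuous one-parameter group of unitary operators. -/
structure IsUnitaryGroup (W : ℝ → (H ≃ₗᵢ[ℂ] H)) : Prop where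
  zero : ∀ x, W 0 x = x
  add : ∀ s t x, W (s + t) x = W s (W t x)
  continuous : ∀ x, Continuous fun t => W t x

variable {W : ℝ → (H ≃ₗᵢ[ℂ] H)}

theorem IsUnitaryGroup.neg (hW : IsUnitaryGroup W) : IsUnitaryGroup fun t => W (-t) where
  zero x := by rw [neg_zero, hW.zero]
  add s t x := by rw [neg_add, hW.add]
  continuous x := (hW.continuous x).comp continuous_neg

theorem IsUnitaryGroup.inner_left (hW : IsUnitaryGroup W) (t : ℝ) (x y : H) :
    ⟪W t x, y⟫_ℂ = ⟪x, W (-t) y⟫_ℂ := by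
  rw [← (W (-t)).inner_map_map, ← hW.add, neg_add_cancel, hW.zero]

theorem IsUnitaryGroup.continuous_orbit (hW : IsUnitaryGroup W) (x : H) :
    Continuous fun t : ℝ => (Real.exp (-t) : ℂ) • W t x :=
  Continuous.smul (by fun_prop) (hW.continuous x)

theorem IsUnitaryGroup.integrableOn_orbit (hW : IsUnitaryGroup W) (x : H) (s : ℝ) :
    IntegrableOn (fun t : ℝ => (Real.exp (-t) : ℂ) • W t x) (Set.Ioi s) := by
  refine ((integrableOn_exp_neg_Ioi s).mul_const ‖x‖).mono'
    (hW.continuous_orbit x).aestronglyMeasurable (Filter.Eventually.of_forall fun t => ?_)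
  rw [norm_smul, LinearIsometryEquiv.norm_map, Complex.norm_real,
    Real.norm_of_nonneg (Real.exp_pos _).le]

/-- The operator `∫₀^∞ e⁻ᵗ W(t) dt`, the value at `1` of the resolvent of the generator. -/
def IsUnitaryGroup.resolvent (hW : IsUnitaryGroup W) : H →L[ℂ] H :=
  LinearMap.mkContinuous
    { toFun := fun x => ∫ t in Set.Ioi (0 : ℝ), (Real.exp (-t) : ℂ) • W t x
      map_add' := fun x y => by
        rw [← integral_add (hW.integrableOn_orbit x 0) (hW.integrableOn_orbit y 0)]
        simp only [map_add, smul_add]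
      map_smul' := fun c x => by
        rw [RingHom.id_apply, ← integral_smul]
        simp only [map_smul, smul_comm c] } 1 (fun x => by
      have h := norm_integral_le_of_norm_le (f := fun t : ℝ => (Real.exp (-t) : ℂ) • W t x)
        ((integrableOn_exp_neg_Ioi 0).mul_const ‖x‖) (Filter.Eventually.of_forall fun t => by
          rw [norm_smul, LinearIsometryEquiv.norm_map, Complex.norm_real,
            Real.norm_of_nonneg (Real.exp_pos _).le])
      rwa [integral_mul_const, integral_exp_neg_Ioi_zero] at h)

theorem IsUnitaryGroup.resolvent_apply (hW : IsUnitaryGroup W) (x : H) :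
    hW.resolvent x = ∫ t in Set.Ioi (0 : ℝ), (Real.exp (-t) : ℂ) • W t x := rfl

/-- The Cayley transform `1 - 2 ∫₀^∞ e⁻ᵗ W(t) dt` of the generator. -/
def IsUnitaryGroup.cayley (hW : IsUnitaryGroup W) : H →L[ℂ] H := 1 - (2 : ℂ) • hW.resolvent

theorem IsUnitaryGroup.cayley_apply (hW : IsUnitaryGroup W) (x : H) :
    hW.cayley x = x - (2 : ℂ) • hW.resolvent x := rfl

variable [CompleteSpace H]

theorem IsUnitaryGroup.inner_resolvent_left (hW : IsUnitaryGroup W) (x y : H) :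
    ⟪hW.resolvent x, y⟫_ℂ = ⟪x, hW.neg.resolvent y⟫_ℂ := by
  rw [resolvent_apply, resolvent_apply, ← integral_inner (hW.neg.integrableOn_orbit y 0),
    ← inner_conj_symm, ← integral_inner (hW.integrableOn_orbit x 0), ← integral_conj]
  refine setIntegral_congr_fun measurableSet_Ioi fun t _ => ?_
  simp only [inner_smul_right, map_mul, Complex.conj_ofReal, inner_conj_symm, hW.inner_left]

/-- The left side is the integral over `(s, ∞)`; the shift of `t` by `s` takes out `e⁻ˢ W(s)`. -/
theorem IsUnitaryGroup.resolvent_sub_integral (hW : IsUnitaryGroup W) (x : H) (s : ℝ) :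
    hW.resolvent x - ∫ t in (0 : ℝ)..s, (Real.exp (-t) : ℂ) • W t x =
      (Real.exp (-s) : ℂ) • W s (hW.resolvent x) := by
  rw [resolvent_apply, ← intervalIntegral.integral_interval_add_Ioi (hW.integrableOn_orbit x 0)
    (hW.integrableOn_orbit x s), add_sub_cancel_left,
    intervalIntegral.integral_interval_add_Ioi (hW.integrableOn_orbit x 0)
    (hW.integrableOn_orbit x s)]
  have h1 := (measurePreserving_add_right volume s).setIntegral_preimage_emb
    (measurableEmbedding_addRight s) (fun t : ℝ => (Real.exp (-t) : ℂ) • W t x) (Set.Ioi s)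
  have h2 : (fun t => t + s) ⁻¹' Set.Ioi s = Set.Ioi (0 : ℝ) := by ext t; simp
  rw [← h1, h2]
  have h3 : ∀ t : ℝ, (Real.exp (-(t + s)) : ℂ) • W (t + s) x =
      (Real.exp (-s) : ℂ) • W s ((Real.exp (-t) : ℂ) • W t x) := by
    intro t
    rw [map_smul, ← hW.add, smul_smul, ← Complex.ofReal_mul, ← Real.exp_add, add_comm t s, neg_add]
  simp_rw [h3]
  rw [integral_smul]
  congr 1
  exact ((W s).toContinuousLinearEquiv : H →L[ℂ] H).integral_comp_comm
    (hW.integrableOn_orbit x 0)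

/-- Differentiate at `s = 0`, in two ways, the squared norm of the remaining integral over `(s, ∞)`,
which equals `e⁻²ˢ ‖R x‖²` for the resolvent `R`. The identity says exactly that `1 - 2R` is
isometric. -/
theorem IsUnitaryGroup.two_mul_inner_resolvent (hW : IsUnitaryGroup W) (x : H) :
    2 * ⟪hW.resolvent x, hW.resolvent x⟫_ℂ =
      ⟪hW.resolvent x, x⟫_ℂ + ⟪x, hW.resolvent x⟫_ℂ := by
  set y := hW.resolvent x with hy
  have hc := hW.continuous_orbit x
  have h1 : HasDerivAt (fun s => y - ∫ t in (0 : ℝ)..s, (Real.exp (-t) : ℂ) • W t x) (-x) 0 := by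
    have := (intervalIntegral.integral_hasDerivAt_right (hc.intervalIntegrable 0 0)
      hc.aestronglyMeasurable.stronglyMeasurableAtFilter hc.continuousAt).const_sub y
    simpa [hW.zero] using this
  have h2 := h1.inner ℂ h1
  have h3 : ∀ s : ℝ, ⟪y - ∫ t in (0 : ℝ)..s, (Real.exp (-t) : ℂ) • W t x,
      y - ∫ t in (0 : ℝ)..s, (Real.exp (-t) : ℂ) • W t x⟫_ℂ =
        ((Real.exp (-2 * s) : ℝ) : ℂ) * ⟪y, y⟫_ℂ := by
    intro s
    rw [hy, hW.resolvent_sub_integral, inner_smul_left, inner_smul_right,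
      LinearIsometryEquiv.inner_map_map, Complex.conj_ofReal, ← mul_assoc, ← Complex.ofReal_mul,
      ← Real.exp_add]
    ring_nf
  simp_rw [h3] at h2
  have h4 : HasDerivAt (fun s : ℝ => ((Real.exp (-2 * s) : ℝ) : ℂ) * ⟪y, y⟫_ℂ)
      (((-2 : ℝ) : ℂ) * ⟪y, y⟫_ℂ) 0 := by
    have h5 : HasDerivAt (fun s : ℝ => Real.exp (-2 * s)) (-2) 0 := by
      simpa using ((hasDerivAt_id (0 : ℝ)).const_mul (-2)).exp
    exact h5.ofReal_comp.mul_const _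
  have h6 := h2.unique h4
  simp only [intervalIntegral.integral_same, sub_zero, inner_neg_left, inner_neg_right] at h6
  push_cast at h6
  linear_combination h6

theorem IsUnitaryGroup.norm_cayley (hW : IsUnitaryGroup W) (x : H) : ‖hW.cayley x‖ = ‖x‖ := by
  have h : ⟪hW.cayley x, hW.cayley x⟫_ℂ = ⟪x, x⟫_ℂ := by
    have h1 := hW.two_mul_inner_resolvent x
    simp only [cayley_apply, inner_sub_left, inner_sub_right, inner_smul_left, inner_smul_right,
      map_ofNat]
    linear_combination 2 * h1
  rw [← sq_eq_sq₀ (norm_nonneg _) (norm_nonneg _), ← @inner_self_eq_norm_sq ℂ,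
    ← @inner_self_eq_norm_sq ℂ, h]

/-- Time reversal serves twice: it makes the adjoint isometric too, hence the Cayley transform
unitary, and it shows that closed subspaces invariant under the group are invariant under the
adjoint. -/
theorem IsUnitaryGroup.adjoint_cayley (hW : IsUnitaryGroup W) :
    ContinuousLinearMap.adjoint hW.cayley = hW.neg.cayley := by
  symm
  rw [ContinuousLinearMap.eq_adjoint_iff]
  intro x y
  have h := hW.neg.inner_resolvent_left x y
  simp only [cayley_apply, inner_sub_left, inner_sub_right, inner_smul_left, inner_smul_right,
    map_ofNat, h]
  simp only [resolvent_apply, neg_neg]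

theorem IsUnitaryGroup.cayley_mem_unitary (hW : IsUnitaryGroup W) :
    hW.cayley ∈ unitary (H →L[ℂ] H) := by
  have key : ∀ A : H →L[ℂ] H, (∀ x, ‖A x‖ = ‖x‖) → star A * A = 1 := by
    intro A hA
    ext x
    refine ext_inner_left ℂ fun y => ?_
    change ⟪y, ContinuousLinearMap.adjoint A (A x)⟫_ℂ = ⟪y, x⟫_ℂ
    rw [ContinuousLinearMap.adjoint_inner_right, inner_map_of_norm_eq hA]
  rw [Unitary.mem_iff]
  refine ⟨key _ hW.norm_cayley, ?_⟩
  have h := key _ hW.neg.norm_cayley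
  rwa [← hW.adjoint_cayley, ← ContinuousLinearMap.star_eq_adjoint, star_star] at h

/-- The function `e⁻ᵗ W(t) y` has derivative `-e⁻ᵗ W(t)(y - z)` and tends to zero; integrate over
`(0, ∞)`. -/
theorem IsUnitaryGroup.resolvent_sub_generator (hW : IsUnitaryGroup W) {y z : H}
    (h : HasDerivAt (fun t => W t y) z 0) : hW.resolvent (y - z) = y := by
  have h1 : ∀ t, HasDerivAt (fun t => W t y) (W t z) t := by
    intro t
    have h2 : HasDerivAt (fun s => W s y) z (t - t) := by rwa [sub_self]
    have h3 := h2.comp_sub_const t t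
    have h4 := ((W t).toContinuousLinearEquiv : H →L[ℂ] H).restrictScalars ℝ
      |>.hasFDerivAt.comp_hasDerivAt t h3
    refine h4.congr_of_eventuallyEq (Filter.Eventually.of_forall fun s => ?_)
    change W s y = W t (W (s - t) y)
    rw [← hW.add, add_sub_cancel]
  have h2 : ∀ t : ℝ, HasDerivAt (fun t : ℝ => (Real.exp (-t) : ℂ) • W t y)
      (-((Real.exp (-t) : ℂ) • W t (y - z))) t := by
    intro t
    have h3 : HasDerivAt (fun t : ℝ => (Real.exp (-t) : ℂ)) (-(Real.exp (-t)) : ℝ) t := by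
      have := ((hasDerivAt_id t).neg.exp).ofReal_comp
      simpa using this
    have h4 := h3.smul (h1 t)
    have h5 : (Real.exp (-t) : ℂ) • W t z + ((-Real.exp (-t) : ℝ) : ℂ) • W t y =
        -((Real.exp (-t) : ℂ) • W t (y - z)) := by
      rw [map_sub, smul_sub, Complex.ofReal_neg, neg_smul]
      abel
    rw [h5] at h4
    exact h4
  have h3 : Filter.Tendsto (fun t : ℝ => (Real.exp (-t) : ℂ) • W t y) Filter.atTop (𝓝 0) := by
    rw [tendsto_zero_iff_norm_tendsto_zero]
    have h4 := (Real.tendsto_exp_neg_atTop_nhds_zero).mul_const ‖y‖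
    rw [zero_mul] at h4
    refine h4.congr fun t => ?_
    rw [norm_smul, LinearIsometryEquiv.norm_map, Complex.norm_real,
      Real.norm_of_nonneg (Real.exp_pos _).le]
  have h4 := integral_Ioi_of_hasDerivAt_of_tendsto (a := 0)
    (hW.continuous_orbit y).continuousWithinAt (fun t _ => h2 t)
    (hW.integrableOn_orbit (y - z) 0).neg h3
  rw [integral_neg, neg_zero, Real.exp_zero, Complex.ofReal_one, one_smul, hW.zero, zero_sub,
    neg_inj] at h4
  exact h4

theorem IsUnitaryGroup.resolvent_mem (hW : IsUnitaryGroup W) {G : Submodule ℂ H}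
    (hG : IsClosed (G : Set H)) (h : ∀ t, ∀ x ∈ G, W t x ∈ G) {x : H} (hx : x ∈ G) :
    hW.resolvent x ∈ G := by
  have : CompleteSpace G := hG.completeSpace_coe
  rw [← G.orthogonal_orthogonal]
  intro z hz
  rw [resolvent_apply, ← integral_inner (hW.integrableOn_orbit x 0)]
  refine integral_eq_zero_of_ae (Filter.Eventually.of_forall fun t => ?_)
  exact Submodule.inner_left_of_mem_orthogonal (G.smul_mem _ (h t x hx)) hz

theorem IsUnitaryGroup.cayley_mem (hW : IsUnitaryGroup W) {G : Submodule ℂ H}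
    (hG : IsClosed (G : Set H)) (h : ∀ t, ∀ x ∈ G, W t x ∈ G) {x : H} (hx : x ∈ G) :
    hW.cayley x ∈ G :=
  G.sub_mem hx (G.smul_mem _ (hW.resolvent_mem hG h hx))

end UnitaryGroup

/-! ### Recovering `J x` from `J S x` through the unitary extension -/

section Extension

variable {E H : Type*} [NormedAddCommGroup E] [InnerProductSpace ℂ E] [CompleteSpace E]
  [NormedAddCommGroup H] [InnerProductSpace ℂ H] [CompleteSpace H]
  {a : ℕ → ℂ} {r : ℝ}

/-- `φ(rU)` commutes with everything that commutes with `U`: with `U*`, and therefore, by taking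
adjoints, with `φ(rU)*`. -/
theorem isStarNormal_abelSum {U : H →L[ℂ] H} (hU : U ∈ unitary (H →L[ℂ] H))
    (ha : ∀ n, ‖a n‖ ≤ 1) (h0 : 0 ≤ r) (h1 : r < 1) (hU1 : ‖U‖ ≤ 1) :
    IsStarNormal (abelSum U a r) := by
  rw [Unitary.mem_iff] at hU
  have h2 : star U * abelSum U a r = abelSum U a r * star U := by
    ext x
    refine abelSum_comm (S := star U) hU1 ha h0 h1 (fun x => ?_) x
    exact congrArg (fun A : H →L[ℂ] H => A x) (hU.1.trans hU.2.symm)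
  have h3 : star (abelSum U a r) * U = U * star (abelSum U a r) := by
    have := congrArg star h2
    simpa [star_mul] using this
  refine ⟨?_⟩
  rw [commute_iff_eq]
  ext x
  exact abelSum_comm (S := star (abelSum U a r)) hU1 ha h0 h1
    (fun x => congrArg (fun A : H →L[ℂ] H => A x) h3) x

/-- Invariance of `G` under `U*` means invariance of `Gᗮ` under `U`. The latter passes to the
convergent series `φ(rU)`, and taking adjoints returns to `G`. -/
theorem adjoint_abelSum_mem {U : H →L[ℂ] H} (ha : ∀ n, ‖a n‖ ≤ 1) (h0 : 0 ≤ r) (h1 : r < 1)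
    (hU1 : ‖U‖ ≤ 1) {G : Submodule ℂ H} (hG : IsClosed (G : Set H))
    (h : ∀ x ∈ G, ContinuousLinearMap.adjoint U x ∈ G) {x : H} (hx : x ∈ G) :
    ContinuousLinearMap.adjoint (abelSum U a r) x ∈ G := by
  have : CompleteSpace G := hG.completeSpace_coe
  rw [← G.orthogonal_orthogonal]
  intro z hz
  have hpow : ∀ n : ℕ, (U ^ n) z ∈ Gᗮ := by
    intro n
    induction n with
    | zero => simpa using hz
    | succ n ih =>
      intro y hy
      rw [pow_succ_apply_left, ← ContinuousLinearMap.adjoint_inner_left]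
      exact ih _ (h y hy)
  have h2 : abelSum U a r z ∈ Gᗮ :=
    G.isClosed_orthogonal.mem_of_tendsto (hasSum_abelSum_apply hU1 ha h0 h1 z)
      (Filter.Eventually.of_forall fun s => Submodule.sum_mem _ fun n _ =>
        Submodule.smul_mem _ _ (hpow n))
  rw [ContinuousLinearMap.adjoint_inner_right]
  exact Submodule.inner_left_of_mem_orthogonal hx h2

/-- Let the unitary operator `U` extend `T` along `J`, and let `S` be an isometric function of `T`.
If `J S x` lies in a closed subspace which is invariant under `U*`, then so does `J x`. -/
theorem mem_of_abelSum_mem {T S : E →L[ℂ] E} {U : H →L[ℂ] H} {J : E →L[ℂ] H} (hT : ‖T‖ ≤ 1)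
    (hU : U ∈ unitary (H →L[ℂ] H)) (hU1 : ‖U‖ ≤ 1) (hJ : ∀ x, U (J x) = J (T x))
    (ha : ∀ n, ‖a n‖ ≤ 1)
    (hS : ∀ x, Filter.Tendsto (fun r => abelSum T a r x) (𝓝[<] 1) (𝓝 (S x)))
    (hJS : ∀ x, ‖J (S x)‖ = ‖J x‖) {G : Submodule ℂ H} (hG : IsClosed (G : Set H))
    (hGU : ∀ x ∈ G, ContinuousLinearMap.adjoint U x ∈ G) {x : E} (hx : J (S x) ∈ G) :
    J x ∈ G := by
  have hint : ∀ᶠ r in 𝓝[<] (1 : ℝ), ∀ x, abelSum U a r (J x) = J (abelSum T a r x) := by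
    filter_upwards [eventually_unit_interval] with r hr x
    have h1 := J.hasSum (hasSum_abelSum_apply hT ha hr.1 hr.2 x)
    refine (hasSum_abelSum_apply hU1 ha hr.1 hr.2 (J x)).unique ?_
    have hn : ∀ n : ℕ, J ((T ^ n) x) = (U ^ n) (J x) := by
      intro n
      induction n with
      | zero => simp
      | succ n ih => rw [pow_succ_apply_left, ← hJ, ih, pow_succ_apply_left]
    simpa only [map_smul, hn] using h1
  have hlim : ∀ x, Filter.Tendsto (fun r => abelSum U a r (J x)) (𝓝[<] 1) (𝓝 (J (S x))) := by
    intro x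
    refine ((J.continuous.tendsto _).comp (hS x)).congr' ?_
    filter_upwards [hint] with r hr using (hr x).symm
  have hnorm : Filter.Tendsto
      (fun r => ‖ContinuousLinearMap.adjoint (abelSum U a r) (J (S x)) - J x‖ ^ 2) (𝓝[<] 1)
      (𝓝 0) := by
    -- Expand the square; normality replaces `‖φ(rU)* J S x‖` by `‖φ(rU) J S x‖`, which tends to `‖J
    -- S S x‖ = ‖J x‖`.
    have h1 : Filter.Tendsto (fun r => ‖abelSum U a r (J (S x))‖ ^ 2 -
        2 * RCLike.re ⟪J (S x), abelSum U a r (J x)⟫_ℂ + ‖J x‖ ^ 2) (𝓝[<] 1)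
        (𝓝 (‖J (S (S x))‖ ^ 2 - 2 * RCLike.re ⟪J (S x), J (S x)⟫_ℂ + ‖J x‖ ^ 2)) := by
      refine (((hlim (S x)).norm.pow 2).sub (Filter.Tendsto.const_mul _ ?_)).add_const _
      exact (RCLike.continuous_re.tendsto _).comp (tendsto_const_nhds.inner (hlim x))
    rw [inner_self_eq_norm_sq, hJS, hJS] at h1
    have h2 : ‖J x‖ ^ 2 - 2 * ‖J x‖ ^ 2 + ‖J x‖ ^ 2 = 0 := by ring
    rw [h2] at h1
    refine h1.congr' ?_
    filter_upwards [eventually_unit_interval] with r hr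
    have hn := isStarNormal_abelSum (a := a) hU ha hr.1 hr.2 hU1
    rw [@norm_sub_sq ℂ, ← ContinuousLinearMap.isStarNormal_iff_norm_eq_adjoint.1 hn,
      ContinuousLinearMap.adjoint_inner_left]
  have hlim' : Filter.Tendsto (fun r => ContinuousLinearMap.adjoint (abelSum U a r) (J (S x)))
      (𝓝[<] 1) (𝓝 (J x)) := by
    rw [tendsto_iff_norm_sub_tendsto_zero]
    simpa [Real.sqrt_sq] using hnorm.sqrt
  refine hG.mem_of_tendsto hlim' ?_
  filter_upwards [eventually_unit_interval] with r hr
  exact adjoint_abelSum_mem ha hr.1 hr.2 hU1 hG hGU hx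

/-- The same for a closed subspace which is invariant under a unitary group, if the Cayley
transform of the generator extends `T` along `J`. -/
theorem IsUnitaryGroup.mem_of_mem {W : ℝ → (H ≃ₗᵢ[ℂ] H)} (hW : IsUnitaryGroup W)
    {T S : E →L[ℂ] E} {J : E →L[ℂ] H} (hT : ‖T‖ ≤ 1)
    (hJ : ∀ x, HasDerivAt (fun t => W t (J (x - T x))) (-J (x + T x)) 0) (ha : ∀ n, ‖a n‖ ≤ 1)
    (hS : ∀ x, Filter.Tendsto (fun r => abelSum T a r x) (𝓝[<] 1) (𝓝 (S x)))
    (hJS : ∀ x, ‖J (S x)‖ = ‖J x‖) {G : Submodule ℂ H} (hG : IsClosed (G : Set H))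
    (hGW : ∀ t, ∀ x ∈ G, W t x ∈ G) {x : E} (hx : J (S x) ∈ G) : J x ∈ G := by
  refine mem_of_abelSum_mem hT hW.cayley_mem_unitary (norm_le_one_of_isometry hW.norm_cayley)
    (fun y => ?_) ha hS hJS hG (fun y hy => ?_) hx
  · have h1 := hW.resolvent_sub_generator (hJ y)
    -- So the resolvent sends `2 J y` to `J (y - T y)`, and the Cayley transform sends `J y` to `J T
    -- y`.
    have h2 : J (y - T y) - -J (y + T y) = (2 : ℂ) • J y := by
      rw [map_sub, map_add, two_smul]; abel
    rw [h2, map_smul] at h1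
    rw [hW.cayley_apply, h1, map_sub, sub_sub_cancel]
  · rw [hW.adjoint_cayley]
    exact hW.neg.cayley_mem hG (fun t => hGW (-t)) hy

end Extension
end

noncomputable section

/-! ### Operators of the commutant moving one wandering vector to another -/

section Transfer

variable {E : Type*} [NormedAddCommGroup E] [InnerProductSpace ℂ E] [CompleteSpace E]
  {v w : ℕ → E}

/-- The partial isometry `x ↦ ∑ (vₙ, x) wₙ`, for orthonormal sequences `v` and `w`. -/
def Orthonormal.transfer (hv : Orthonormal ℂ v) (hw : Orthonormal ℂ w) : E →L[ℂ] E :=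
  hw.orthogonalFamily.linearIsometry.toContinuousLinearMap ∘L
    ContinuousLinearMap.adjoint hv.orthogonalFamily.linearIsometry.toContinuousLinearMap

theorem Orthonormal.hasSum_transfer (hv : Orthonormal ℂ v) (hw : Orthonormal ℂ w) (x : E) :
    HasSum (fun n => ⟪v n, x⟫_ℂ • w n) (hv.transfer hw x) := by
  set f := ContinuousLinearMap.adjoint hv.orthogonalFamily.linearIsometry.toContinuousLinearMap x
    with hf
  have h1 : ∀ n, f n = ⟪v n, x⟫_ℂ := by
    intro n
    have h2 : ⟪lp.single 2 n (1 : ℂ), f⟫_ℂ = ⟪v n, x⟫_ℂ := by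
      rw [hf, ContinuousLinearMap.adjoint_inner_right]
      congr 1
      change hv.orthogonalFamily.linearIsometry _ = _
      rw [OrthogonalFamily.linearIsometry_apply_single]
      simp
    rw [← h2, lp.inner_single_left]
    simp
  have h3 := hw.orthogonalFamily.hasSum_linearIsometry f
  simp only [h1, LinearIsometry.toSpanSingleton_apply] at h3
  exact h3

theorem Orthonormal.inner_transfer_left (hv : Orthonormal ℂ v) (hw : Orthonormal ℂ w) (x y : E) :
    ⟪hv.transfer hw x, y⟫_ℂ = ⟪x, hw.transfer hv y⟫_ℂ := by
  simp only [Orthonormal.transfer, ContinuousLinearMap.comp_apply]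
  rw [← ContinuousLinearMap.adjoint_inner_right, ContinuousLinearMap.adjoint_inner_left]

/-- The first coefficient `(e, T x)` vanishes and the others are those of `x`, shifted by one.
Hyperinvariance is applied to these operators and their adjoints. -/
theorem transfer_pow_comm {T : E →L[ℂ] E} (hT : ∀ x, ‖T x‖ = ‖x‖) {e f : E}
    (he : e ∈ wandering T) (he1 : ‖e‖ = 1) (hf : f ∈ wandering T) (hf1 : ‖f‖ = 1) (x : E) :
    (orthonormal_pow hT he he1).transfer (orthonormal_pow hT hf hf1) (T x) =
      T ((orthonormal_pow hT he he1).transfer (orthonormal_pow hT hf hf1) x) := by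
  have h1 := T.hasSum ((orthonormal_pow hT he he1).hasSum_transfer (orthonormal_pow hT hf hf1) x)
  have h2 := (orthonormal_pow hT he he1).hasSum_transfer (orthonormal_pow hT hf hf1) (T x)
  refine h2.unique ?_
  rw [← hasSum_nat_add_iff' 1]
  have h3 : ⟪e, T x⟫_ℂ = 0 := by
    rw [← inner_conj_symm, mem_wandering_iff.1 he, map_zero]
  simp only [Finset.range_one, Finset.sum_singleton, pow_zero, one_apply_eq_self, h3, zero_smul,
    sub_zero, pow_succ_apply_left, inner_map_of_norm_eq hT]
  simpa only [map_smul] using h1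

end Transfer

/-! ### The range of `V` as the range of an inner function of `T` -/

section InvariantRange

variable {E : Type*} [NormedAddCommGroup E] [InnerProductSpace ℂ E]
  {T : E →L[ℂ] E} {a : ℕ → ℂ}

theorem comm_pow_apply {S : E →L[ℂ] E} (hS : ∀ x, S (T x) = T (S x)) (n : ℕ) (x : E) :
    S ((T ^ n) x) = (T ^ n) (S x) := by
  induction n with
  | zero => simp
  | succ n ih => rw [pow_succ_apply_left, hS, ih, pow_succ_apply_left]

/-- A function `∑ aₙ wⁿ` which is inner, the operator `S` being its value at `T`. -/
structure IsInnerFunctionOf (T : E →L[ℂ] E) (a : ℕ → ℂ) (S : E →L[ℂ] E) : Prop where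
  hasSum : HasSum (fun n => ‖a n‖ ^ 2) 1
  norm_le : ∀ w : ℂ, ‖w‖ < 1 → ‖powerSum a w‖ ≤ 1
  tendsto : ∀ x, Filter.Tendsto (fun r => abelSum T a r x) (𝓝[<] 1) (𝓝 (S x))
  norm_map : ∀ x, ‖S x‖ = ‖x‖
  comm : ∀ x, S (T x) = T (S x)

theorem IsInnerFunctionOf.norm_coeff_le {S : E →L[ℂ] E} (h : IsInnerFunctionOf T a S) (n : ℕ) :
    ‖a n‖ ≤ 1 := by
  have := le_hasSum h.hasSum n fun _ _ => by positivity
  exact (sq_le_one_iff₀ (norm_nonneg _)).1 this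

theorem orthonormal_pow_map (hT : ∀ x, ‖T x‖ = ‖x‖) (V : E →ₗᵢ[ℂ] E) (hV : ∀ x, V (T x) = T (V x))
    {d : E} (hd : d ∈ wandering T) (hd1 : ‖d‖ = 1) : Orthonormal ℂ fun n : ℕ => (T ^ n) (V d) := by
  have h := (orthonormal_pow hT hd hd1).comp_linearIsometry V
  have h1 : ∀ n : ℕ, V ((T ^ n) d) = (T ^ n) (V d) :=
    fun n => comm_pow_apply (S := V.toContinuousLinearMap) hV n d
  simpa only [Function.comp_def, h1] using h

variable [CompleteSpace E]

/-- The vector `k = ∑ w̄ⁿ Tⁿ e` is a reproducing kernel: `T* k = w̄ k` and `(k, y) = φ(w)`. The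
vector `k' = ∑ w̄ⁿ Tⁿ y` has the same norm and satisfies `(k, k') = φ(w) ‖k‖²`, so Cauchy–Schwarz
gives the bound. -/
theorem norm_powerSum_le_one (hT : ∀ x, ‖T x‖ = ‖x‖) {e y : E} (he : e ∈ wandering T)
    (he1 : ‖e‖ = 1) (hy : HasSum (fun n => a n • (T ^ n) e) y)
    (hy1 : Orthonormal ℂ fun n : ℕ => (T ^ n) y) {w : ℂ} (hw : ‖w‖ < 1) : ‖powerSum a w‖ ≤ 1 := by
  have hv := orthonormal_pow hT he he1
  have hg : Summable fun n : ℕ => ‖(starRingEnd ℂ) w ^ n‖ ^ 2 := by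
    have h1 : ‖w‖ ^ 2 < 1 := pow_lt_one₀ (norm_nonneg _) hw two_ne_zero
    refine (summable_geometric_of_lt_one (by positivity) h1).congr fun n => ?_
    rw [norm_pow, RCLike.norm_conj, ← pow_mul, ← pow_mul, mul_comm]
  have hs := (hv.summable_smul_iff fun n => (starRingEnd ℂ) w ^ n).2 hg
  obtain ⟨k, hk⟩ := hs
  obtain ⟨k', hk'⟩ := (hy1.summable_smul_iff fun n => (starRingEnd ℂ) w ^ n).2 hg
  have hnorm : ‖k'‖ ^ 2 = ‖k‖ ^ 2 := (hy1.hasSum_norm_sq hk').unique (hv.hasSum_norm_sq hk)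
  have hshift : k = e + (starRingEnd ℂ) w • T k := by
    refine hk.unique ?_
    rw [← hasSum_nat_add_iff' 1]
    have h1 := (T.hasSum hk).const_smul ((starRingEnd ℂ) w)
    simp only [Finset.range_one, Finset.sum_singleton, pow_zero, one_apply_eq_self, one_smul,
      add_sub_cancel_left, pow_succ_apply_left]
    simpa only [map_smul, smul_smul, ← pow_succ'] using h1
  have hkT : ∀ z, ⟪k, T z⟫_ℂ = w * ⟪k, z⟫_ℂ := by
    intro z
    conv_lhs => rw [hshift]
    rw [inner_add_left, inner_smul_left, inner_map_of_norm_eq hT, ← inner_conj_symm e,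
      mem_wandering_iff.1 he]
    simp
  have hkTn : ∀ (n : ℕ) z, ⟪k, (T ^ n) z⟫_ℂ = w ^ n * ⟪k, z⟫_ℂ := by
    intro n z
    induction n with
    | zero => simp
    | succ n ih => rw [pow_succ_apply_left, hkT, ih, pow_succ']; ring
  have hke : ⟪k, e⟫_ℂ = 1 := by
    conv_lhs => rw [hshift]
    rw [inner_add_left, inner_smul_left, mem_wandering_iff.1 he, inner_self_eq_norm_sq_to_K, he1]
    simp
  have hky : ⟪k, y⟫_ℂ = powerSum a w := by
    have h1 : HasSum (fun n => ⟪k, a n • (T ^ n) e⟫_ℂ) ⟪k, y⟫_ℂ := (innerSL ℂ k).hasSum hy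
    simp only [inner_smul_right, hkTn, hke, mul_one] at h1
    exact h1.tsum_eq.symm
  have hkk : ⟪k, k'⟫_ℂ = powerSum a w * ⟪k, k⟫_ℂ := by
    have h1 : HasSum (fun n => ⟪k, (starRingEnd ℂ) w ^ n • (T ^ n) y⟫_ℂ) ⟪k, k'⟫_ℂ :=
      (innerSL ℂ k).hasSum hk'
    have h2 : HasSum (fun n => ⟪k, (starRingEnd ℂ) w ^ n • (T ^ n) e⟫_ℂ) ⟪k, k⟫_ℂ :=
      (innerSL ℂ k).hasSum hk
    refine h1.unique ?_
    refine (h2.mul_left (powerSum a w)).congr_fun fun n => ?_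
    simp only [inner_smul_right, hkTn, hke, hky]
    ring
  have hk0 : 0 < ‖k‖ := norm_pos_iff.2 fun h => by simp [h] at hke
  have h3 := norm_inner_le_norm (𝕜 := ℂ) k k'
  rw [hkk, norm_mul, inner_self_eq_norm_sq_to_K,
    (sq_eq_sq₀ (norm_nonneg _) (norm_nonneg _)).1 hnorm] at h3
  simp only [norm_pow, RCLike.norm_ofReal, abs_norm] at h3
  have h4 : 0 < ‖k‖ * ‖k‖ := mul_pos hk0 hk0
  nlinarith

theorem isClosed_range_of_norm_eq {S : E →L[ℂ] E} (hS : ∀ x, ‖S x‖ = ‖x‖) :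
    IsClosed (LinearMap.range S.toLinearMap : Set E) := by
  have h : Isometry S := AddMonoidHomClass.isometry_of_norm S hS
  have h2 := h.isClosedEmbedding.isClosed_range
  rwa [LinearMap.coe_range]

/-- Each `φ(rT) x` is a limit of combinations of the `Tⁿ x`, hence orthogonal to the range of `S`.
In the limit `S x` is orthogonal to itself. -/
theorem eq_zero_of_pow_orthogonal (hT : ‖T‖ ≤ 1) (ha : ∀ n, ‖a n‖ ≤ 1) {S : E →L[ℂ] E}
    (hS : ∀ x, Filter.Tendsto (fun r => abelSum T a r x) (𝓝[<] 1) (𝓝 (S x)))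
    (hS1 : ∀ x, ‖S x‖ = ‖x‖) {x : E} (hx : ∀ (n : ℕ) y, ⟪(T ^ n) x, S y⟫_ℂ = 0) : x = 0 := by
  have h1 : Filter.Tendsto (fun r => ⟪abelSum T a r x, S x⟫_ℂ) (𝓝[<] 1) (𝓝 ⟪S x, S x⟫_ℂ) :=
    (hS x).inner tendsto_const_nhds
  have h2 : ⟪S x, S x⟫_ℂ = 0 := by
    refine tendsto_nhds_unique (h1.congr' ?_) tendsto_const_nhds
    filter_upwards [eventually_unit_interval] with r hr
    have h3 := (innerSL ℂ (S x)).hasSum (hasSum_abelSum_apply hT ha hr.1 hr.2 x)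
    have h4 : ∀ n, (innerSL ℂ (S x)) ((a n * (r : ℂ) ^ n) • (T ^ n) x) = 0 := by
      intro n
      rw [map_smul, innerSL_apply_apply, ← inner_conj_symm, hx, map_zero, smul_zero]
    simp only [h4] at h3
    have h5 : ⟪S x, abelSum T a r x⟫_ℂ = 0 := h3.unique hasSum_zero
    rw [← inner_conj_symm, h5, map_zero]
  rw [inner_self_eq_zero, ← norm_eq_zero, hS1, norm_eq_zero] at h2
  exact h2

theorem exists_isInnerFunctionOf (hT : ∀ x, ‖T x‖ = ‖x‖) (hp : IsPure T)
    (h2 : HasSum (fun n => ‖a n‖ ^ 2) 1) (hφ : ∀ w : ℂ, ‖w‖ < 1 → ‖powerSum a w‖ ≤ 1) :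
    ∃ S, IsInnerFunctionOf T a S ∧ ∀ c ∈ wandering T, HasSum (fun n => a n • (T ^ n) c) (S c) := by
  obtain ⟨S, h3, h4, h5, h6⟩ := exists_isometry_of_abelSum hT hp h2 hφ
  exact ⟨S, ⟨h2, hφ, h3, h4, h5⟩, h6⟩

/-- Multiplicity one: the commutant of the shift consists of functions of the shift. -/
theorem exists_isInnerFunctionOf_of_finrank (hT : ∀ x, ‖T x‖ = ‖x‖) (hp : IsPure T)
    (V : E →ₗᵢ[ℂ] E) (hV : ∀ x, V (T x) = T (V x))
    (h1 : Module.finrank ℂ (wandering T) = 1) :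
    ∃ a S, IsInnerFunctionOf T a S ∧
      LinearMap.range V.toLinearMap = LinearMap.range S.toLinearMap := by
  obtain ⟨⟨c, hc⟩, hc0, hspan⟩ := finrank_eq_one_iff'.1 h1
  have hc0' : c ≠ 0 := fun h => hc0 (Subtype.ext h)
  set e := ((‖c‖ : ℂ)⁻¹) • c with he_def
  have he : e ∈ wandering T := Submodule.smul_mem _ _ hc
  have he1 : ‖e‖ = 1 := by
    rw [he_def, norm_smul, norm_inv, Complex.norm_real, norm_norm,
      inv_mul_cancel₀ (norm_ne_zero_iff.2 hc0')]
  have hce : ∀ d ∈ wandering T, ∃ z : ℂ, d = z • e := by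
    intro d hd
    obtain ⟨z, hz⟩ := hspan ⟨d, hd⟩
    have hz' : z • c = d := congrArg Subtype.val hz
    refine ⟨z * ‖c‖, ?_⟩
    rw [he_def, smul_smul, mul_assoc, mul_inv_cancel₀ (by simpa using hc0'), mul_one, hz']
  have hv := orthonormal_pow hT he he1
  have hbot : (Submodule.span ℂ (Set.range fun n : ℕ => (T ^ n) e))ᗮ = ⊥ := by
    rw [Submodule.eq_bot_iff]
    refine fun x hx => hp x fun n d hd => ?_
    obtain ⟨z, rfl⟩ := hce d hd
    rw [map_smul, inner_smul_left, hx _ (Submodule.subset_span ⟨n, rfl⟩), mul_zero]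
  let b := HilbertBasis.mkOfOrthogonalEqBot hv hbot
  have hb : ∀ n, b n = (T ^ n) e := fun n => by
    simp only [b, HilbertBasis.coe_mkOfOrthogonalEqBot]
  let a : ℕ → ℂ := fun n => b.repr (V e) n
  have hsum : HasSum (fun n => a n • (T ^ n) e) (V e) := by
    have := b.hasSum_repr (V e)
    simpa only [hb] using this
  have ha2 : HasSum (fun n => ‖a n‖ ^ 2) 1 := by
    have := hv.hasSum_norm_sq hsum
    rwa [V.norm_map, he1, one_pow] at this
  have hφ : ∀ w : ℂ, ‖w‖ < 1 → ‖powerSum a w‖ ≤ 1 := fun w hw =>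
    norm_powerSum_le_one hT he he1 hsum (orthonormal_pow_map hT V hV he he1) hw
  obtain ⟨S, hS, hSN⟩ := exists_isInnerFunctionOf hT hp ha2 hφ
  refine ⟨a, S, hS, ?_⟩
  -- `S` and `V` both commute with `T` and agree at `e`, hence on all `Tⁿ N`; purity gives `S = V`.
  have hSV : LinearMap.eqLocus S.toLinearMap V.toLinearMap = ⊤ := by
    refine hp.eq_top _ (isClosed_eq S.continuous V.continuous) fun n d hd => ?_
    obtain ⟨z, rfl⟩ := hce d hd
    change S _ = V _
    rw [comm_pow_apply hS.comm, map_smul S, (hSN e he).unique hsum]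
    have := comm_pow_apply (S := V.toContinuousLinearMap) hV n (z • e)
    rw [show V ((T ^ n) (z • e)) = _ from this]
    simp
  have hSV' : ∀ x, S x = V x := fun x => by
    have : x ∈ LinearMap.eqLocus S.toLinearMap V.toLinearMap := hSV ▸ Submodule.mem_top
    exact this
  ext x
  simp only [LinearMap.mem_range]
  exact exists_congr fun y => by
    change V y = x ↔ S y = x
    rw [hSV']

/-- If the range of `V` is hyperinvariant for the shift, then it is the range of an inner function
of the shift. -/
theorem exists_isInnerFunctionOf_of_isHyperinvariant (hT : ∀ x, ‖T x‖ = ‖x‖) (hp : IsPure T)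
    (V : E →ₗᵢ[ℂ] E) (hV : ∀ x, V (T x) = T (V x))
    (hyp : IsHyperinvariant (LinearMap.range V.toLinearMap) T) :
    ∃ a S, IsInnerFunctionOf T a S ∧
      LinearMap.range V.toLinearMap = LinearMap.range S.toLinearMap := by
  have hVn : ∀ (n : ℕ) x, V ((T ^ n) x) = (T ^ n) (V x) :=
    fun n x => comm_pow_apply (S := V.toContinuousLinearMap) hV n x
  -- If `N = 0`, purity makes the whole space zero, and the constant function `1` serves.
  by_cases hN : ∀ c ∈ wandering T, c = 0
  · have hE : ∀ x : E, x = 0 := fun x => hp x fun n c hc => by rw [hN c hc]; simp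
    let a : ℕ → ℂ := fun n => if n = 0 then 1 else 0
    have ha2 : HasSum (fun n => ‖a n‖ ^ 2) 1 := by
      convert hasSum_ite_eq 0 (1 : ℝ) using 2 with n
      simp only [a]
      split_ifs <;> simp
    have hφ : ∀ w : ℂ, ‖w‖ < 1 → ‖powerSum a w‖ ≤ 1 := by
      intro w _
      have h : powerSum a w = 1 := by
        rw [powerSum, tsum_eq_single 0 fun n hn => by simp [a, hn]]
        simp [a]
      rw [h, norm_one]
    obtain ⟨S, hS, -⟩ := exists_isInnerFunctionOf hT hp ha2 hφ
    refine ⟨a, S, hS, ?_⟩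
    ext x
    rw [hE x]
    exact iff_of_true (Submodule.zero_mem _) (Submodule.zero_mem _)
  push Not at hN
  obtain ⟨d, hd, hd0⟩ := hN
  -- the operators `∑ (Tⁿ e, ·) Tⁿ f` preserve the wandering subspace of the range of `V`
  have hpres : ∀ (e f : E) (he : e ∈ wandering T) (he1 : ‖e‖ = 1) (hf : f ∈ wandering T)
      (hf1 : ‖f‖ = 1), ∀ d ∈ wandering T, ∃ d' ∈ wandering T,
        (orthonormal_pow hT he he1).transfer (orthonormal_pow hT hf hf1) (V d) = V d' := by
    intro e f he he1 hf hf1 d hd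
    have hcomm := transfer_pow_comm hT he he1 hf hf1
    have hcomm' := transfer_pow_comm hT hf hf1 he he1
    obtain ⟨d', hd'⟩ := hyp ((orthonormal_pow hT he he1).transfer (orthonormal_pow hT hf hf1))
      (ContinuousLinearMap.ext hcomm) (V d) ⟨d, rfl⟩
    refine ⟨d', ?_, hd'.symm⟩
    rw [mem_wandering_iff]
    intro x
    -- The adjoint transfer also preserves the range of `V`. Moving it across turns `(V T x, V d')`
    -- into `(V T z, V d) = (T z, d) = 0`.
    obtain ⟨z, hz⟩ := hyp ((orthonormal_pow hT hf hf1).transfer (orthonormal_pow hT he he1))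
      (ContinuousLinearMap.ext hcomm') (V x) ⟨x, rfl⟩
    have h1 : V d' = _ := hd'
    have h2 : V z = _ := hz
    rw [← V.inner_map_map, h1, ← Orthonormal.inner_transfer_left, hV, hcomm', ← h2, ← hV,
      V.inner_map_map, mem_wandering_iff.1 hd]
  -- A direction of `N` along which `V d` has a nonzero coefficient, so that transferring it to that
  -- same direction does not kill it.
  obtain ⟨m, c, hc, hmc⟩ : ∃ m : ℕ, ∃ c ∈ wandering T, ⟪(T ^ m) c, V d⟫_ℂ ≠ 0 := by
    by_contra! h
    exact hd0 (V.injective ((hp (V d) h).trans V.map_zero.symm))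
  have hc0 : c ≠ 0 := by rintro rfl; simp at hmc
  set e := ((‖c‖ : ℂ)⁻¹) • c with he_def
  have hcn : (‖c‖ : ℂ) ≠ 0 := by simpa using hc0
  have he : e ∈ wandering T := Submodule.smul_mem _ _ hc
  have he1 : ‖e‖ = 1 := by
    rw [he_def, norm_smul, norm_inv, Complex.norm_real, norm_norm,
      inv_mul_cancel₀ (norm_ne_zero_iff.2 hc0)]
  have hme : ⟪(T ^ m) e, V d⟫_ℂ ≠ 0 := by
    rw [he_def, map_smul, inner_smul_left]
    exact mul_ne_zero (by simpa using hc0) hmc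
  have hv := orthonormal_pow hT he he1
  obtain ⟨d₁, hd₁, hy⟩ := hpres e e he he1 he he1 d hd
  have hy0 : d₁ ≠ 0 := by
    rintro rfl
    have h := hv.hasSum_transfer hv (V d)
    rw [hy, map_zero] at h
    have h' := hv.inner_hasSum h m
    rw [inner_zero_right] at h'
    exact hme h'.symm
  set s : ℂ := (‖d₁‖ : ℂ)⁻¹ with hs
  have hd₁' : s • d₁ ∈ wandering T := Submodule.smul_mem _ _ hd₁
  have hd₁n : ‖s • d₁‖ = 1 := by
    rw [norm_smul, norm_inv, Complex.norm_real, norm_norm,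
      inv_mul_cancel₀ (norm_ne_zero_iff.2 hy0)]
  -- The scaling `s` normalises `d₁`, the image under the transfer, and not `d`: only the component
  -- of `V d` along `e` enters `∑ ‖aₙ‖²`.
  let a : ℕ → ℂ := fun n => ⟪(T ^ n) e, V (s • d)⟫_ℂ
  have hsum : HasSum (fun n => a n • (T ^ n) e) (V (s • d₁)) := by
    have h := hv.hasSum_transfer hv (V (s • d))
    rw [map_smul V, map_smul, hy, ← map_smul V, ← map_smul V] at h
    exact h
  have ha2 : HasSum (fun n => ‖a n‖ ^ 2) 1 := by
    have := hv.hasSum_norm_sq hsum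
    rwa [V.norm_map, hd₁n, one_pow] at this
  have hφ : ∀ w : ℂ, ‖w‖ < 1 → ‖powerSum a w‖ ≤ 1 := fun w hw =>
    norm_powerSum_le_one hT he he1 hsum (orthonormal_pow_map hT V hV hd₁' hd₁n) hw
  obtain ⟨S, hS, hSN⟩ := exists_isInnerFunctionOf hT hp ha2 hφ
  refine ⟨a, S, hS, ?_⟩
  -- For a unit vector `g` of `N`, the transfer from `e` to `g` sends `V (s d)` to `∑ aₙ Tⁿ g = S
  -- g`; so `S` maps `N` into `V N`.
  have hSV : ∀ f ∈ wandering T, ∃ d' ∈ wandering T, S f = V d' := by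
    intro f hf
    rcases eq_or_ne f 0 with rfl | hf0
    · exact ⟨0, Submodule.zero_mem _, by simp⟩
    have hfn : (‖f‖ : ℂ) ≠ 0 := by simpa using hf0
    have hg : ((‖f‖ : ℂ)⁻¹) • f ∈ wandering T := Submodule.smul_mem _ _ hf
    have hg1 : ‖((‖f‖ : ℂ)⁻¹) • f‖ = 1 := by
      rw [norm_smul, norm_inv, Complex.norm_real, norm_norm,
        inv_mul_cancel₀ (norm_ne_zero_iff.2 hf0)]
    obtain ⟨d', hd', h⟩ := hpres e _ he he1 hg hg1 (s • d) (Submodule.smul_mem _ _ hd)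
    refine ⟨(‖f‖ : ℂ) • d', Submodule.smul_mem _ _ hd', ?_⟩
    have h3 := (hv.hasSum_transfer (orthonormal_pow hT hg hg1) (V (s • d))).unique (hSN _ hg)
    rw [map_smul V, ← h, h3, map_smul, smul_inv_smul₀ hfn]
  have hVcl : IsClosed (LinearMap.range V.toLinearMap : Set E) :=
    isClosed_range_of_norm_eq (S := V.toContinuousLinearMap) V.norm_map
  have hScl := isClosed_range_of_norm_eq hS.norm_map
  refine le_antisymm ?_ ?_
  · let Q : Submodule ℂ E := (LinearMap.range S.toLinearMap).comap V.toLinearMap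
    have hQcl : IsClosed (Q : Set E) := hScl.preimage V.continuous
    have hQc : CompleteSpace Q := hQcl.completeSpace_coe
    have hQ : Q = ⊤ := by
      rw [← Submodule.orthogonal_eq_bot_iff, Submodule.eq_bot_iff]
      intro q hq
      -- It suffices that every `Tⁿ V q` is orthogonal to the range of `S`, by purity to each `S Tᵏ
      -- f = V Tᵏ d'`.
      have h0 : V q = 0 := by
        refine eq_zero_of_pow_orthogonal (norm_le_one_of_isometry hT) hS.norm_coeff_le hS.tendsto
          hS.norm_map fun n => ?_
        have hker : LinearMap.ker (innerSL ℂ ((T ^ n) (V q)) ∘L S : E →L[ℂ] ℂ).toLinearMap = ⊤ := by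
          refine hp.eq_top _ (ContinuousLinearMap.isClosed_ker _) fun k f hf => ?_
          change ⟪(T ^ n) (V q), S ((T ^ k) f)⟫_ℂ = 0
          obtain ⟨d', hd', h⟩ := hSV f hf
          rw [comm_pow_apply hS.comm, h, ← hVn, ← hVn, V.inner_map_map]
          -- For `k < n` the product reduces to `(T^(n-k) q, d')`, zero because `d'` is wandering.
          -- For `k ≥ n` it is `(q, T^(k-n) d')`, zero because `V T^(k-n) d' = S T^(k-n) f` puts the
          -- second vector in `Q`.
          rcases lt_or_ge k n with hkn | hkn
          · obtain ⟨j, rfl⟩ := Nat.exists_eq_add_of_lt hkn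
            rw [add_assoc, pow_add, mul_apply_eq_comp, inner_pow_apply hT, pow_succ_apply_left,
              mem_wandering_iff.1 hd']
          · obtain ⟨j, rfl⟩ := Nat.exists_eq_add_of_le hkn
            rw [pow_add, mul_apply_eq_comp, inner_pow_apply hT]
            refine Submodule.inner_left_of_mem_orthogonal ?_ hq
            refine ⟨(T ^ j) f, ?_⟩
            change S ((T ^ j) f) = V ((T ^ j) d')
            rw [comm_pow_apply hS.comm, h, hVn]
        intro y
        have : y ∈ LinearMap.ker (innerSL ℂ ((T ^ n) (V q)) ∘L S : E →L[ℂ] ℂ).toLinearMap :=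
          hker ▸ Submodule.mem_top
        exact this
      rw [← norm_eq_zero, V.norm_map, norm_eq_zero] at h0
      exact h0
    rintro _ ⟨x, rfl⟩
    have : x ∈ Q := hQ ▸ Submodule.mem_top
    exact this
  · have hQ : (LinearMap.range V.toLinearMap).comap S.toLinearMap = ⊤ := by
      refine hp.eq_top _ (hVcl.preimage S.continuous) fun n f hf => ?_
      obtain ⟨d', -, h⟩ := hSV f hf
      refine ⟨(T ^ n) d', ?_⟩
      change V ((T ^ n) d') = S ((T ^ n) f)
      rw [comm_pow_apply hS.comm, h, hVn]
    rintro _ ⟨x, rfl⟩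
    have : x ∈ (LinearMap.range V.toLinearMap).comap S.toLinearMap := hQ ▸ Submodule.mem_top
    exact this

end InvariantRange
end

noncomputable section

/-! ### The domain of `B²` in terms of the Cayley transform -/

section SquareDomain

variable {E : Type*} [NormedAddCommGroup E] [InnerProductSpace ℂ E] [CompleteSpace E]
  {B : E →ₗ.[ℂ] E}

/-- The operator `(I - T)²`, where `T` is the Cayley transform of `B`. Its range is `𝒟(B²)`. -/
def squareParam (hB : IsSimpleMaximalSymmetric B) : E →L[ℂ] E := (1 - cayleyTransform hB) ^ 2

theorem squareParam_apply (hB : IsSimpleMaximalSymmetric B) (x : E) :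
    squareParam hB x =
      x - cayleyTransform hB x - cayleyTransform hB (x - cayleyTransform hB x) := by
  simp [squareParam, pow_two]

theorem squareParam_mem (hB : IsSimpleMaximalSymmetric B) (x : E) :
    squareParam hB x ∈ B.domain :=
  squareParam_apply hB x ▸ sub_cayleyTransform_mem hB _

theorem apply_squareParam (hB : IsSimpleMaximalSymmetric B) (x : E) :
    B ⟨squareParam hB x, squareParam_mem hB x⟩ =
      Complex.I • (x - cayleyTransform hB (cayleyTransform hB x)) := by
  have h : (⟨squareParam hB x, squareParam_mem hB x⟩ : B.domain) =
      ⟨_, sub_cayleyTransform_mem hB (x - cayleyTransform hB x)⟩ :=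
    Subtype.ext (squareParam_apply hB x)
  rw [h, apply_sub_cayleyTransform, map_sub]
  congr 1
  abel

theorem apply_squareParam_mem (hB : IsSimpleMaximalSymmetric B) (x : E) :
    B ⟨squareParam hB x, squareParam_mem hB x⟩ ∈ B.domain := by
  have h := sub_cayleyTransform_mem hB (x + cayleyTransform hB x)
  rw [map_add, add_comm x, add_sub_add_left_eq_sub] at h
  rw [apply_squareParam]
  exact B.domain.smul_mem _ h

theorem apply_apply_squareParam (hB : IsSimpleMaximalSymmetric B) (x : E) :
    B ⟨_, apply_squareParam_mem hB x⟩ =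
      -(x + (2 : ℂ) • cayleyTransform hB x + cayleyTransform hB (cayleyTransform hB x)) := by
  have h : (⟨_, apply_squareParam_mem hB x⟩ : B.domain) =
      Complex.I • ⟨_, sub_cayleyTransform_mem hB (x + cayleyTransform hB x)⟩ := by
    ext
    refine (apply_squareParam hB x).trans ?_
    change _ =
      Complex.I • (x + cayleyTransform hB x - cayleyTransform hB (x + cayleyTransform hB x))
    rw [map_add, add_comm x, add_sub_add_left_eq_sub]
  rw [h, B.map_smul, apply_sub_cayleyTransform, smul_smul, Complex.I_mul_I, map_add, two_smul,
    neg_one_smul]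
  abel

/-- Write `u = y - T y` and `B u = i (y + T y) = z - T z`. Adding `y - T y` to `y + T y = -i (z - T
z)` gives `2y = (I - T)(y - i z)`. -/
theorem exists_eq_squareParam (hB : IsSimpleMaximalSymmetric B) (u : B.domain)
    (hu : B u ∈ B.domain) : ∃ x, (u : E) = squareParam hB x := by
  obtain ⟨y, hy⟩ := exists_eq_sub_cayleyTransform hB u
  obtain ⟨z, hz⟩ := exists_eq_sub_cayleyTransform hB ⟨B u, hu⟩
  have h : u = ⟨_, sub_cayleyTransform_mem hB y⟩ := Subtype.ext hy
  have h1 : Complex.I • (y + cayleyTransform hB y) = z - cayleyTransform hB z := by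
    rw [← hz, ← apply_sub_cayleyTransform hB y (sub_cayleyTransform_mem hB y), ← h]
  have h2 : y = (2⁻¹ : ℂ) • (y - Complex.I • z) -
      cayleyTransform hB ((2⁻¹ : ℂ) • (y - Complex.I • z)) := by
    have h3 : y + cayleyTransform hB y = -Complex.I • (z - cayleyTransform hB z) := by
      rw [← h1, smul_smul, neg_mul, Complex.I_mul_I, neg_neg, one_smul]
    have h4 : cayleyTransform hB y = -Complex.I • (z - cayleyTransform hB z) - y :=
      eq_sub_of_add_eq' h3
    rw [map_smul, map_sub, map_smul, h4]
    module
  refine ⟨(2⁻¹ : ℂ) • (y - Complex.I • z), ?_⟩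
  rw [squareParam_apply, ← h2, hy]

theorem isFunctionOf_halfPlaneSum (hB : IsSimpleMaximalSymmetric B) {a : ℕ → ℂ} {S : E →L[ℂ] E}
    (hS : IsInnerFunctionOf (cayleyTransform hB) a S) : IsFunctionOf hB (halfPlaneSum a) S := by
  intro x
  refine (hS.tendsto x).congr' ?_
  filter_upwards [eventually_unit_interval] with r hr
  simp only [discCoeff_halfPlaneSum hS.norm_coeff_le]
  exact (hasSum_abelSum_apply (norm_le_one_of_isometry (norm_cayleyTransform hB))
    hS.norm_coeff_le hr.1 hr.2 x).tsum_eq.symm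

end SquareDomain

/-! ### Vectors of the energy space -/

section EnergyVec

variable {𝔥 : Type*} [NormedAddCommGroup 𝔥] [InnerProductSpace ℂ 𝔥] [CompleteSpace 𝔥]
  {L : 𝔥 →ₗ.[ℂ] 𝔥} (hL : IsPositiveSelfAdjoint L)

theorem energyVec_add (u u' : L.domain) (v v' : 𝔥) :
    energyVec hL (u + u') (v + v') = energyVec hL u v + energyVec hL u' v' := by
  simp only [energyVec, map_add, UniformSpace.Completion.coe_add]
  rfl

theorem energyVec_smul (c : ℂ) (u : L.domain) (v : 𝔥) :
    energyVec hL (c • u) (c • v) = c • energyVec hL u v := by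
  simp only [energyVec, map_smul, UniformSpace.Completion.coe_smul]
  rfl

theorem norm_sq_energyVec (u : L.domain) (v : 𝔥) :
    ‖energyVec hL u v‖ ^ 2 = (⟪L u, (u : 𝔥)⟫_ℂ).re + ‖v‖ ^ 2 := by
  rw [WithLp.prod_norm_sq_eq_of_L2]
  congr 1
  change ‖((EnergyDomain.toDomain hL).symm u : UniformSpace.Completion (EnergyDomain hL))‖ ^ 2 = _
  rw [UniformSpace.Completion.norm_coe, @norm_sq_eq_re_inner ℂ]
  rfl

end EnergyVec

/-! ### The parametrisation of the incoming and outgoing subspaces -/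

section WaveMap

variable {𝔥 : Type*} [NormedAddCommGroup 𝔥] [InnerProductSpace ℂ 𝔥]
  {L : 𝔥 →ₗ.[ℂ] 𝔥} {K : Submodule ℂ 𝔥} [CompleteSpace K]
  {B : K →ₗ.[ℂ] K} (hB : IsSimpleMaximalSymmetric B) (hBL : ExtendsSquare L B)

/-- The operator `(I - T)²`, as a map into `𝒟(L)`. -/
def waveParam : K →ₗ[ℂ] L.domain :=
  (K.subtype ∘ₗ (squareParam hB).toLinearMap).codRestrict L.domain fun x =>
    (hBL ⟨_, squareParam_mem hB x⟩ (apply_squareParam_mem hB x)).1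

theorem coe_waveParam (x : K) : (waveParam hB hBL x : 𝔥) = (squareParam hB x : K) := rfl

theorem apply_waveParam (x : K) : L (waveParam hB hBL x) =
    (B ⟨_, apply_squareParam_mem hB x⟩ : K) :=
  (hBL ⟨_, squareParam_mem hB x⟩ (apply_squareParam_mem hB x)).2

variable [CompleteSpace 𝔥] (hL : IsPositiveSelfAdjoint L)

/-- Here `(L u, u) = (B² u, u) = ‖B u‖²` and `B u = i (I - T²) x`. The energy norm thus sees `x`
only through `‖(I - T²) x‖`, which isometries commuting with `T` preserve. -/
theorem norm_sq_waveVec (c : ℂ) (x : K) :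
    ‖energyVec hL (waveParam hB hBL x) (c • (B ⟨_, squareParam_mem hB x⟩ : K))‖ ^ 2 =
      (1 + ‖c‖ ^ 2) * ‖x - cayleyTransform hB (cayleyTransform hB x)‖ ^ 2 := by
  have h1 : ‖B ⟨_, squareParam_mem hB x⟩‖ =
      ‖x - cayleyTransform hB (cayleyTransform hB x)‖ := by
    rw [apply_squareParam, norm_smul, Complex.norm_I, one_mul]
  have h2 := (hB.symmetric ⟨_, apply_squareParam_mem hB x⟩ ⟨_, squareParam_mem hB x⟩).trans
    (inner_self_eq_norm_sq_to_K (B ⟨_, squareParam_mem hB x⟩))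
  rw [norm_sq_energyVec, apply_waveParam, coe_waveParam, ← Submodule.coe_inner, h2, norm_smul,
    ← Submodule.coe_norm, h1]
  norm_cast
  change ‖x - cayleyTransform hB (cayleyTransform hB x)‖ ^ 2 + _ = _
  ring

/-- The map `x ↦ (u, c B u)`, where `u = (I - T)² x`. -/
def waveMap (c : ℂ) : K →L[ℂ] EnergySpace hL :=
  LinearMap.mkContinuous
    { toFun := fun x => energyVec hL (waveParam hB hBL x) (c • (B ⟨_, squareParam_mem hB x⟩ : K))
      map_add' := fun x y => by
        rw [← energyVec_add, map_add, ← smul_add, ← Submodule.coe_add, apply_squareParam,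
          apply_squareParam, apply_squareParam, ← smul_add, map_add, map_add]
        congr 4
        abel
      map_smul' := fun d x => by
        rw [RingHom.id_apply, ← energyVec_smul, map_smul, apply_squareParam, apply_squareParam,
          map_smul, map_smul, ← smul_sub, smul_comm Complex.I d, Submodule.coe_smul,
          smul_comm c d] }
    (2 * √(1 + ‖c‖ ^ 2)) fun x => by
      refine abs_le_of_sq_le_sq' ?_ (by positivity) |>.2
      change ‖energyVec hL _ _‖ ^ 2 ≤ _
      rw [norm_sq_waveVec, mul_pow, mul_pow, Real.sq_sqrt (by positivity)]
      have h := norm_sub_le x (cayleyTransform hB (cayleyTransform hB x))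
      rw [norm_cayleyTransform, norm_cayleyTransform] at h
      have h' := pow_le_pow_left₀ (norm_nonneg _) h 2
      have := mul_le_mul_of_nonneg_left h' (by positivity : 0 ≤ 1 + ‖c‖ ^ 2)
      linarith

theorem waveMap_apply (c : ℂ) (x : K) : waveMap hB hBL hL c x =
    energyVec hL (waveParam hB hBL x) (c • (B ⟨_, squareParam_mem hB x⟩ : K)) := rfl

theorem norm_waveMap_of_comm {S : K →L[ℂ] K} (hS : ∀ x, ‖S x‖ = ‖x‖)
    (hST : ∀ x, S (cayleyTransform hB x) = cayleyTransform hB (S x)) (c : ℂ) (x : K) :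
    ‖waveMap hB hBL hL c (S x)‖ = ‖waveMap hB hBL hL c x‖ := by
  refine (sq_eq_sq₀ (norm_nonneg _) (norm_nonneg _)).1 ?_
  rw [waveMap_apply, waveMap_apply, norm_sq_waveVec, norm_sq_waveVec, ← hST, ← hST, ← map_sub, hS]

theorem waveSubspace_eq_closure_range (c : ℂ) :
    waveSubspace hL B c = closure (Set.range (waveMap hB hBL hL c)) := by
  refine congrArg closure (Set.ext fun y => ⟨?_, ?_⟩)
  · rintro ⟨u, hu, h, rfl⟩
    obtain ⟨x, hx⟩ := exists_eq_squareParam hB u hu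
    obtain rfl : u = ⟨_, squareParam_mem hB x⟩ := Subtype.ext hx
    exact ⟨x, rfl⟩
  · rintro ⟨x, rfl⟩
    exact ⟨⟨_, squareParam_mem hB x⟩, apply_squareParam_mem hB x, (waveParam hB hBL x).2, rfl⟩

variable {W : ℝ → (EnergySpace hL ≃ₗᵢ[ℂ] EnergySpace hL)}

theorem IsWaveGroup.isUnitaryGroup (hW : IsWaveGroup hL W) : IsUnitaryGroup W :=
  ⟨hW.zero, hW.add, hW.continuous⟩

/-- For `u = (I - T)² (x - T x)` the component `c B u = c i (I - T)² (x + T x)` lies again in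
`𝒟(L)`, so the generator formula applies; `c² = -1` matches the second components. -/
theorem IsWaveGroup.hasDerivAt_waveMap (hW : IsWaveGroup hL W) {c : ℂ} (hc : c * c = -1) (x : K) :
    HasDerivAt (fun t => W t (waveMap hB hBL hL c (x - cayleyTransform hB x)))
      ((c * Complex.I) • waveMap hB hBL hL c (x + cayleyTransform hB x)) 0 := by
  set T := cayleyTransform hB with hT
  have h := hW.generator (waveParam hB hBL (x - T x))
    ((c * Complex.I) • waveParam hB hBL (x + T x))
  have h1 : (((c * Complex.I) • waveParam hB hBL (x + T x) : L.domain) : 𝔥) =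
      c • (B ⟨_, squareParam_mem hB (x - T x)⟩ : K) := by
    rw [apply_squareParam, Submodule.coe_smul, coe_waveParam, ← hT, mul_smul, squareParam_apply,
      ← Submodule.coe_smul]
    simp only [map_sub, map_add, ← hT]
    congr 3
    abel
  have h2 : -L (waveParam hB hBL (x - T x)) = (c * Complex.I) •
      (c • (B ⟨_, squareParam_mem hB (x + T x)⟩ : K) : 𝔥) := by
    have h3 : c * Complex.I * c * Complex.I = 1 := by
      linear_combination Complex.I * Complex.I * hc - Complex.I_mul_I
    rw [apply_waveParam, apply_apply_squareParam, apply_squareParam, ← hT, Submodule.coe_smul,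
      smul_smul, smul_smul, h3, one_smul, ← Submodule.coe_neg, neg_neg]
    congr 1
    simp only [map_sub, map_add]
    module
  rw [h1, h2, energyVec_smul, ← waveMap_apply, ← waveMap_apply] at h
  exact h

end WaveMap

/-! ### Closed spans of orbits -/

section OrbitSpan

variable {H : Type*} [NormedAddCommGroup H] [InnerProductSpace ℂ H] {W : ℝ → (H ≃ₗᵢ[ℂ] H)}
  {D : Set H}

theorem subset_orbitSpan (hW : IsUnitaryGroup W) : D ⊆ orbitSpan W D := fun x hx =>
  Submodule.le_topologicalClosure _
    (Submodule.subset_span (Set.mem_iUnion.2 ⟨0, x, hx, hW.zero x⟩))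

theorem isClosed_orbitSpan : IsClosed (orbitSpan W D : Set H) :=
  Submodule.isClosed_topologicalClosure _

theorem map_mem_orbitSpan (hW : IsUnitaryGroup W) (t : ℝ) {x : H} (hx : x ∈ orbitSpan W D) :
    W t x ∈ orbitSpan W D := by
  have h : orbitSpan W D ≤ (orbitSpan W D).comap ((W t).toLinearEquiv : H →ₗ[ℂ] H) := by
    refine Submodule.topologicalClosure_minimal _ (Submodule.span_le.2 ?_)
      (isClosed_orbitSpan.preimage (W t).continuous)
    intro y hy
    obtain ⟨s, z, hz, rfl⟩ := Set.mem_iUnion.1 hy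
    refine Submodule.le_topologicalClosure _ (Submodule.subset_span ?_)
    exact Set.mem_iUnion.2 ⟨t + s, z, hz, hW.add t s z⟩
  exact h hx

end OrbitSpan

/-! ### Asymptotic equivalence -/

section Equivalence

variable {𝔥 : Type*} [NormedAddCommGroup 𝔥] [InnerProductSpace ℂ 𝔥]
  {L : 𝔥 →ₗ.[ℂ] 𝔥} {K : Submodule ℂ 𝔥} {B : K →ₗ.[ℂ] K} {V : K →ₗᵢ[ℂ] K}

/-- The operator `V`, as a unitary map onto its range. -/
def rangeEquiv (V : K →ₗᵢ[ℂ] K) : K ≃ₗᵢ[ℂ] rangeSubspace V := (K.subtypeₗᵢ.comp V).equivRange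

theorem rangeEquiv_mem_domain (u : K) :
    rangeEquiv V u ∈ (transformedOperator B V).domain ↔ u ∈ B.domain := by
  change (rangeEquiv V).symm _ ∈ B.domain ↔ _
  rw [LinearIsometryEquiv.symm_apply_apply]

theorem transformedOperator_apply (u : B.domain)
    (h : rangeEquiv V (u : K) ∈ (transformedOperator B V).domain) :
    transformedOperator B V ⟨rangeEquiv V (u : K), h⟩ = rangeEquiv V (B u) := by
  change rangeEquiv V (B ⟨_, _⟩) = _
  congr 3
  exact LinearIsometryEquiv.symm_apply_apply _ _

variable [CompleteSpace 𝔥] (hL : IsPositiveSelfAdjoint L)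

/-- Since `V` commutes with `B`, `B_V` is a restriction of `B`. This is the trivial half of the
equivalence. -/
theorem waveSubspace_transformedOperator_subset (hVB : CommutesWith V.toContinuousLinearMap B)
    (c : ℂ) : waveSubspace hL (transformedOperator B V) c ⊆ waveSubspace hL B c := by
  refine closure_mono ?_
  rintro _ ⟨⟨w, hw⟩, hBw, h, rfl⟩
  obtain ⟨u, rfl⟩ := (rangeEquiv V).surjective w
  have hu : u ∈ B.domain := (rangeEquiv_mem_domain u).1 hw
  rw [transformedOperator_apply ⟨u, hu⟩, rangeEquiv_mem_domain] at hBw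
  obtain ⟨h1, h2⟩ := hVB ⟨u, hu⟩
  obtain ⟨h3, -⟩ := hVB ⟨_, hBw⟩
  refine ⟨⟨_, h1⟩, h2 ▸ h3, h, ?_⟩
  rw [transformedOperator_apply ⟨u, hu⟩, h2]
  rfl

variable [CompleteSpace K]

theorem waveMap_map_mem (hB : IsSimpleMaximalSymmetric B)
    (hVB : CommutesWith V.toContinuousLinearMap B)
    (hBL : ExtendsSquare L B) (c : ℂ) (x : K) :
    waveMap hB hBL hL c (V x) ∈ waveSubspace hL (transformedOperator B V) c := by
  refine subset_closure ?_
  have hV : ∀ x, V (cayleyTransform hB x) = cayleyTransform hB (V x) :=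
    fun x => (cayleyTransform_comm hB hVB x).symm
  have h1 : squareParam hB (V x) = V (squareParam hB x) := by
    simp only [squareParam_apply, map_sub, hV]
  have h2 : V (B ⟨_, squareParam_mem hB x⟩) = B ⟨_, squareParam_mem hB (V x)⟩ := by
    simp only [apply_squareParam, map_smul, map_sub, hV]
  have h3 : (rangeEquiv V (squareParam hB x) : 𝔥) =
      (squareParam hB (V x) : K) := by rw [h1]; rfl
  have h4 := (rangeEquiv_mem_domain (V := V) _).2 (squareParam_mem hB x)
  have h5 := transformedOperator_apply ⟨_, squareParam_mem hB x⟩ h4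
  refine ⟨⟨_, h4⟩, ?_, h3 ▸ (waveParam hB hBL (V x)).2, ?_⟩
  · rw [h5, rangeEquiv_mem_domain]
    exact apply_squareParam_mem hB x
  · rw [waveMap_apply, h5, ← h2]
    congr 1
    exact Subtype.ext h3.symm

variable {W : ℝ → (EnergySpace hL ≃ₗᵢ[ℂ] EnergySpace hL)}

theorem asymptoticallyEquivalent_waveSubspace (hW : IsWaveGroup hL W)
    (hB : IsSimpleMaximalSymmetric B) (hBL : ExtendsSquare L B)
    (hVB : CommutesWith V.toContinuousLinearMap B) {c : ℂ} (hc : c = Complex.I ∨ c = -Complex.I)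
    {a : ℕ → ℂ} {S : K →L[ℂ] K} (hS : IsInnerFunctionOf (cayleyTransform hB) a S)
    (hVS : LinearMap.range V.toLinearMap = LinearMap.range S.toLinearMap) :
    AsymptoticallyEquivalent W (waveSubspace hL B c)
      (waveSubspace hL (transformedOperator B V) c) := by
  have hW' := hW.isUnitaryGroup
  refine ⟨?_, (waveSubspace_transformedOperator_subset hL hVB c).trans (subset_orbitSpan hW')⟩
  set G := orbitSpan W (waveSubspace hL (transformedOperator B V) c) with hG
  rw [waveSubspace_eq_closure_range hB hBL hL]
  refine closure_minimal ?_ isClosed_orbitSpan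
  rintro _ ⟨x, rfl⟩
  have hT := norm_le_one_of_isometry (norm_cayleyTransform hB)
  have hJS := norm_waveMap_of_comm hB hBL hL hS.norm_map hS.comm c
  have hx : waveMap hB hBL hL c (S x) ∈ G := by
    obtain ⟨y, hy⟩ : S x ∈ LinearMap.range V.toLinearMap := hVS ▸ ⟨x, rfl⟩
    have hy' : V y = S x := hy
    rw [← hy']
    exact subset_orbitSpan hW' (waveMap_map_mem hL hB hVB hBL c y)
  have hGW : ∀ t, ∀ y ∈ G, W t y ∈ G := fun t y hy => map_mem_orbitSpan hW' t hy
  -- For `c = i` the Cayley transform of the generator of `W(t)` extends `T`; for `c = -i` that of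
  -- the reversed group does, and the invariant subspaces are the same.
  rcases hc with rfl | rfl
  · refine hW'.mem_of_mem hT (fun y => ?_) hS.norm_coeff_le hS.tendsto hJS isClosed_orbitSpan hGW hx
    have h := hW.hasDerivAt_waveMap hB hBL hL Complex.I_mul_I y
    rwa [Complex.I_mul_I, neg_one_smul] at h
  · refine hW'.neg.mem_of_mem hT (fun y => ?_) hS.norm_coeff_le hS.tendsto hJS isClosed_orbitSpan
      (fun t => hGW (-t)) hx
    have h := hW.hasDerivAt_waveMap hB hBL hL (c := -Complex.I) (by simp) y
    rw [neg_mul, Complex.I_mul_I, neg_neg, one_smul] at h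
    have h2 : HasDerivAt (fun t : ℝ => -t) (-1) 0 := hasDerivAt_neg 0
    rw [← neg_zero] at h
    have h3 := h.scomp (0 : ℝ) h2
    rwa [neg_one_smul] at h3

end Equivalence

theorem corollary2p7 {𝔥 : Type*} [NormedAddCommGroup 𝔥] [InnerProductSpace ℂ 𝔥] [CompleteSpace 𝔥]
    (L : 𝔥 →ₗ.[ℂ] 𝔥) (hL : IsPositiveSelfAdjoint L)
    (W : ℝ → (EnergySpace hL ≃ₗᵢ[ℂ] EnergySpace hL)) (hW : IsWaveGroup hL W)
    (𝔥₀ : Submodule ℂ 𝔥) [CompleteSpace 𝔥₀]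
    (B : 𝔥₀ →ₗ.[ℂ] 𝔥₀) (hB : IsSimpleMaximalSymmetric B) (hBL : ExtendsSquare L B)
    (V : 𝔥₀ →ₗᵢ[ℂ] 𝔥₀) (hVB : CommutesWith V.toContinuousLinearMap B)
    (hab : Module.finrank ℂ (defectSpace B (-Complex.I)) = 1 ∨
      IsHyperinvariant (LinearMap.range V.toLinearMap) (cayleyTransform hB)) :
    AsymptoticallyEquivalent W (outgoingSubspace hL B)
        (outgoingSubspace hL (transformedOperator B V)) ∧
      AsymptoticallyEquivalent W (incomingSubspace hL B)
        (incomingSubspace hL (transformedOperator B V)) ∧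
      ∃ (ψ : ℂ → ℂ) (S : 𝔥₀ →L[ℂ] 𝔥₀), IsInnerUpperHalfPlane ψ ∧ IsFunctionOf hB ψ S ∧
        LinearMap.range V.toLinearMap = LinearMap.range S.toLinearMap := by
  have hV : ∀ x, V (cayleyTransform hB x) = cayleyTransform hB (V x) :=
    fun x => (cayleyTransform_comm hB hVB x).symm
  have hT := norm_cayleyTransform hB
  have hp := isPure_cayleyTransform hB
  obtain ⟨a, S, hS, hVS⟩ : ∃ a S, IsInnerFunctionOf (cayleyTransform hB) a S ∧
      LinearMap.range V.toLinearMap = LinearMap.range S.toLinearMap := by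
    rcases hab with h | h
    · exact exists_isInnerFunctionOf_of_finrank hT hp V hV (defectSpace_eq_wandering hB ▸ h)
    · exact exists_isInnerFunctionOf_of_isHyperinvariant hT hp V hV h
  exact ⟨asymptoticallyEquivalent_waveSubspace hL hW hB hBL hVB (Or.inl rfl) hS hVS,
    asymptoticallyEquivalent_waveSubspace hL hW hB hBL hVB (Or.inr rfl) hS hVS,
    halfPlaneSum a, S, isInnerUpperHalfPlane_halfPlaneSum hS.hasSum hS.norm_le,
    isFunctionOf_halfPlaneSum hB hS, hVS⟩

end
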